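/- **Setting.** Let $\Sigma$ be a Riemann surface and $n\ge 0$. Equip the trivial bundle $\underline{\mathbb C}^{n+2}=\Sigma\times(\mathbb R^{n+1,1})^{\mathbb C}$ with the complex bilinear extension $(\cdot,\cdot)$ of the Lorentz metric of $\mathbb R^{n+1,1}$, with complex conjugation, and with the trivial flat connection $d$; ${}^\perp$ denotes the orthogonal with respect to $(\cdot,\cdot)$, and $u\wedge v$ is the skew endomorphism $w\mapsto(u,w)v-(v,w)u$. Bundles, sections and forms are smooth; $\omega^{1,0},\omega^{0,1}$ are the type components of a complex-valued $1$-form $\omega$. For a subbundle $V\subset\underline{\mathbb C}^{n+2}$ that is non-degenerate (the metric restricts non-degenerately to its fibres), let $\pi_V,\pi_{V^\perp}$ be the orthogonal projections, $\rho=\pi_V-\pi_{V^\perp}$, $\mathcal D_V=\pi_V\circ d\circ\pi_V+\pi_{V^\perp}\circ d\circ\pi_{V^\perp}$ and $\mathcal N_V=d-\mathcal D_V$. Given a $1$-form $q$ with values in $\wedge^2V\oplus\wedge^2V^\perp$, $V$ is *$q$-constrained harmonic* if for every $\lambda\in\mathbb C\setminus\{0\}$ the connection $$d^{\lambda,q}_V=\mathcal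 D_V+\lambda^{-1}\mathcal N_V^{1,0}+\lambda\,\mathcal N_V^{0,1}+(\lambda^{-2}-1)q^{1,0}+(\lambda^2-1)q^{0,1}$$ is flat. If moreover $\overline V=V$ and $q$ is real, $V$ is a *real $q$-constrained harmonic bundle*. For $\mu\in\mathbb C\setminus\{0\}$ and a null line subbundle $L$ with $\rho L\cap L^\perp=\{0\}$ at every point, let $p_{\mu,L}(\lambda)$, respectively $q_{\mu,L}(\lambda)$, $\lambda\in\mathbb P^1\setminus\{\pm\mu\}$, be the orthogonal transformation acting as $\frac{\mu-\lambda}{\mu+\lambda}$, respectively $\frac{\lambda-\mu}{\lambda+\mu}$, on $L$, as $1$ on $(L\oplus\rho L)^\perp$, and as the inverse scalar on $\rho L$ (at $\lambda=\infty$ the scalars on $L$ are $-1$ and $1$, respectively). **Theorem.** Let $V$ be a real $q$-constrained harmonic bundle over $\Sigma$, let $\alpha\in\mathbb C\setminus(S^1\cup\{0\})$ and $\beta=\overline\alpha^{\,-1}$, let $L^\alpha$ be a $d^{\alpha,q}_V$-parallel null line subbundle of $\underline{\mathbb C}^{n+2}$, and let $L^\beta=\overline{L^\alpha}$ and $\hat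 L=p_{\alpha,L^\alpha}(\beta)L^\beta$. Assume that $\rho L^\alpha\cap(L^\alpha)^\perp=\{0\}$ and $\rho\hat L\cap\hat L^\perp=\{0\}$ at every point of $\Sigma$. Put $r^*=q_{\beta,\hat L}\,p_{\alpha,L^\alpha}$ and $$V^*=r^*(1)^{-1}V,\qquad q^*=\mathrm{Ad}_{r^*(1)^{-1}}\bigl(\mathrm{Ad}_{r^*(0)}q^{1,0}+\mathrm{Ad}_{r^*(\infty)}q^{0,1}\bigr).$$ Then the Bäcklund transform $V^*$ of $V$ of parameters $\alpha,L^\alpha$ is a real $q^*$-constrained harmonic bundle; in particular it is a non-degenerate subbundle and $q^*$ takes values in $\wedge^2V^*\oplus\wedge^2(V^*)^\perp$. -/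

import Mathlib

open scoped Manifold ContDiff

noncomputable section

namespace HarmonicBundles

/-! ### Linear algebra of the complexified Lorentz space -/

/-- `ℂⁿ⁺²`, the complexification of `ℝ^{n+1,1}`; complex conjugation is the componentwise `star`. -/
abbrev CVec (n : ℕ) : Type := Fin (n + 2) → ℂ

/-- Endomorphisms of `ℂⁿ⁺²`. -/
abbrev CEnd (n : ℕ) : Type := CVec n →L[ℂ] CVec n

/-- The complex bilinear extension of the Lorentz metric of `ℝ^{n+1,1}`:
`(u, v) = u₀ v₀ + ⋯ + uₙ vₙ - uₙ₊₁ vₙ₊₁`. -/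
def metric (n : ℕ) : LinearMap.BilinForm ℂ (CVec n) :=
  LinearMap.mk₂ ℂ
    (fun u v => (∑ i : Fin (n + 1), u i.castSucc * v i.castSucc)
      - u (Fin.last (n + 1)) * v (Fin.last (n + 1)))
    (fun u u' v => by simp only [Pi.add_apply, add_mul, Finset.sum_add_distrib]; ring)
    (fun c u v => by
      simp only [Pi.smul_apply, smul_eq_mul, mul_sub, Finset.mul_sum, mul_assoc])
    (fun u v v' => by simp only [Pi.add_apply, mul_add, Finset.sum_add_distrib]; ring)
    (fun c u v => by
      simp only [Pi.smul_apply, smul_eq_mul, mul_sub, Finset.mul_sum, mul_left_comm])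

/-- The orthogonal complement `P^⊥` with respect to the (bilinear) metric. -/
def perp {n : ℕ} (P : Submodule ℂ (CVec n)) : Submodule ℂ (CVec n) :=
  (metric n).orthogonal P

/-- The complex conjugate `{v̄ | v ∈ P}` of a subspace. -/
def conjSpace {n : ℕ} (P : Submodule ℂ (CVec n)) : Submodule ℂ (CVec n) where
  carrier := {v | star v ∈ P}
  add_mem' := fun {a b} ha hb => by
    simpa only [Set.mem_ofPred_eq, star_add] using P.add_mem ha hb
  zero_mem' := by simp
  smul_mem' := fun c {v} hv => by
    simpa only [Set.mem_ofPred_eq, star_smul] using P.smul_mem (star c) hv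

open Classical in
/-- The projection of `ℂⁿ⁺²` onto `P` along the complement `Q` (junk value `0` if `P` and `Q` are
not complementary). -/
def projAlong {n : ℕ} (P Q : Submodule ℂ (CVec n)) : CEnd n :=
  if h : IsCompl P Q then LinearMap.toContinuousLinearMap (P.projection Q h) else 0

/-- Orthogonal projection onto a non-degenerate subspace `P`. -/
def orthProj {n : ℕ} (P : Submodule ℂ (CVec n)) : CEnd n := projAlong P (perp P)

/-- Reflection across `P`: `ρ = π_P - π_{P^⊥}`. -/
def reflection {n : ℕ} (P : Submodule ℂ (CVec n)) : CEnd n := orthProj P - orthProj (perp P)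

/-- The image `T P` of a subspace under an endomorphism. -/
def image {n : ℕ} (T : CEnd n) (P : Submodule ℂ (CVec n)) : Submodule ℂ (CVec n) :=
  P.map (T : CVec n →ₗ[ℂ] CVec n)

/-- `u ∧ v` as an element of the orthogonal algebra: `(u ∧ v)(w) = (u, w) v - (v, w) u`. -/
def wedge {n : ℕ} (u v : CVec n) : CEnd n :=
  LinearMap.toContinuousLinearMap ((metric n u).smulRight v - (metric n v).smulRight u)

/-- `∧² P`, as a subspace of endomorphisms. -/
def wedgeSq {n : ℕ} (P : Submodule ℂ (CVec n)) : Submodule ℂ (CEnd n) :=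
  Submodule.span ℂ {ξ | ∃ u ∈ P, ∃ v ∈ P, ξ = wedge u v}

/-- Left multiplication `ξ ↦ T ξ`, as a real-linear map on endomorphisms. -/
def mulLeft {n : ℕ} (T : CEnd n) : CEnd n →L[ℝ] CEnd n :=
  (ContinuousLinearMap.compL ℂ (CVec n) (CVec n) (CVec n) T).restrictScalars ℝ

/-- `Ad_T : ξ ↦ T ξ T⁻¹`, for `T` invertible, as a real-linear map on endomorphisms. -/
def Ad {n : ℕ} (T : CEnd n) : CEnd n →L[ℝ] CEnd n :=
  ((ContinuousLinearMap.compL ℂ (CVec n) (CVec n) (CVec n)).flip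
    (Ring.inverse T)).restrictScalars ℝ ∘L mulLeft T

/-! ### Forms and connections on trivial bundles over a Riemann surface

A Riemann surface is a space `M` charted on `ℂ` with holomorphic changes of charts.  Its underlying
smooth surface has the same charts, with model `𝓘(ℝ, ℂ)`. -/

section Forms

variable {M : Type*} [TopologicalSpace M] [ChartedSpace ℂ M]

/-- Differential `1`-forms on the real surface `M` with values in `E`.  If `E` is complex, these are
complex-valued forms, that is, sections of `Hom_ℂ(TM^ℂ, E)`. -/
abbrev OneForm (M : Type*) [TopologicalSpace M] [ChartedSpace ℂ M]
    (E : Type*) [NormedAddCommGroup E] [NormedSpace ℂ E] : Type _ :=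
  (x : M) → TangentSpace 𝓘(ℝ, ℂ) x →L[ℝ] E

/-- The complex structure `J` of `M`.  The model `ℂ` of `T_x M` is identified with it through a chart
of the atlas; as changes of charts are holomorphic, multiplication by `i` does not depend on it. -/
def complexStructure (x : M) : TangentSpace 𝓘(ℝ, ℂ) x →L[ℝ] TangentSpace 𝓘(ℝ, ℂ) x :=
  (ContinuousLinearMap.mul ℝ ℂ Complex.I : ℂ →L[ℝ] ℂ)

variable {E : Type*} [NormedAddCommGroup E] [NormedSpace ℂ E]

/-- The `(1,0)`-part `X ↦ (η(X) - i η(JX)) / 2`. -/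
def part10 (η : OneForm M E) : OneForm M E :=
  fun x => (1 / 2 : ℂ) • (η x - Complex.I • (η x).comp (complexStructure x))

/-- The `(0,1)`-part `X ↦ (η(X) + i η(JX)) / 2`. -/
def part01 (η : OneForm M E) : OneForm M E :=
  fun x => (1 / 2 : ℂ) • (η x + Complex.I • (η x).comp (complexStructure x))

/-- The flat derivative `d f` of a map into a vector space. -/
def diff (f : M → E) : OneForm M E := fun x => mfderiv 𝓘(ℝ, ℂ) 𝓘(ℝ, E) f x

/-- A `1`-form read in the chart at `x₀`: its pull-back by the inverse of the chart. -/
def inChart (η : OneForm M E) (x₀ : M) (z : ℂ) : ℂ →L[ℝ] E :=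
  (η ((chartAt ℂ x₀).symm z)).comp (mfderiv 𝓘(ℝ, ℂ) 𝓘(ℝ, ℂ) (chartAt ℂ x₀).symm z)

/-- Smoothness of a `1`-form. -/
def IsSmoothForm (η : OneForm M E) : Prop :=
  ∀ x₀ : M, ContDiffOn ℝ ∞ (inChart η x₀) (chartAt ℂ x₀).target

variable {n : ℕ}

/-- Flatness of the connection `d + A` on the trivial bundle with fibre `ℂⁿ⁺²`: vanishing of its
curvature `(dA + A ∧ A)(X, Y) = X(A(Y)) - Y(A(X)) + [A(X), A(Y)]`, `X, Y` constant in a chart. -/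
def IsFlat (A : OneForm M (CEnd n)) : Prop :=
  ∀ x₀ : M, ∀ z ∈ (chartAt ℂ x₀).target, ∀ X Y : ℂ,
    fderiv ℝ (inChart A x₀) z X Y - fderiv ℝ (inChart A x₀) z Y X
      + (inChart A x₀ z X * inChart A x₀ z Y - inChart A x₀ z Y * inChart A x₀ z X) = 0

/-! ### Subbundles of the trivial bundle with fibre `ℂⁿ⁺²` -/

/-- `V` is a smooth complex subbundle: near every point it has a smooth frame. -/
def IsSubbundle (V : M → Submodule ℂ (CVec n)) : Prop :=
  ∀ x₀ : M, ∃ U : Set M, IsOpen U ∧ x₀ ∈ U ∧ ∃ (k : ℕ) (s : Fin k → M → CVec n),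
    (∀ i, ContMDiffOn 𝓘(ℝ, ℂ) 𝓘(ℝ, CVec n) ∞ (s i) U) ∧
    ∀ x ∈ U, LinearIndependent ℂ (fun i => s i x) ∧
      Submodule.span ℂ (Set.range fun i => s i x) = V x

/-- `V` is non-degenerate: the metric restricts to a non-degenerate form on every fibre. -/
def IsNondegenerate (V : M → Submodule ℂ (CVec n)) : Prop :=
  ∀ x, ((metric n).restrict (V x)).Nondegenerate

/-- `V` is real: it coincides with its complex conjugate. -/
def IsRealBundle (V : M → Submodule ℂ (CVec n)) : Prop := ∀ x, conjSpace (V x) = V x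

/-- `q` is real: `q(X)` is the complex extension of a real endomorphism, for `X` real. -/
def IsRealForm (q : OneForm M (CEnd n)) : Prop :=
  ∀ x (X : TangentSpace 𝓘(ℝ, ℂ) x) (v : CVec n), star (q x X v) = q x X (star v)

/-- `L` is a null line subbundle. -/
structure IsNullLineSubbundle (L : M → Submodule ℂ (CVec n)) : Prop where
  isSubbundle : IsSubbundle L
  finrank_eq_one : ∀ x, Module.finrank ℂ (L x) = 1
  isNull : ∀ x, ∀ u ∈ L x, ∀ v ∈ L x, metric n u v = 0

/-- `L` is parallel for the connection `d + A`: covariant derivatives of local sections of `L` are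
again in `L`. -/
def IsParallel (A : OneForm M (CEnd n)) (L : M → Submodule ℂ (CVec n)) : Prop :=
  ∀ (U : Set M) (s : M → CVec n), IsOpen U → ContMDiffOn 𝓘(ℝ, ℂ) 𝓘(ℝ, CVec n) ∞ s U →
    (∀ x ∈ U, s x ∈ L x) →
    ∀ x ∈ U, ∀ X : TangentSpace 𝓘(ℝ, ℂ) x, diff s x X + A x X (s x) ∈ L x

/-! ### Constrained harmonic bundles -/

/-- The form `𝒩_V = d - 𝒟_V`, where `𝒟_V s = π_V d(π_V s) + π_{V^⊥} d(π_{V^⊥} s)` is the sum of the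
connections induced by `d` on `V` and `V^⊥`.  By the Leibniz rule,
`𝒩_V = -(π_V ∘ dπ_V + π_{V^⊥} ∘ dπ_{V^⊥})`. -/
def formN (V : M → Submodule ℂ (CVec n)) : OneForm M (CEnd n) := fun x =>
  -(mulLeft (orthProj (V x)) ∘L diff (fun y => orthProj (V y)) x
    + mulLeft (orthProj (perp (V x))) ∘L diff (fun y => orthProj (perp (V y))) x)

/-- The connection form, with respect to `d`, of
`d_V^{μ,q} = 𝒟_V + μ⁻¹ 𝒩_V^{1,0} + μ 𝒩_V^{0,1} + (μ⁻² - 1) q^{1,0} + (μ² - 1) q^{0,1}`,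
where `𝒟_V = d - 𝒩_V`. -/
def connForm (V : M → Submodule ℂ (CVec n)) (q : OneForm M (CEnd n)) (μ : ℂ) :
    OneForm M (CEnd n) := fun x =>
  -formN V x + μ⁻¹ • part10 (formN V) x + μ • part01 (formN V) x
    + (μ⁻¹ ^ 2 - 1) • part10 q x + (μ ^ 2 - 1) • part01 q x

/-- `V` is a `q`-constrained harmonic bundle. -/
structure IsConstrainedHarmonic (V : M → Submodule ℂ (CVec n)) (q : OneForm M (CEnd n)) :
    Prop where
  isSubbundle : IsSubbundle V
  isNondegenerate : IsNondegenerate V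
  isSmoothForm : IsSmoothForm q
  values : ∀ x (X : TangentSpace 𝓘(ℝ, ℂ) x), q x X ∈ wedgeSq (V x) ⊔ wedgeSq (perp (V x))
  flat : ∀ μ : ℂ, μ ≠ 0 → IsFlat (connForm V q μ)

/-- `V` is a real `q`-constrained harmonic bundle. -/
structure IsRealConstrainedHarmonic (V : M → Submodule ℂ (CVec n)) (q : OneForm M (CEnd n)) :
    Prop extends IsConstrainedHarmonic V q where
  isRealBundle : IsRealBundle V
  isRealForm : IsRealForm q

end Forms

/-! ### Bäcklund transformation -/

/-- The endomorphism equal to `c` on `L`, to `1` on `(L ⊕ ρL)^⊥` and to `c⁻¹` on `ρL`, where `ρ` is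
the reflection across `V`. -/
def threeEigen {n : ℕ} (V L : Submodule ℂ (CVec n)) (c : ℂ) : CEnd n :=
  let L' := image (reflection V) L
  c • projAlong L (L' ⊔ perp (L ⊔ L')) + projAlong (perp (L ⊔ L')) (L ⊔ L')
    + c⁻¹ • projAlong L' (L ⊔ perp (L ⊔ L'))

/-- `p_{α,L}(μ)`, `μ ∈ ℙ¹`: eigenvalue `(α - μ) / (α + μ)` on `L`, which is `-1` at `μ = ∞`. -/
def pTransf {n : ℕ} (V : Submodule ℂ (CVec n)) (α : ℂ) (L : Submodule ℂ (CVec n))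
    (μ : OnePoint ℂ) : CEnd n :=
  threeEigen V L (OnePoint.elim μ (-1) fun t => (α - t) / (α + t))

/-- `q_{α,L}(μ)`, `μ ∈ ℙ¹`: eigenvalue `(μ - α) / (μ + α)` on `L`, which is `1` at `μ = ∞`. -/
def qTransf {n : ℕ} (V : Submodule ℂ (CVec n)) (α : ℂ) (L : Submodule ℂ (CVec n))
    (μ : OnePoint ℂ) : CEnd n :=
  threeEigen V L (OnePoint.elim μ 1 fun t => (t - α) / (t + α))

/-- `L̂ = p_{α,Lα}(β) Lβ`. -/
def hatLine {n : ℕ} (V : Submodule ℂ (CVec n)) (α β : ℂ) (Lα Lβ : Submodule ℂ (CVec n)) :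
    Submodule ℂ (CVec n) :=
  image (pTransf V α Lα (β : OnePoint ℂ)) Lβ

/-- `r* = q_{β,L̂} p_{α,Lα}`. -/
def rStar {n : ℕ} (V : Submodule ℂ (CVec n)) (α β : ℂ) (Lα Lβ : Submodule ℂ (CVec n))
    (μ : OnePoint ℂ) : CEnd n :=
  qTransf V β (hatLine V α β Lα Lβ) μ * pTransf V α Lα μ

section Transform

variable {M : Type*} [TopologicalSpace M] [ChartedSpace ℂ M] {n : ℕ}

/-- The Bäcklund transform `V* = r*(1)⁻¹ V` of parameters `α, β, Lα, Lβ`. -/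
def backlundBundle (V : M → Submodule ℂ (CVec n)) (α β : ℂ) (Lα Lβ : M → Submodule ℂ (CVec n)) :
    M → Submodule ℂ (CVec n) := fun x =>
  image (Ring.inverse (rStar (V x) α β (Lα x) (Lβ x) ((1 : ℂ) : OnePoint ℂ))) (V x)

/-- The multiplier
`q* = Ad_{r*(1)⁻¹} (Ad_{r*(0)} q^{1,0} + Ad_{r*(∞)} q^{0,1})`. -/
def backlundForm (V : M → Submodule ℂ (CVec n)) (q : OneForm M (CEnd n)) (α β : ℂ)
    (Lα Lβ : M → Submodule ℂ (CVec n)) : OneForm M (CEnd n) := fun x =>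
  (Ad (Ring.inverse (rStar (V x) α β (Lα x) (Lβ x) ((1 : ℂ) : OnePoint ℂ)))).comp
    ((Ad (rStar (V x) α β (Lα x) (Lβ x) ((0 : ℂ) : OnePoint ℂ))).comp (part10 q x)
      + (Ad (rStar (V x) α β (Lα x) (Lβ x) OnePoint.infty)).comp (part01 q x))

end Transform

end HarmonicBundles

end

open HarmonicBundles

noncomputable section

namespace HarmonicBundles

/-! ### Gauge transformations of connections on a domain of `ℂ` -/

section Gauge

variable {𝔸 : Type*} [NormedRing 𝔸] [NormedAlgebra ℂ 𝔸]

/-! In a chart, the connections of a constrained harmonic bundle are `d + A(λ)`, with `A` a Laurent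
polynomial of degrees -2 to 2. Its values are skew, it is flat for every `λ ≠ 0`, its negative
powers have type (1,0) and its positive ones type (0,1), and `A(-λ)` is the gauge transform of
`A(λ)` by the reflection `ρ`. `IsLax` collects these properties. Moreover `A(1) = 0`. Conversely, a
Lax family `B` such that `d + B(1)` is the gauge transform of `d` by some `g` becomes, after gauging
by `g⁻¹`, the family of the bundle with reflection `g⁻¹ρg` (`IsLax.curv_ofForms`). So it suffices to
produce a new Lax family and to know `g`.

The new family comes from dressing. Let `L` be a null line parallel at `λ = α`, with `ρL` not
orthogonal to `L`. By the twist, `ρL` is parallel at `-α`. Conjugation by `p(λ)` splits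
endomorphisms into weights. A skew endomorphism has no component of weight ±2, because `L` and `ρL`
are null. With `c = (α - λ)/(α + λ)` the gauged form is therefore `A(λ) + (c - 1) raise (A(λ) -
A(-α)) + (c⁻¹ - 1) lower (A(λ) - A(α))`. The differences vanish at the poles of their factors, so a
Laurent polynomial of the same degrees comes out (`IsParallelPair.dress_form`). Gauge invariance
gives flatness off `±α`, and continuity in `λ` gives it everywhere (`IsLax.dress`).

A second dressing is needed for reality. As `A(1/conj λ)` is the conjugate of `A(λ)`, the line `conj
L` is parallel at `β = 1/conj α`, and its image `L̂` under `p(β)` is parallel at `β` for the dressed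
family (`isParallelPair_hat`). Since `(λ - β)/(λ + β) = (β⁻¹ - λ⁻¹)/(β⁻¹ + λ⁻¹)`, dressing by `q` is
dressing by `p` with parameter `β⁻¹` after the substitution of `λ⁻¹` for `λ`, and `IsLax.dress`
applies again (`curv_dress_dress`).

Finally, dressing first by `L` or first by `conj L` gives the same result up to a left factor: this
is Bianchi permutability (`nullDress_permute`, `nullDress_permute_neg_one`). It yields an invertible
`K` commuting with `ρ` such that `conj r(λ) = K r(1/conj λ)` for `λ = 1, 0, ∞`
(`exists_conj_factor`). These three values determine the new bundle and its multiplier, and `K`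
cancels from both. -/

/-- The curvature of `d + A`. -/
def curv (A : ℂ → ℂ →L[ℝ] 𝔸) (z X Y : ℂ) : 𝔸 :=
  fderiv ℝ A z X Y - fderiv ℝ A z Y X + (A z X * A z Y - A z Y * A z X)

/-- The form `X ↦ a η(X) b`. -/
def sandwich (a b : 𝔸) (η : ℂ →L[ℝ] 𝔸) : ℂ →L[ℝ] 𝔸 :=
  (ContinuousLinearMap.mulLeftRight ℝ 𝔸 a b).comp η

@[simp] lemma sandwich_apply (a b : 𝔸) (η : ℂ →L[ℝ] 𝔸) (X : ℂ) :
    sandwich a b η X = a * η X * b := rfl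

lemma ContDiffOn.sandwich {Ω : Set ℂ} {a b : ℂ → 𝔸} {η : ℂ → ℂ →L[ℝ] 𝔸}
    (ha : ContDiffOn ℝ ∞ a Ω) (hb : ContDiffOn ℝ ∞ b Ω) (hη : ContDiffOn ℝ ∞ η Ω) :
    ContDiffOn ℝ ∞ (fun z => sandwich (a z) (b z) (η z)) Ω := by
  unfold HarmonicBundles.sandwich
  refine ContDiffOn.clm_comp (ContDiffOn.clm_apply ?_ hb) hη
  exact (ContinuousLinearMap.contDiff _).comp_contDiffOn ha

lemma fderiv_mul_apply {a b : ℂ → 𝔸} {z : ℂ} (ha : DifferentiableAt ℝ a z)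
    (hb : DifferentiableAt ℝ b z) (X : ℂ) :
    fderiv ℝ (fun y => a y * b y) z X = a z * fderiv ℝ b z X + fderiv ℝ a z X * b z := by
  have h := (ha.hasFDerivAt.mul' hb.hasFDerivAt).fderiv
  have h' : fderiv ℝ (fun y => a y * b y) z = _ := h
  rw [h']
  simp

lemma fderiv_congr_on {E : Type*} [NormedAddCommGroup E] [NormedSpace ℝ E] {Ω : Set ℂ}
    (hΩ : IsOpen Ω) {a b : ℂ → E} (h : ∀ z ∈ Ω, a z = b z) {z : ℂ} (hz : z ∈ Ω) :
    fderiv ℝ a z = fderiv ℝ b z :=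
  Filter.EventuallyEq.fderiv_eq (Filter.eventually_of_mem (hΩ.mem_nhds hz) h)

lemma differentiableAt_of_contDiffOn {E F : Type*} [NormedAddCommGroup E] [NormedSpace ℝ E]
    [NormedAddCommGroup F] [NormedSpace ℝ F] {Ω : Set F}
    (hΩ : IsOpen Ω) {a : F → E} (h : ContDiffOn ℝ ∞ a Ω) {z : F} (hz : z ∈ Ω) :
    DifferentiableAt ℝ a z :=
  (h.contDiffAt (hΩ.mem_nhds hz)).differentiableAt (by simp)

lemma contDiffOn_fderiv {E : Type*} [NormedAddCommGroup E] [NormedSpace ℝ E] {Ω : Set ℂ}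
    (hΩ : IsOpen Ω) {a : ℂ → E} (h : ContDiffOn ℝ ∞ a Ω) : ContDiffOn ℝ ∞ (fderiv ℝ a) Ω :=
  h.fderiv_of_isOpen hΩ (by simp)

lemma fderiv_apply_const {Ω : Set ℂ} (hΩ : IsOpen Ω) {A : ℂ → ℂ →L[ℝ] 𝔸}
    (hA : ContDiffOn ℝ ∞ A Ω) {z : ℂ} (hz : z ∈ Ω) (X Y : ℂ) :
    fderiv ℝ (fun y => A y Y) z X = fderiv ℝ A z X Y := by
  have h := ((differentiableAt_of_contDiffOn hΩ hA hz).hasFDerivAt.clm_apply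
    (hasFDerivAt_const Y z)).fderiv
  rw [h]; simp

lemma fderiv_fderiv_comm {E : Type*} [NormedAddCommGroup E] [NormedSpace ℝ E] {Ω : Set ℂ}
    (hΩ : IsOpen Ω) {g : ℂ → E}
    (hg : ContDiffOn ℝ ∞ g Ω) {z : ℂ} (hz : z ∈ Ω) (X Y : ℂ) :
    fderiv ℝ (fderiv ℝ g) z X Y = fderiv ℝ (fderiv ℝ g) z Y X :=
  ((hg.contDiffAt (hΩ.mem_nhds hz)).isSymmSndFDerivAt
    (by rw [minSmoothness_of_isRCLikeNormedField]; exact WithTop.coe_le_coe.2 le_top)) X Y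

lemma fderiv_inv_mul {Ω : Set ℂ} (hΩ : IsOpen Ω) {g h : ℂ → 𝔸} (hg : ContDiffOn ℝ ∞ g Ω)
    (hh : ContDiffOn ℝ ∞ h Ω) (hgh : ∀ z ∈ Ω, g z * h z = 1) {z : ℂ} (hz : z ∈ Ω) (X : ℂ) :
    g z * fderiv ℝ h z X = - (fderiv ℝ g z X * h z) := by
  have h1 := fderiv_mul_apply (differentiableAt_of_contDiffOn hΩ hg hz)
    (differentiableAt_of_contDiffOn hΩ hh hz) X
  rw [fderiv_congr_on hΩ hgh hz] at h1
  simp only [fderiv_fun_const, Pi.zero_apply, zero_apply] at h1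
  exact eq_neg_of_add_eq_zero_left h1.symm

/-- Gauge transformations conjugate the curvature. -/
theorem curv_gauge {Ω : Set ℂ} (hΩ : IsOpen Ω) {g h : ℂ → 𝔸} (hg : ContDiffOn ℝ ∞ g Ω)
    (hh : ContDiffOn ℝ ∞ h Ω) (hgh : ∀ z ∈ Ω, g z * h z = 1) (hhg : ∀ z ∈ Ω, h z * g z = 1)
    {A B : ℂ → ℂ →L[ℝ] 𝔸} (hA : ContDiffOn ℝ ∞ A Ω) (hB : ContDiffOn ℝ ∞ B Ω)
    (hAB : ∀ z ∈ Ω, ∀ X, B z X = g z * A z X * h z - fderiv ℝ g z X * h z)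
    {z : ℂ} (hz : z ∈ Ω) (X Y : ℂ) :
    curv B z X Y = g z * curv A z X Y * h z := by
  have dg := differentiableAt_of_contDiffOn hΩ hg hz
  have dh := differentiableAt_of_contDiffOn hΩ hh hz
  have dA : ∀ Y, DifferentiableAt ℝ (fun y => A y Y) z := fun Y =>
    (differentiableAt_of_contDiffOn hΩ hA hz).clm_apply (differentiableAt_const Y)
  have ddg : ∀ Y, DifferentiableAt ℝ (fun y => fderiv ℝ g y Y) z := fun Y =>
    (differentiableAt_of_contDiffOn hΩ (contDiffOn_fderiv hΩ hg) hz).clm_apply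
      (differentiableAt_const Y)
  have key : ∀ X Y, fderiv ℝ B z X Y = g z * A z Y * fderiv ℝ h z X
      + (g z * fderiv ℝ A z X Y + fderiv ℝ g z X * A z Y) * h z
      - (fderiv ℝ g z Y * fderiv ℝ h z X + fderiv ℝ (fderiv ℝ g) z X Y * h z) := by
    intro X Y
    rw [← fderiv_apply_const hΩ hB hz, fderiv_congr_on hΩ (fun y hy => hAB y hy Y) hz,
      fderiv_fun_sub (by exact (dg.mul (dA Y)).mul dh) (by exact (ddg Y).mul dh),
      sub_apply, fderiv_mul_apply (by exact dg.mul (dA Y)) dh,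
      fderiv_mul_apply dg (dA Y), fderiv_mul_apply (ddg Y) dh, fderiv_apply_const hΩ hA hz,
      fderiv_apply_const hΩ (contDiffOn_fderiv hΩ hg) hz]
  have dhe : ∀ X, fderiv ℝ h z X = - (h z * fderiv ℝ g z X * h z) := fun X => by
    have := fderiv_inv_mul hΩ hg hh hgh hz X
    calc fderiv ℝ h z X = h z * g z * fderiv ℝ h z X := by rw [hhg z hz, one_mul]
      _ = _ := by rw [mul_assoc, this]; noncomm_ring
  have hhg' : ∀ x, h z * (g z * x) = x := fun x => by rw [← mul_assoc, hhg z hz, one_mul]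
  unfold curv
  -- The second derivatives of `g` cancel by symmetry; the remaining terms in the derivative of `g`
  -- cancel against the commutator of `B`.
  rw [key, key, hAB z hz, hAB z hz, dhe, dhe, fderiv_fderiv_comm hΩ hg hz X Y]
  simp only [mul_sub, sub_mul, mul_add, add_mul, mul_neg, mul_assoc, hhg']
  abel

end Gauge

/-! ### Laurent families of flat connections and their dressing -/

section Lax

variable {𝔸 : Type*} [NormedRing 𝔸] [NormedAlgebra ℂ 𝔸]

/-- Coefficients `λ⁻², …, λ²` of a Laurent family of connection forms. -/
structure LaurentForm (𝔸 : Type*) [NormedRing 𝔸] [NormedAlgebra ℂ 𝔸] where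
  m2 : ℂ → ℂ →L[ℝ] 𝔸
  m1 : ℂ → ℂ →L[ℝ] 𝔸
  z0 : ℂ → ℂ →L[ℝ] 𝔸
  p1 : ℂ → ℂ →L[ℝ] 𝔸
  p2 : ℂ → ℂ →L[ℝ] 𝔸

namespace LaurentForm

/-- The value of a Laurent family at `t`. -/
def form (A : LaurentForm 𝔸) (t : ℂ) : ℂ → ℂ →L[ℝ] 𝔸 := fun z =>
  t⁻¹ ^ 2 • A.m2 z + t⁻¹ • A.m1 z + A.z0 z + t • A.p1 z + t ^ 2 • A.p2 z

/-- The family `t ↦ A(t⁻¹)`. -/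
def inv (A : LaurentForm 𝔸) : LaurentForm 𝔸 := ⟨A.p2, A.p1, A.z0, A.m1, A.m2⟩

lemma form_inv (A : LaurentForm 𝔸) (t : ℂ) : A.inv.form t = A.form t⁻¹ := by
  funext z
  simp only [form, inv, inv_inv]
  abel

/-- Smoothness of the coefficients. -/
structure Smooth (A : LaurentForm 𝔸) (Ω : Set ℂ) : Prop where
  m2 : ContDiffOn ℝ ∞ A.m2 Ω
  m1 : ContDiffOn ℝ ∞ A.m1 Ω
  z0 : ContDiffOn ℝ ∞ A.z0 Ω
  p1 : ContDiffOn ℝ ∞ A.p1 Ω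
  p2 : ContDiffOn ℝ ∞ A.p2 Ω

lemma Smooth.form {A : LaurentForm 𝔸} {Ω : Set ℂ} (h : A.Smooth Ω) (t : ℂ) :
    ContDiffOn ℝ ∞ (A.form t) Ω :=
  ((((h.m2.const_smul _).add (h.m1.const_smul _)).add h.z0).add (h.p1.const_smul _)).add
    (h.p2.const_smul _)

lemma fderiv_form {A : LaurentForm 𝔸} {Ω : Set ℂ} (hΩ : IsOpen Ω) (h : A.Smooth Ω) {z : ℂ}
    (hz : z ∈ Ω) (t : ℂ) : fderiv ℝ (A.form t) z =
      t⁻¹ ^ 2 • fderiv ℝ A.m2 z + t⁻¹ • fderiv ℝ A.m1 z + fderiv ℝ A.z0 z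
      + t • fderiv ℝ A.p1 z + t ^ 2 • fderiv ℝ A.p2 z := by
  have d2 := (differentiableAt_of_contDiffOn hΩ h.m2 hz).hasFDerivAt
  have d1 := (differentiableAt_of_contDiffOn hΩ h.m1 hz).hasFDerivAt
  have d0 := (differentiableAt_of_contDiffOn hΩ h.z0 hz).hasFDerivAt
  have e1 := (differentiableAt_of_contDiffOn hΩ h.p1 hz).hasFDerivAt
  have e2 := (differentiableAt_of_contDiffOn hΩ h.p2 hz).hasFDerivAt
  exact (((((d2.const_smul (t⁻¹ ^ 2)).add (d1.const_smul t⁻¹)).add d0).add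
    (e1.const_smul t)).add (e2.const_smul (t ^ 2))).fderiv

/-- At a fixed point the curvature is a Laurent polynomial in `t`. Only its continuity is used, to
extend flatness over the exceptional parameters of a dressing. -/
lemma continuousAt_curv {A : LaurentForm 𝔸} {Ω : Set ℂ} (hΩ : IsOpen Ω) (h : A.Smooth Ω) {z : ℂ}
    (hz : z ∈ Ω) (X Y : ℂ) {t : ℂ} (ht : t ≠ 0) :
    ContinuousAt (fun t => curv (A.form t) z X Y) t := by
  unfold curv
  simp only [fderiv_form hΩ h hz, form, add_apply,
    smul_apply]
  fun_prop (disch := assumption)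

/-- A Laurent family that is flat off finitely many parameters is flat. -/
lemma curv_eq_zero_of_ne {A : LaurentForm 𝔸} {Ω : Set ℂ} (hΩ : IsOpen Ω) (h : A.Smooth Ω)
    {S : Set ℂ} (hS : S.Finite) {z : ℂ} (hz : z ∈ Ω) (X Y : ℂ)
    (hA : ∀ t, t ≠ 0 → t ∉ S → curv (A.form t) z X Y = 0) {t : ℂ} (ht : t ≠ 0) :
    curv (A.form t) z X Y = 0 := by
  have h1 : Filter.Tendsto (fun t => curv (A.form t) z X Y) (nhdsWithin t {t}ᶜ)
      (nhds (curv (A.form t) z X Y)) :=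
    (continuousAt_curv hΩ h hz X Y ht).tendsto.mono_left nhdsWithin_le_nhds
  refine tendsto_nhds_unique_of_eventuallyEq h1 tendsto_const_nhds ?_
  -- Removing `t` from the finite set `S` leaves a closed set that misses `t`, whether or not `t` is
  -- itself exceptional.
  have h2 : ∀ᶠ s in nhdsWithin t {t}ᶜ, s ∉ S \ {t} :=
    nhdsWithin_le_nhds ((hS.subset Set.sdiff_subset).isClosed.isOpen_compl.mem_nhds (by simp))
  have h3 : ∀ᶠ s in nhdsWithin t {t}ᶜ, s ≠ 0 :=
    nhdsWithin_le_nhds (isOpen_ne.mem_nhds ht)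
  filter_upwards [h2, h3, self_mem_nhdsWithin] with s hs hs0 hst
  exact hA s hs0 fun hsS => hs ⟨hsS, hst⟩

end LaurentForm

/-- A Laurent family of flat connections `d + A(t)` adapted to the reflection `ρ`: the coefficients
are skew, `A(-t)` is the gauge transform of `A(t)` by `ρ`, and those of `t⁻², t⁻¹` have type
determined by `σ = ± i`. -/
structure IsLax (Ω : Set ℂ) (τ : 𝔸 →L[ℂ] 𝔸) (σ : ℂ) (ρ : ℂ → 𝔸) (A : LaurentForm 𝔸) : Prop where
  smooth : A.Smooth Ω
  smooth_refl : ContDiffOn ℝ ∞ ρ Ω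
  skew_m2 : ∀ z ∈ Ω, ∀ X, τ (A.m2 z X) = -A.m2 z X
  skew_m1 : ∀ z ∈ Ω, ∀ X, τ (A.m1 z X) = -A.m1 z X
  skew_z0 : ∀ z ∈ Ω, ∀ X, τ (A.z0 z X) = -A.z0 z X
  skew_p1 : ∀ z ∈ Ω, ∀ X, τ (A.p1 z X) = -A.p1 z X
  skew_p2 : ∀ z ∈ Ω, ∀ X, τ (A.p2 z X) = -A.p2 z X
  type_m2 : ∀ z ∈ Ω, ∀ X, A.m2 z (Complex.I * X) = σ • A.m2 z X
  type_m1 : ∀ z ∈ Ω, ∀ X, A.m1 z (Complex.I * X) = σ • A.m1 z X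
  type_p1 : ∀ z ∈ Ω, ∀ X, A.p1 z (Complex.I * X) = -(σ • A.p1 z X)
  type_p2 : ∀ z ∈ Ω, ∀ X, A.p2 z (Complex.I * X) = -(σ • A.p2 z X)
  parity_m2 : ∀ z ∈ Ω, ∀ X, ρ z * A.m2 z X = A.m2 z X * ρ z
  parity_m1 : ∀ z ∈ Ω, ∀ X, ρ z * A.m1 z X = -(A.m1 z X * ρ z)
  parity_p1 : ∀ z ∈ Ω, ∀ X, ρ z * A.p1 z X = -(A.p1 z X * ρ z)
  parity_p2 : ∀ z ∈ Ω, ∀ X, ρ z * A.p2 z X = A.p2 z X * ρ z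
  refl_sq : ∀ z ∈ Ω, ρ z * ρ z = 1
  fderiv_refl : ∀ z ∈ Ω, ∀ X, fderiv ℝ ρ z X = ρ z * A.z0 z X - A.z0 z X * ρ z
  flat : ∀ t : ℂ, t ≠ 0 → ∀ z ∈ Ω, ∀ X Y, curv (A.form t) z X Y = 0

/-- The substitution of `t⁻¹` for `t` exchanges the two types. This is why `IsLax` carries the sign
`σ`, and it reduces dressing by `q` to dressing by `p`. -/
lemma IsLax.inv {Ω : Set ℂ} {τ : 𝔸 →L[ℂ] 𝔸} {σ : ℂ} {ρ : ℂ → 𝔸} {A : LaurentForm 𝔸}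
    (h : IsLax Ω τ σ ρ A) : IsLax Ω τ (-σ) ρ A.inv where
  smooth := ⟨h.smooth.p2, h.smooth.p1, h.smooth.z0, h.smooth.m1, h.smooth.m2⟩
  smooth_refl := h.smooth_refl
  skew_m2 := h.skew_p2
  skew_m1 := h.skew_p1
  skew_z0 := h.skew_z0
  skew_p1 := h.skew_m1
  skew_p2 := h.skew_m2
  type_m2 := fun z hz X => by rw [neg_smul]; exact h.type_p2 z hz X
  type_m1 := fun z hz X => by rw [neg_smul]; exact h.type_p1 z hz X
  type_p1 := fun z hz X => by rw [neg_smul, neg_neg]; exact h.type_m1 z hz X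
  type_p2 := fun z hz X => by rw [neg_smul, neg_neg]; exact h.type_m2 z hz X
  parity_m2 := h.parity_p2
  parity_m1 := h.parity_p1
  parity_p1 := h.parity_m1
  parity_p2 := h.parity_m2
  refl_sq := h.refl_sq
  fderiv_refl := h.fderiv_refl
  flat := fun t ht z hz X Y => by
    rw [LaurentForm.form_inv]; exact h.flat _ (inv_ne_zero ht) z hz X Y

lemma IsLax.skew_form {Ω : Set ℂ} {τ : 𝔸 →L[ℂ] 𝔸} {σ : ℂ} {ρ : ℂ → 𝔸} {A : LaurentForm 𝔸}
    (h : IsLax Ω τ σ ρ A) (t : ℂ) {z : ℂ} (hz : z ∈ Ω) (X : ℂ) :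
    τ (A.form t z X) = -A.form t z X := by
  simp only [LaurentForm.form, add_apply, smul_apply,
    map_add, map_smul, h.skew_m2 z hz, h.skew_m1 z hz, h.skew_z0 z hz, h.skew_p1 z hz,
    h.skew_p2 z hz]
  module

/-- Coefficients of even degree commute with `ρ` and those of odd degree anticommute. The
coefficient of degree 0 is left out because it acts on `ρ` through `fderiv_refl`: `ρ` is parallel
for `d + z0`. -/
lemma IsLax.refl_mul_form {Ω : Set ℂ} {τ : 𝔸 →L[ℂ] 𝔸} {σ : ℂ} {ρ : ℂ → 𝔸} {A : LaurentForm 𝔸}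
    (h : IsLax Ω τ σ ρ A) (t : ℂ) {z : ℂ} (hz : z ∈ Ω) (X : ℂ) :
    ρ z * (A.form t z X - A.z0 z X) = (A.form (-t) z X - A.z0 z X) * ρ z := by
  simp only [LaurentForm.form, add_apply, smul_apply,
    mul_add, mul_sub, add_mul, sub_mul, mul_smul_comm, smul_mul_assoc, h.parity_m2 z hz,
    h.parity_m1 z hz, h.parity_p1 z hz, h.parity_p2 z hz, inv_neg, neg_sq]
  module

end Lax

/-! ### Weights with respect to a null line and its reflection -/

/-- The component of weight `-1` of `ξ`. -/
def lower {R : Type*} [Ring R] (e f ξ : R) : R := (1 - e - f) * ξ * e + f * ξ * (1 - e - f)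

/-- The component of weight `1` of `ξ`. -/
def raise {R : Type*} [Ring R] (e f ξ : R) : R := e * ξ * (1 - e - f) + (1 - e - f) * ξ * f

lemma raise_add {R : Type*} [Ring R] (e f ξ η : R) : raise e f (ξ + η) = raise e f ξ + raise e f η := by
  simp only [raise]; noncomm_ring

lemma lower_add {R : Type*} [Ring R] (e f ξ η : R) : lower e f (ξ + η) = lower e f ξ + lower e f η := by
  simp only [lower]; noncomm_ring

section Dress

variable {𝔸 : Type*} [NormedRing 𝔸] [NormedAlgebra ℂ 𝔸]

/-- The element acting as `c`, `c⁻¹`, `1` on the images of `e`, `f`, `1 - e - f`. -/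
def dress (c : ℂ) (e f : 𝔸) : 𝔸 := 1 + (c - 1) • e + (c⁻¹ - 1) • f

/-- Projections `e`, `f` onto a null line and its reflection, for the transpose `τ` and the
reflection `ρ`. -/
structure IsNullPair (τ : 𝔸 →L[ℂ] 𝔸) (ρ e f : 𝔸) : Prop where
  ee : e * e = e
  ff : f * f = f
  ef : e * f = 0
  fe : f * e = 0
  refl_mul : ρ * e = f * ρ
  mul_refl : e * ρ = ρ * f
  tr_left : τ e = f
  tr_right : τ f = e
  null_left : ∀ ξ, τ ξ = -ξ → e * ξ * f = 0
  null_right : ∀ ξ, τ ξ = -ξ → f * ξ * e = 0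

lemma dress_mul_dress {τ : 𝔸 →L[ℂ] 𝔸} {ρ e f : 𝔸} (h : IsNullPair τ ρ e f) {c d : ℂ}
    (hc : c ≠ 0) (hd : d ≠ 0) : dress c e f * dress d e f = dress (c * d) e f := by
  simp only [dress, mul_add, add_mul, one_mul, mul_one, smul_mul_assoc, mul_smul_comm, h.ee, h.ff,
    h.ef, h.fe]
  match_scalars <;> field_simp <;> ring

lemma dress_one (e f : 𝔸) : dress 1 e f = 1 := by simp [dress]

lemma dress_mul_dress_inv {τ : 𝔸 →L[ℂ] 𝔸} {ρ e f : 𝔸} (h : IsNullPair τ ρ e f) {c : ℂ}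
    (hc : c ≠ 0) : dress c e f * dress c⁻¹ e f = 1 := by
  rw [dress_mul_dress h hc (inv_ne_zero hc), mul_inv_cancel₀ hc, dress_one]

lemma dress_inv_mul_dress {τ : 𝔸 →L[ℂ] 𝔸} {ρ e f : 𝔸} (h : IsNullPair τ ρ e f) {c : ℂ}
    (hc : c ≠ 0) : dress c⁻¹ e f * dress c e f = 1 := by
  rw [dress_mul_dress h (inv_ne_zero hc) hc, inv_mul_cancel₀ hc, dress_one]

/-- Conjugation multiplies the component of weight `k` by `c ^ k`. Skewness removes the weights ±2,
that is `e ξ f` and `f ξ e`, so that only `c` and `c⁻¹` occur; a factor `c ^ 2` would give double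
poles after dressing. -/
lemma dress_conj {τ : 𝔸 →L[ℂ] 𝔸} {ρ e f ξ : 𝔸} (h : IsNullPair τ ρ e f) {c : ℂ} (hc : c ≠ 0)
    (hξ : τ ξ = -ξ) : dress c e f * ξ * dress c⁻¹ e f =
      ξ + (c - 1) • raise e f ξ + (c⁻¹ - 1) • lower e f ξ := by
  have h1 := h.null_left ξ hξ
  have h2 := h.null_right ξ hξ
  simp only [mul_assoc] at h1 h2
  simp only [dress, raise, lower, mul_add, add_mul, mul_sub, sub_mul, one_mul, mul_one,
    smul_mul_assoc, mul_smul_comm, mul_assoc, h1, h2, inv_inv, smul_zero, smul_add, smul_sub]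
  match_scalars <;> field_simp <;> ring

/-- Derivatives of the projections onto a parallel line. -/
lemma dress_deriv {τ : 𝔸 →L[ℂ] 𝔸} {ρ e f e' f' a b : 𝔸} (h : IsNullPair τ ρ e f) {c : ℂ}
    (hc : c ≠ 0) (ha : τ a = -a) (hb : τ b = -b)
    (he : e' = e * b * (1 - e) - (1 - e) * a * e) (hf : f' = f * a * (1 - f) - (1 - f) * b * f) :
    -(((c - 1) • e' + (c⁻¹ - 1) • f') * dress c⁻¹ e f) =
      -((c - 1) • raise e f b) - (c⁻¹ - 1) • lower e f a := by
  have h2 := h.null_right a ha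
  have h3 := h.null_left b hb
  simp only [mul_assoc] at h2 h3
  simp only [he, hf, dress, raise, lower, mul_add, add_mul, mul_sub, sub_mul, one_mul, mul_one,
    smul_mul_assoc, mul_smul_comm, mul_assoc, h2, h3, inv_inv, smul_zero, smul_add,
    smul_sub, h.ee, h.ff, h.ef, h.fe, mul_zero, sub_zero]
  match_scalars <;> field_simp <;> ring

lemma raise_smul (e f ξ : 𝔸) (c : ℂ) : raise e f (c • ξ) = c • raise e f ξ := by
  simp only [raise, mul_smul_comm, smul_mul_assoc, smul_add]

lemma lower_smul (e f ξ : 𝔸) (c : ℂ) : lower e f (c • ξ) = c • lower e f ξ := by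
  simp only [lower, mul_smul_comm, smul_mul_assoc, smul_add]

variable {τ : 𝔸 →L[ℂ] 𝔸} {ρ e f : 𝔸}

lemma IsNullPair.refl_mul_compl (h : IsNullPair τ ρ e f) (hρ : ρ * ρ = 1) :
    ρ * (1 - e - f) = (1 - e - f) * ρ := by
  have h1 : ρ * f = e * ρ := by
    calc ρ * f = ρ * f * (ρ * ρ) := by rw [hρ, mul_one]
      _ = ρ * (f * ρ) * ρ := by noncomm_ring
      _ = ρ * ρ * e * ρ := by rw [← h.refl_mul]; noncomm_ring
      _ = e * ρ := by rw [hρ, one_mul]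
  simp only [mul_sub, sub_mul, mul_one, one_mul, h.refl_mul, h1]; abel

lemma IsNullPair.refl_mul_right (h : IsNullPair τ ρ e f) : ρ * f = e * ρ := h.mul_refl.symm

/-- Conjugation by `ρ` exchanges `e` and `f`, hence reverses weights. Taking `ε = ξ` or `ε = -ξ`
covers the even and odd coefficients of a Lax family. -/
lemma IsNullPair.refl_mul_raise (h : IsNullPair τ ρ e f) (hρ : ρ * ρ = 1) {ξ ε : 𝔸}
    (hξ : ρ * ξ = ε * ρ) : ρ * raise e f ξ = lower e f ε * ρ := by
  have h1 : ∀ x, ρ * (e * x) = f * (ρ * x) := fun x => by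
    rw [← mul_assoc, h.refl_mul, mul_assoc]
  have h2 : ∀ x, ρ * ((1 - e - f) * x) = (1 - e - f) * (ρ * x) := fun x => by
    rw [← mul_assoc, h.refl_mul_compl hρ, mul_assoc]
  have h3 : ∀ x, ρ * (ξ * x) = ε * (ρ * x) := fun x => by
    rw [← mul_assoc, hξ, mul_assoc]
  simp only [raise, lower, mul_add (ρ), add_mul _ _ ρ, mul_assoc, h1, h2, h3, h.refl_mul_compl hρ,
    h.refl_mul_right]
  abel

lemma IsNullPair.refl_mul_lower (h : IsNullPair τ ρ e f) (hρ : ρ * ρ = 1) {ξ ε : 𝔸}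
    (hξ : ρ * ξ = ε * ρ) : ρ * lower e f ξ = raise e f ε * ρ := by
  have h1 : ∀ x, ρ * (f * x) = e * (ρ * x) := fun x => by
    rw [← mul_assoc, h.refl_mul_right, mul_assoc]
  have h2 : ∀ x, ρ * ((1 - e - f) * x) = (1 - e - f) * (ρ * x) := fun x => by
    rw [← mul_assoc, h.refl_mul_compl hρ, mul_assoc]
  have h3 : ∀ x, ρ * (ξ * x) = ε * (ρ * x) := fun x => by
    rw [← mul_assoc, hξ, mul_assoc]
  simp only [raise, lower, mul_add (ρ), add_mul _ _ ρ, mul_assoc, h1, h2, h3, h.refl_mul_compl hρ,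
    h.refl_mul]
  abel

lemma IsNullPair.tr_raise (h : IsNullPair τ ρ e f) (hτ : ∀ a b, τ (a * b) = τ b * τ a)
    (hτ1 : τ 1 = 1) {ξ : 𝔸} (hξ : τ ξ = -ξ) : τ (raise e f ξ) = -raise e f ξ := by
  simp only [raise, map_add, hτ, map_sub, hτ1, h.tr_left, h.tr_right, hξ]; noncomm_ring

lemma IsNullPair.tr_lower (h : IsNullPair τ ρ e f) (hτ : ∀ a b, τ (a * b) = τ b * τ a)
    (hτ1 : τ 1 = 1) {ξ : 𝔸} (hξ : τ ξ = -ξ) : τ (lower e f ξ) = -lower e f ξ := by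
  simp only [lower, map_add, hτ, map_sub, hτ1, h.tr_left, h.tr_right, hξ]; noncomm_ring

/-- The components of weight `±1` of an endomorphism-valued form. -/
def lowerForm (e f : 𝔸) (η : ℂ →L[ℝ] 𝔸) : ℂ →L[ℝ] 𝔸 :=
  sandwich (1 - e - f) e η + sandwich f (1 - e - f) η

/-- The component of weight `1` of an endomorphism-valued form. -/
def raiseForm (e f : 𝔸) (η : ℂ →L[ℝ] 𝔸) : ℂ →L[ℝ] 𝔸 :=
  sandwich e (1 - e - f) η + sandwich (1 - e - f) f η

@[simp] lemma lowerForm_apply (e f : 𝔸) (η : ℂ →L[ℝ] 𝔸) (X : ℂ) :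
    lowerForm e f η X = lower e f (η X) := rfl

@[simp] lemma raiseForm_apply (e f : 𝔸) (η : ℂ →L[ℝ] 𝔸) (X : ℂ) :
    raiseForm e f η X = raise e f (η X) := rfl

lemma contDiffOn_lowerForm {Ω : Set ℂ} {e f : ℂ → 𝔸} {η : ℂ → ℂ →L[ℝ] 𝔸}
    (he : ContDiffOn ℝ ∞ e Ω) (hf : ContDiffOn ℝ ∞ f Ω) (hη : ContDiffOn ℝ ∞ η Ω) :
    ContDiffOn ℝ ∞ (fun z => lowerForm (e z) (f z) (η z)) Ω :=
  (ContDiffOn.sandwich ((contDiffOn_const.sub he).sub hf) he hη).add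
    (ContDiffOn.sandwich hf ((contDiffOn_const.sub he).sub hf) hη)

lemma contDiffOn_raiseForm {Ω : Set ℂ} {e f : ℂ → 𝔸} {η : ℂ → ℂ →L[ℝ] 𝔸}
    (he : ContDiffOn ℝ ∞ e Ω) (hf : ContDiffOn ℝ ∞ f Ω) (hη : ContDiffOn ℝ ∞ η Ω) :
    ContDiffOn ℝ ∞ (fun z => raiseForm (e z) (f z) (η z)) Ω :=
  (ContDiffOn.sandwich he ((contDiffOn_const.sub he).sub hf) hη).add
    (ContDiffOn.sandwich ((contDiffOn_const.sub he).sub hf) hf hη)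

lemma contDiffOn_dress {Ω : Set ℂ} {e f : ℂ → 𝔸} (c : ℂ)
    (he : ContDiffOn ℝ ∞ e Ω) (hf : ContDiffOn ℝ ∞ f Ω) :
    ContDiffOn ℝ ∞ (fun z => dress c (e z) (f z)) Ω :=
  (contDiffOn_const.add (he.const_smul _)).add (hf.const_smul _)

/-- The dressed family. -/
def LaurentForm.dress (A : LaurentForm 𝔸) (α : ℂ) (e f : ℂ → 𝔸) : LaurentForm 𝔸 where
  m2 := A.m2
  m1 := fun z => A.m1 z
    + (2 / α) • (lowerForm (e z) (f z) (A.m2 z) - raiseForm (e z) (f z) (A.m2 z))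
  z0 := fun z => A.z0 z
    + (2 / α ^ 2) • (lowerForm (e z) (f z) (A.m2 z) + raiseForm (e z) (f z) (A.m2 z))
    + (2 / α) • (lowerForm (e z) (f z) (A.m1 z) - raiseForm (e z) (f z) (A.m1 z))
  p1 := fun z => A.p1 z
    - (2 : ℂ) • (lowerForm (e z) (f z) (A.p1 z) + raiseForm (e z) (f z) (A.p1 z))
    - (2 * α) • (lowerForm (e z) (f z) (A.p2 z) - raiseForm (e z) (f z) (A.p2 z))
  p2 := fun z => A.p2 z
    - (2 : ℂ) • (lowerForm (e z) (f z) (A.p2 z) + raiseForm (e z) (f z) (A.p2 z))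

lemma LaurentForm.Smooth.dress {A : LaurentForm 𝔸} {Ω : Set ℂ} (h : A.Smooth Ω) (α : ℂ)
    {e f : ℂ → 𝔸} (he : ContDiffOn ℝ ∞ e Ω) (hf : ContDiffOn ℝ ∞ f Ω) :
    (A.dress α e f).Smooth Ω where
  m2 := h.m2
  m1 := h.m1.add (((contDiffOn_lowerForm he hf h.m2).sub
    (contDiffOn_raiseForm he hf h.m2)).const_smul _)
  z0 := (h.z0.add (((contDiffOn_lowerForm he hf h.m2).add
    (contDiffOn_raiseForm he hf h.m2)).const_smul _)).add
    (((contDiffOn_lowerForm he hf h.m1).sub (contDiffOn_raiseForm he hf h.m1)).const_smul _)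
  p1 := (h.p1.sub (((contDiffOn_lowerForm he hf h.p1).add
    (contDiffOn_raiseForm he hf h.p1)).const_smul _)).sub
    (((contDiffOn_lowerForm he hf h.p2).sub (contDiffOn_raiseForm he hf h.p2)).const_smul _)
  p2 := h.p2.sub (((contDiffOn_lowerForm he hf h.p2).add
    (contDiffOn_raiseForm he hf h.p2)).const_smul _)

/-- The projections `e`, `f` of null pairs vary smoothly, and the line `e` is parallel for `d + A`. -/
structure IsParallelPair (Ω : Set ℂ) (τ : 𝔸 →L[ℂ] 𝔸) (ρ e f : ℂ → 𝔸) (A : ℂ → ℂ →L[ℝ] 𝔸) :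
    Prop where
  pair : ∀ z ∈ Ω, IsNullPair τ (ρ z) (e z) (f z)
  smooth_left : ContDiffOn ℝ ∞ e Ω
  smooth_right : ContDiffOn ℝ ∞ f Ω
  parallel : ∀ z ∈ Ω, ∀ X, (1 - e z) * (fderiv ℝ e z X + A z X * e z) = 0

end Dress

/-! ### Derivatives of the projections onto a parallel line, and the dressed family as a gauge
transform -/

section Step

variable {𝔸 : Type*} [NormedRing 𝔸] [NormedAlgebra ℂ 𝔸] {Ω : Set ℂ} {τ : 𝔸 →L[ℂ] 𝔸} {σ : ℂ}
  {ρ e f : ℂ → 𝔸} {A : LaurentForm 𝔸} {α : ℂ}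

lemma fderiv_idem (hΩ : IsOpen Ω) (he : ContDiffOn ℝ ∞ e Ω) (hee : ∀ z ∈ Ω, e z * e z = e z)
    {z : ℂ} (hz : z ∈ Ω) (X : ℂ) :
    fderiv ℝ e z X = e z * fderiv ℝ e z X + fderiv ℝ e z X * e z := by
  have d := differentiableAt_of_contDiffOn hΩ he hz
  have := fderiv_mul_apply d d X
  rwa [fderiv_congr_on hΩ hee hz] at this

/-- The kernel of `f` is the orthogonal of the line `e`, which is parallel at `α` because the
connection is metric. The image of `f` is the reflected line, which is parallel at `-α` by the
twist. Kernel and image determine the derivative of a projection. -/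
lemma IsParallelPair.fderiv_right (hΩ : IsOpen Ω) (hA : IsLax Ω τ σ ρ A)
    (hτ : ∀ a b, τ (a * b) = τ b * τ a) (hτ1 : τ 1 = 1)
    (h : IsParallelPair Ω τ ρ e f (A.form α)) {z : ℂ} (hz : z ∈ Ω) (X : ℂ) :
    fderiv ℝ f z X = f z * A.form α z X * (1 - f z) - (1 - f z) * A.form (-α) z X * f z := by
  have de := differentiableAt_of_contDiffOn hΩ h.smooth_left hz
  have hdf : τ (fderiv ℝ e z X) = fderiv ℝ f z X := by
    rw [← fderiv_congr_on hΩ (fun y hy => (h.pair y hy).tr_left) hz]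
    have := ((τ.restrictScalars ℝ).hasFDerivAt.comp z de.hasFDerivAt).fderiv
    have h' : fderiv ℝ (fun y => τ (e y)) z = _ := this
    rw [h']; rfl
  have hp := h.pair z hz
  -- The transpose of the parallelism condition for `e`.
  have h1 : fderiv ℝ f z X * (1 - f z) = f z * A.form α z X * (1 - f z) := by
    have := congrArg τ (h.parallel z hz X)
    simp only [hτ, map_sub, map_add, hτ1, hp.tr_left, hdf, hA.skew_form α hz, map_zero, add_mul,
      mul_neg, neg_mul] at this
    exact eq_of_sub_eq_zero (by rw [← this]; abel)
  have hρ := hA.refl_sq z hz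
  have hρe := hp.refl_mul
  have hcompl : ρ z * (1 - e z) = (1 - f z) * ρ z := by
    rw [mul_sub, sub_mul, mul_one, one_mul, hρe]
  -- Parallelism of the reflected line at `-α`: differentiate `ρ e = f ρ` and move `ρ` across the
  -- form.
  have h2 : (1 - f z) * fderiv ℝ f z X = -((1 - f z) * A.form (-α) z X * f z) := by
    have hd : fderiv ℝ (fun y => ρ y * e y) z X = fderiv ℝ (fun y => f y * ρ y) z X := by
      rw [fderiv_congr_on hΩ (fun y hy => (h.pair y hy).refl_mul) hz]
    rw [fderiv_mul_apply (differentiableAt_of_contDiffOn hΩ hA.smooth_refl hz) de,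
      fderiv_mul_apply (differentiableAt_of_contDiffOn hΩ h.smooth_right hz)
        (differentiableAt_of_contDiffOn hΩ hA.smooth_refl hz), hA.fderiv_refl z hz] at hd
    have hff : (1 - f z) * f z = 0 := by rw [sub_mul, one_mul, hp.ff, sub_self]
    have hpar := h.parallel z hz X
    have hA' := hA.refl_mul_form α hz X
    have e1 : (1 - f z) * fderiv ℝ f z X = (1 - f z) *
        (ρ z * fderiv ℝ e z X + (ρ z * A.z0 z X - A.z0 z X * ρ z) * e z) * ρ z := by
      rw [hd, mul_add, add_mul, ← mul_assoc, ← mul_assoc, hff, mul_assoc _ (ρ z) (ρ z), hρ]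
      simp
    have e2 : (1 - f z) * (ρ z * fderiv ℝ e z X) = -((1 - f z) * (ρ z * (A.form α z X * e z))) := by
      rw [← mul_assoc, ← hcompl, ← mul_assoc, ← hcompl, mul_assoc, mul_assoc, ← mul_neg]
      congr 1
      rw [mul_add] at hpar
      exact eq_neg_of_add_eq_zero_left hpar
    have e3 : ρ z * A.form α z X = (A.form (-α) z X - A.z0 z X) * ρ z + ρ z * A.z0 z X := by
      rw [← hA']; noncomm_ring
    rw [e1, mul_add, e2, ← mul_assoc (ρ z), e3]
    have e4 : e z * ρ z = ρ z * f z := hp.mul_refl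
    have e5 : ∀ x, ρ z * (ρ z * x) = x := fun x => by rw [← mul_assoc, hρ, one_mul]
    simp only [mul_add, add_mul, sub_mul, mul_sub, mul_assoc, neg_mul, e4, e5, one_mul]
    abel
  have h3 := fderiv_idem hΩ h.smooth_right (fun y hy => (h.pair y hy).ff) hz X
  calc fderiv ℝ f z X = fderiv ℝ f z X * (1 - f z) + fderiv ℝ f z X * f z := by noncomm_ring
    _ = fderiv ℝ f z X * (1 - f z) + (1 - f z) * fderiv ℝ f z X := by
      congr 1
      rw [sub_mul, one_mul]
      nth_rewrite 2 [h3]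
      abel
    _ = _ := by rw [h1, h2]; abel

lemma IsParallelPair.fderiv_left (hΩ : IsOpen Ω) (hA : IsLax Ω τ σ ρ A)
    (hτ : ∀ a b, τ (a * b) = τ b * τ a) (hτ1 : τ 1 = 1)
    (h : IsParallelPair Ω τ ρ e f (A.form α)) {z : ℂ} (hz : z ∈ Ω) (X : ℂ) :
    fderiv ℝ e z X = e z * A.form (-α) z X * (1 - e z) - (1 - e z) * A.form α z X * e z := by
  have hp := h.pair z hz
  have df := differentiableAt_of_contDiffOn hΩ h.smooth_right hz
  have hdf : τ (fderiv ℝ f z X) = fderiv ℝ e z X := by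
    rw [← fderiv_congr_on hΩ (fun y hy => (h.pair y hy).tr_right) hz]
    have := ((τ.restrictScalars ℝ).hasFDerivAt.comp z df.hasFDerivAt).fderiv
    have h' : fderiv ℝ (fun y => τ (f y)) z = _ := this
    rw [h']; rfl
  rw [← hdf, h.fderiv_right hΩ hA hτ hτ1 hz]
  simp only [map_sub, hτ, hτ1, hp.tr_right, hA.skew_form _ hz]
  noncomm_ring

lemma dressFactor_ne_zero {t : ℂ} (h1 : t ≠ α) (h2 : t ≠ -α) : (α - t) / (α + t) ≠ 0 :=
  div_ne_zero (sub_ne_zero.2 h1.symm) fun h => h2 (eq_neg_of_add_eq_zero_right h)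

/-- The dressed family is the gauge transform of the original one. -/
theorem IsParallelPair.dress_form (hΩ : IsOpen Ω) (hA : IsLax Ω τ σ ρ A)
    (hτ : ∀ a b, τ (a * b) = τ b * τ a) (hτ1 : τ 1 = 1) (hα : α ≠ 0)
    (h : IsParallelPair Ω τ ρ e f (A.form α)) {t : ℂ} (ht : t ≠ 0) (h1 : t ≠ α) (h2 : t ≠ -α)
    {z : ℂ} (hz : z ∈ Ω) (X : ℂ) :
    (A.dress α e f).form t z X =
      dress ((α - t) / (α + t)) (e z) (f z) * A.form t z X * dress ((α - t) / (α + t))⁻¹ (e z) (f z)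
      - fderiv ℝ (fun y => dress ((α - t) / (α + t)) (e y) (f y)) z X
        * dress ((α - t) / (α + t))⁻¹ (e z) (f z) := by
  have hc := dressFactor_ne_zero h1 h2
  set c := (α - t) / (α + t) with hcdef
  have hp := h.pair z hz
  have hd : fderiv ℝ (fun y => dress c (e y) (f y)) z X
      = (c - 1) • fderiv ℝ e z X + (c⁻¹ - 1) • fderiv ℝ f z X := by
    have := (((hasFDerivAt_const (𝕜 := ℝ) (1 : 𝔸) z).add
      ((differentiableAt_of_contDiffOn hΩ h.smooth_left hz).hasFDerivAt.const_smul (c - 1))).add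
      ((differentiableAt_of_contDiffOn hΩ h.smooth_right hz).hasFDerivAt.const_smul
        (c⁻¹ - 1))).fderiv
    have h' : fderiv ℝ (fun y => dress c (e y) (f y)) z = _ := this
    rw [h']; simp
  rw [sub_eq_add_neg, hd, dress_deriv hp hc (hA.skew_form α hz X) (hA.skew_form (-α) hz X)
    (h.fderiv_left hΩ hA hτ hτ1 hz X) (h.fderiv_right hΩ hA hτ hτ1 hz X),
    dress_conj hp hc (hA.skew_form t hz X)]
  have h1' : α - t ≠ 0 := sub_ne_zero.2 h1.symm
  have h2' : α + t ≠ 0 := fun h => h2 (eq_neg_of_add_eq_zero_right h)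
  -- The corrections are now `(c - 1) raise (A(t) - A(-α))` and `(c⁻¹ - 1) lower (A(t) - A(α))`. The
  -- differences contain the factors `t + α` and `t - α`, which cancel these denominators; the
  -- quotients are the coefficients of `LaurentForm.dress`.
  have e1 : c - 1 = -2 * t / (α + t) := by rw [hcdef]; field_simp; ring
  have e2 : c⁻¹ - 1 = 2 * t / (α - t) := by rw [hcdef, inv_div]; field_simp; ring
  rw [e1, e2]
  simp only [LaurentForm.form, LaurentForm.dress, add_apply, sub_apply, smul_apply, raise_add,
    lower_add, raise_smul, lower_smul, raiseForm_apply, lowerForm_apply]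
  generalize raise (e z) (f z) (A.m2 z X) = r1
  generalize raise (e z) (f z) (A.m1 z X) = r2
  generalize raise (e z) (f z) (A.z0 z X) = r3
  generalize raise (e z) (f z) (A.p1 z X) = r4
  generalize raise (e z) (f z) (A.p2 z X) = r5
  generalize lower (e z) (f z) (A.m2 z X) = s1
  generalize lower (e z) (f z) (A.m1 z X) = s2
  generalize lower (e z) (f z) (A.z0 z X) = s3
  generalize lower (e z) (f z) (A.p1 z X) = s4
  generalize lower (e z) (f z) (A.p2 z X) = s5
  match_scalars <;> field_simp <;> ring

end Step

/-! ### Stability of Lax families under dressing, and transport of parallel lines -/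

section Step

variable {𝔸 : Type*} [NormedRing 𝔸] [NormedAlgebra ℂ 𝔸] {Ω : Set ℂ} {τ : 𝔸 →L[ℂ] 𝔸} {σ : ℂ}
  {ρ e f : ℂ → 𝔸} {A : LaurentForm 𝔸} {α : ℂ}

/-- Dressing by a parallel null line. -/
theorem IsLax.dress (hΩ : IsOpen Ω) (hA : IsLax Ω τ σ ρ A)
    (hτ : ∀ a b, τ (a * b) = τ b * τ a) (hτ1 : τ 1 = 1) (hα : α ≠ 0)
    (h : IsParallelPair Ω τ ρ e f (A.form α)) : IsLax Ω τ σ ρ (A.dress α e f) where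
  smooth := hA.smooth.dress α h.smooth_left h.smooth_right
  smooth_refl := hA.smooth_refl
  skew_m2 := hA.skew_m2
  skew_m1 := fun z hz X => by
    simp only [LaurentForm.dress, add_apply, sub_apply, smul_apply, raiseForm_apply,
      lowerForm_apply, map_add, map_sub, map_smul, hA.skew_m1 z hz,
      (h.pair z hz).tr_raise hτ hτ1 (hA.skew_m2 z hz X),
      (h.pair z hz).tr_lower hτ hτ1 (hA.skew_m2 z hz X)]
    module
  skew_z0 := fun z hz X => by
    simp only [LaurentForm.dress, add_apply, sub_apply, smul_apply, raiseForm_apply,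
      lowerForm_apply, map_add, map_sub, map_smul, hA.skew_z0 z hz,
      (h.pair z hz).tr_raise hτ hτ1 (hA.skew_m2 z hz X),
      (h.pair z hz).tr_lower hτ hτ1 (hA.skew_m2 z hz X),
      (h.pair z hz).tr_raise hτ hτ1 (hA.skew_m1 z hz X),
      (h.pair z hz).tr_lower hτ hτ1 (hA.skew_m1 z hz X)]
    module
  skew_p1 := fun z hz X => by
    simp only [LaurentForm.dress, add_apply, sub_apply, smul_apply, raiseForm_apply,
      lowerForm_apply, map_add, map_sub, map_smul, hA.skew_p1 z hz,
      (h.pair z hz).tr_raise hτ hτ1 (hA.skew_p2 z hz X),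
      (h.pair z hz).tr_lower hτ hτ1 (hA.skew_p2 z hz X),
      (h.pair z hz).tr_raise hτ hτ1 (hA.skew_p1 z hz X),
      (h.pair z hz).tr_lower hτ hτ1 (hA.skew_p1 z hz X)]
    module
  skew_p2 := fun z hz X => by
    simp only [LaurentForm.dress, add_apply, sub_apply, smul_apply, raiseForm_apply,
      lowerForm_apply, map_add, map_sub, map_smul, hA.skew_p2 z hz,
      (h.pair z hz).tr_raise hτ hτ1 (hA.skew_p2 z hz X),
      (h.pair z hz).tr_lower hτ hτ1 (hA.skew_p2 z hz X)]
    module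
  type_m2 := hA.type_m2
  type_m1 := fun z hz X => by
    simp only [LaurentForm.dress, add_apply, sub_apply, smul_apply, raiseForm_apply,
      lowerForm_apply, hA.type_m1 z hz, hA.type_m2 z hz, raise_smul, lower_smul]
    module
  type_p1 := fun z hz X => by
    simp only [LaurentForm.dress, add_apply, sub_apply, smul_apply, raiseForm_apply,
      lowerForm_apply, hA.type_p1 z hz, hA.type_p2 z hz, ← neg_smul, raise_smul, lower_smul]
    module
  type_p2 := fun z hz X => by
    simp only [LaurentForm.dress, add_apply, sub_apply, smul_apply, raiseForm_apply,
      lowerForm_apply, hA.type_p2 z hz, ← neg_smul, raise_smul, lower_smul]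
    module
  parity_m2 := hA.parity_m2
  parity_m1 := fun z hz X => by
    have hρ := hA.refl_sq z hz
    simp only [LaurentForm.dress, add_apply, sub_apply, smul_apply, raiseForm_apply,
      lowerForm_apply, mul_add, mul_sub, add_mul, sub_mul, mul_smul_comm, smul_mul_assoc,
      (h.pair z hz).refl_mul_raise hρ (hA.parity_m2 z hz X),
      (h.pair z hz).refl_mul_lower hρ (hA.parity_m2 z hz X), hA.parity_m1 z hz]
    module
  parity_p1 := fun z hz X => by
    have hρ := hA.refl_sq z hz
    -- The sign is written as a scalar so that it passes through `raise_smul` and `lower_smul`.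
    have h1 : ρ z * A.p1 z X = ((-1 : ℂ) • A.p1 z X) * ρ z := by
      rw [hA.parity_p1 z hz, neg_one_smul, neg_mul]
    simp only [LaurentForm.dress, add_apply, sub_apply, smul_apply, raiseForm_apply,
      lowerForm_apply, mul_add, mul_sub, add_mul, sub_mul, mul_smul_comm, smul_mul_assoc,
      (h.pair z hz).refl_mul_raise hρ (hA.parity_p2 z hz X),
      (h.pair z hz).refl_mul_lower hρ (hA.parity_p2 z hz X), (h.pair z hz).refl_mul_raise hρ h1,
      (h.pair z hz).refl_mul_lower hρ h1, raise_smul, lower_smul]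
    rw [hA.parity_p1 z hz]
    module
  parity_p2 := fun z hz X => by
    have hρ := hA.refl_sq z hz
    simp only [LaurentForm.dress, add_apply, sub_apply, smul_apply, raiseForm_apply,
      lowerForm_apply, mul_add, mul_sub, add_mul, sub_mul, mul_smul_comm, smul_mul_assoc,
      (h.pair z hz).refl_mul_raise hρ (hA.parity_p2 z hz X),
      (h.pair z hz).refl_mul_lower hρ (hA.parity_p2 z hz X), hA.parity_p2 z hz]
    module
  refl_sq := hA.refl_sq
  fderiv_refl := fun z hz X => by
    have hρ := hA.refl_sq z hz
    have h1 : ρ z * A.m1 z X = ((-1 : ℂ) • A.m1 z X) * ρ z := by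
      rw [hA.parity_m1 z hz, neg_one_smul, neg_mul]
    simp only [LaurentForm.dress, add_apply, sub_apply, smul_apply, raiseForm_apply,
      lowerForm_apply, mul_add, mul_sub, add_mul, sub_mul, mul_smul_comm, smul_mul_assoc,
      (h.pair z hz).refl_mul_raise hρ (hA.parity_m2 z hz X),
      (h.pair z hz).refl_mul_lower hρ (hA.parity_m2 z hz X), (h.pair z hz).refl_mul_raise hρ h1,
      (h.pair z hz).refl_mul_lower hρ h1, raise_smul, lower_smul, hA.fderiv_refl z hz]
    module
  flat := fun t ht z hz X Y => by
    -- The gauge transformation is singular exactly at `±α`; the dressed family is not.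
    refine LaurentForm.curv_eq_zero_of_ne hΩ (hA.smooth.dress α h.smooth_left h.smooth_right)
      (S := {α, -α}) (by simp) hz X Y (fun s hs hsS => ?_) ht
    simp only [Set.mem_insert_iff, Set.mem_singleton_iff, not_or] at hsS
    have hc := dressFactor_ne_zero hsS.1 hsS.2
    rw [curv_gauge hΩ (contDiffOn_dress ((α - s) / (α + s)) h.smooth_left h.smooth_right)
      (contDiffOn_dress ((α - s) / (α + s))⁻¹ h.smooth_left h.smooth_right)
      (fun y hy => dress_mul_dress_inv (h.pair y hy) hc)
      (fun y hy => dress_inv_mul_dress (h.pair y hy) hc) (hA.smooth.form s)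
      ((hA.smooth.dress α h.smooth_left h.smooth_right).form s)
      (fun y hy X => h.dress_form hΩ hA hτ hτ1 hα hs hsS.1 hsS.2 hy X) hz, hA.flat s hs z hz]
    simp

/-- The coefficient of `λ²` of the dressed family. -/
lemma IsParallelPair.dress_p2 (hA : IsLax Ω τ σ ρ A) {B : ℂ → ℂ →L[ℝ] 𝔸}
    (h : IsParallelPair Ω τ ρ e f B) {z : ℂ} (hz : z ∈ Ω) (X : ℂ) :
    (A.dress α e f).p2 z X =
      HarmonicBundles.dress (-1) (e z) (f z) * A.p2 z X
        * HarmonicBundles.dress (-1) (e z) (f z) := by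
  have := dress_conj (h.pair z hz) (c := -1) (by simp) (hA.skew_p2 z hz X)
  rw [show (-1 : ℂ)⁻¹ = -1 by norm_num] at this
  rw [this]
  simp only [LaurentForm.dress, add_apply, sub_apply, smul_apply, raiseForm_apply, lowerForm_apply]
  module

/-- If `g` gauges `d + A` to `d + B`, it maps lines parallel for `d + A` to lines parallel for
`d + B`; here `e` is any projection onto a parallel line and `e'` one onto its image. -/
lemma parallel_of_gauge (hΩ : IsOpen Ω) {g h e e' : ℂ → 𝔸} {A B : ℂ → ℂ →L[ℝ] 𝔸}
    (hg : ContDiffOn ℝ ∞ g Ω) (hh : ContDiffOn ℝ ∞ h Ω) (hgh : ∀ z ∈ Ω, g z * h z = 1)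
    (hhg : ∀ z ∈ Ω, h z * g z = 1)
    (he : ContDiffOn ℝ ∞ e Ω) (he' : ContDiffOn ℝ ∞ e' Ω)
    (hAB : ∀ z ∈ Ω, ∀ X, B z X = g z * A z X * h z - fderiv ℝ g z X * h z)
    (hpar : ∀ z ∈ Ω, ∀ X, (1 - e z) * (fderiv ℝ e z X + A z X * e z) = 0)
    (h1 : ∀ z ∈ Ω, g z * e z * h z * e' z = e' z)
    (h2 : ∀ z ∈ Ω, e' z * (g z * e z * h z) = g z * e z * h z)
    {z : ℂ} (hz : z ∈ Ω) (X : ℂ) :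
    (1 - e' z) * (fderiv ℝ e' z X + B z X * e' z) = 0 := by
  have dg := differentiableAt_of_contDiffOn hΩ hg hz
  have dh := differentiableAt_of_contDiffOn hΩ hh hz
  have de := differentiableAt_of_contDiffOn hΩ he hz
  have de' := differentiableAt_of_contDiffOn hΩ he' hz
  -- `g e h` and `e'` project onto the same line, in general along different complements.
  -- Differentiating `(g e h) e' = e'` brings in the derivative of `e`, which the hypothesis
  -- controls.
  have hd : fderiv ℝ e' z X = g z * e z * h z * fderiv ℝ e' z X
      + (g z * e z * fderiv ℝ h z X + (g z * fderiv ℝ e z X + fderiv ℝ g z X * e z) * h z)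
        * e' z := by
    conv_lhs => rw [← fderiv_congr_on hΩ h1 hz]
    rw [fderiv_mul_apply (by exact (dg.mul de).mul dh) de', fderiv_mul_apply (by exact dg.mul de) dh,
      fderiv_mul_apply dg de]
  have hhg' : ∀ x, h z * (g z * x) = x := fun x => by rw [← mul_assoc, hhg z hz, one_mul]
  -- Since `1 - e'` kills the transported line, it factors through the transport of `1 - e`, and
  -- parallelism for `A` can be applied.
  have e0 : (1 - e' z) = (1 - e' z) * (g z * (1 - e z) * h z) := by
    have hx : g z * (1 - e z) * h z = 1 - g z * e z * h z := by
      rw [mul_sub, sub_mul, mul_one, hgh z hz]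
    rw [hx, mul_sub, mul_one, sub_mul, one_mul, h2 z hz, sub_self, sub_zero]
  have e1 : (1 - e' z) * (g z * e z) = 0 := by
    have := congrArg (· * g z) (h2 z hz)
    simp only [mul_assoc, hhg z hz, mul_one] at this
    rw [sub_mul, one_mul, this, sub_self]
  have e2 : h z * e' z = e z * h z * e' z := by
    have := congrArg (h z * ·) (h1 z hz)
    simp only [mul_assoc, hhg'] at this
    rw [mul_assoc, this]
  have e3 : ∀ x, (1 - e' z) * (g z * (e z * x)) = 0 := fun x => by
    rw [← mul_assoc (g z), ← mul_assoc, e1, zero_mul]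
  have hp : (1 - e' z) * (g z * (fderiv ℝ e z X + A z X * e z)) = 0 := by
    rw [e0]
    simp only [mul_assoc, hhg']
    rw [hpar z hz X]
    simp
  have hp' : ∀ x, (1 - e' z) * (g z * (fderiv ℝ e z X * x))
      + (1 - e' z) * (g z * (A z X * (e z * x))) = 0 := fun x => by
    have := congrArg (· * x) hp
    simpa only [mul_add, add_mul, mul_assoc, zero_mul] using this
  have e4 : (g z * A z X * h z - fderiv ℝ g z X * h z) * e' z
      = g z * (A z X * (e z * (h z * e' z))) - fderiv ℝ g z X * (e z * (h z * e' z)) := by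
    rw [← mul_assoc (e z), ← e2]; noncomm_ring
  rw [hd, hAB z hz, e4]
  have := hp' (h z * e' z)
  simp only [mul_add, add_mul, mul_sub (1 - e' z), mul_assoc, e3, zero_add]
  rw [← this]
  abel

end Step

/-! ### From constrained harmonic bundles to Lax families and back -/

section Harmonic

variable {𝔸 : Type*} [NormedRing 𝔸] [NormedAlgebra ℂ 𝔸]

section Types

variable {E : Type*} [NormedAddCommGroup E] [NormedSpace ℂ E]

/-- The `(1,0)`-part of a form at a point of `ℂ`. -/
def typeL (η : ℂ →L[ℝ] E) : ℂ →L[ℝ] E :=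
  (1 / 2 : ℂ) • (η - Complex.I • η.comp (ContinuousLinearMap.mul ℝ ℂ Complex.I))

/-- The `(0,1)`-part of a form at a point of `ℂ`. -/
def typeR (η : ℂ →L[ℝ] E) : ℂ →L[ℝ] E :=
  (1 / 2 : ℂ) • (η + Complex.I • η.comp (ContinuousLinearMap.mul ℝ ℂ Complex.I))

lemma typeL_apply (η : ℂ →L[ℝ] E) (X : ℂ) :
    typeL η X = (1 / 2 : ℂ) • (η X - Complex.I • η (Complex.I * X)) := rfl

lemma typeR_apply (η : ℂ →L[ℝ] E) (X : ℂ) :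
    typeR η X = (1 / 2 : ℂ) • (η X + Complex.I • η (Complex.I * X)) := rfl

lemma typeL_add_typeR (η : ℂ →L[ℝ] E) : typeL η + typeR η = η := by
  simp only [typeL, typeR]; module

lemma apply_I_mul_I (η : ℂ →L[ℝ] E) (X : ℂ) : η (Complex.I * (Complex.I * X)) = -η X := by
  rw [← mul_assoc, Complex.I_mul_I, neg_one_mul, map_neg]

lemma typeL_I (η : ℂ →L[ℝ] E) (X : ℂ) : typeL η (Complex.I * X) = Complex.I • typeL η X := by
  rw [typeL_apply, typeL_apply, apply_I_mul_I]
  match_scalars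
  · linear_combination (1 / 2 : ℂ) * Complex.I_mul_I
  · ring

lemma typeR_I (η : ℂ →L[ℝ] E) (X : ℂ) : typeR η (Complex.I * X) = -(Complex.I • typeR η X) := by
  rw [typeR_apply, typeR_apply, apply_I_mul_I]
  match_scalars
  · linear_combination (1 / 2 : ℂ) * Complex.I_mul_I
  · ring

/-- A sum of forms of types `(1,0)` and `(0,1)` has these as its parts. -/
lemma typeL_eq_of_types {η a b : ℂ →L[ℝ] E} (h : ∀ X, η X = a X + b X)
    (ha : ∀ X, a (Complex.I * X) = Complex.I • a X)
    (hb : ∀ X, b (Complex.I * X) = -(Complex.I • b X)) : typeL η = a := by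
  ext1 X
  rw [typeL_apply, h, h, ha, hb]
  match_scalars
  · linear_combination (-1 / 2 : ℂ) * Complex.I_mul_I
  · linear_combination (1 / 2 : ℂ) * Complex.I_mul_I

lemma typeR_eq_of_types {η a b : ℂ →L[ℝ] E} (h : ∀ X, η X = a X + b X)
    (ha : ∀ X, a (Complex.I * X) = Complex.I • a X)
    (hb : ∀ X, b (Complex.I * X) = -(Complex.I • b X)) : typeR η = b := by
  ext1 X
  rw [typeR_apply, h, h, ha, hb]
  match_scalars
  · linear_combination (1 / 2 : ℂ) * Complex.I_mul_I
  · linear_combination (-1 / 2 : ℂ) * Complex.I_mul_I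

lemma contDiffOn_typeL {Ω : Set ℂ} {η : ℂ → ℂ →L[ℝ] E} (h : ContDiffOn ℝ ∞ η Ω) :
    ContDiffOn ℝ ∞ (fun z => typeL (η z)) Ω :=
  (h.sub ((h.clm_comp contDiffOn_const).const_smul _)).const_smul _

lemma contDiffOn_typeR {Ω : Set ℂ} {η : ℂ → ℂ →L[ℝ] E} (h : ContDiffOn ℝ ∞ η Ω) :
    ContDiffOn ℝ ∞ (fun z => typeR (η z)) Ω :=
  (h.add ((h.clm_comp contDiffOn_const).const_smul _)).const_smul _

end Types

/-- The Laurent family of a pair of forms `N`, `Q`. -/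
def LaurentForm.ofForms (N Q : ℂ → ℂ →L[ℝ] 𝔸) : LaurentForm 𝔸 where
  m2 := fun z => typeL (Q z)
  m1 := fun z => typeL (N z)
  z0 := fun z => -N z - typeL (Q z) - typeR (Q z)
  p1 := fun z => typeR (N z)
  p2 := fun z => typeR (Q z)

lemma LaurentForm.form_ofForms (N Q : ℂ → ℂ →L[ℝ] 𝔸) (t z : ℂ) :
    (LaurentForm.ofForms N Q).form t z = -N z + t⁻¹ • typeL (N z) + t • typeR (N z)
      + (t⁻¹ ^ 2 - 1) • typeL (Q z) + (t ^ 2 - 1) • typeR (Q z) := by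
  simp only [form, ofForms]; module

/-- At the parameter 1 the connection is `d`. Dressing destroys this normalisation, and the final
gauge by `r(1)⁻¹` restores it. -/
lemma LaurentForm.form_ofForms_one (N Q : ℂ → ℂ →L[ℝ] 𝔸) (z : ℂ) :
    (LaurentForm.ofForms N Q).form 1 z = 0 := by
  rw [form_ofForms]
  nth_rewrite 1 [← typeL_add_typeR (N z)]
  simp

variable {Ω : Set ℂ} {τ : 𝔸 →L[ℂ] 𝔸} {ρ : ℂ → 𝔸}

/-- A constrained harmonic bundle defines a Laurent family. -/
theorem isLax_ofForms (hΩ : IsOpen Ω) (hτ : ∀ a b, τ (a * b) = τ b * τ a) {N Q : ℂ → ℂ →L[ℝ] 𝔸}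
    (hN : ContDiffOn ℝ ∞ N Ω) (hQ : ContDiffOn ℝ ∞ Q Ω) (hρ : ContDiffOn ℝ ∞ ρ Ω)
    (hsq : ∀ z ∈ Ω, ρ z * ρ z = 1) (hτρ : ∀ z ∈ Ω, τ (ρ z) = ρ z)
    (hNρ : ∀ z ∈ Ω, ∀ X, N z X = -((1 / 2 : ℂ) • (ρ z * fderiv ℝ ρ z X)))
    (hQτ : ∀ z ∈ Ω, ∀ X, τ (Q z X) = -Q z X)
    (hQρ : ∀ z ∈ Ω, ∀ X, ρ z * Q z X = Q z X * ρ z)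
    (hflat : ∀ t : ℂ, t ≠ 0 → ∀ z ∈ Ω, ∀ X Y,
      curv ((LaurentForm.ofForms N Q).form t) z X Y = 0) :
    IsLax Ω τ Complex.I ρ (LaurentForm.ofForms N Q) := by
  have hd : ∀ z ∈ Ω, ∀ X, ρ z * fderiv ℝ ρ z X = -(fderiv ℝ ρ z X * ρ z) := fun z hz X =>
    fderiv_inv_mul hΩ hρ hρ hsq hz X
  have hdτ : ∀ z ∈ Ω, ∀ X, τ (fderiv ℝ ρ z X) = fderiv ℝ ρ z X := fun z hz X => by
    have h1 := ((τ.restrictScalars ℝ).hasFDerivAt.comp z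
      (differentiableAt_of_contDiffOn hΩ hρ hz).hasFDerivAt).fderiv
    have h2 : fderiv ℝ (fun y => τ (ρ y)) z = _ := h1
    rw [fderiv_congr_on hΩ hτρ hz] at h2
    conv_rhs => rw [h2]
    rfl
  have hNτ : ∀ z ∈ Ω, ∀ X, τ (N z X) = -N z X := fun z hz X => by
    rw [hNρ z hz, map_neg, map_smul, hτ, hdτ z hz, hτρ z hz, hd z hz]; module
  -- The derivative of `ρ * ρ = 1` shows that the derivative of `ρ` anticommutes with `ρ`; hence so
  -- does `N`, and `ρ` is parallel for `d - N`.
  have hNa : ∀ z ∈ Ω, ∀ X, ρ z * N z X = -(N z X * ρ z) := fun z hz X => by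
    have h1 : ρ z * fderiv ℝ ρ z X * ρ z = -(ρ z * (ρ z * fderiv ℝ ρ z X)) := by
      rw [hd z hz, mul_neg, neg_neg, ← mul_assoc, hd z hz]
    rw [hNρ z hz, mul_neg, mul_smul_comm, neg_mul, smul_mul_assoc, h1]; module
  have hNd : ∀ z ∈ Ω, ∀ X, fderiv ℝ ρ z X = -(ρ z * N z X) + N z X * ρ z := fun z hz X => by
    have : fderiv ℝ ρ z X = (-2 : ℂ) • (ρ z * N z X) := by
      rw [hNρ z hz, mul_neg, mul_smul_comm, ← mul_assoc, hsq z hz, one_mul]; module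
    rw [this, ← neg_eq_iff_eq_neg.2 (hNa z hz X)]; module
  refine ⟨⟨contDiffOn_typeL hQ, contDiffOn_typeL hN, (hN.neg.sub (contDiffOn_typeL hQ)).sub
    (contDiffOn_typeR hQ), contDiffOn_typeR hN, contDiffOn_typeR hQ⟩, hρ, ?_, ?_, ?_, ?_, ?_,
    fun z _ X => typeL_I _ X, fun z _ X => typeL_I _ X, fun z _ X => typeR_I _ X,
    fun z _ X => typeR_I _ X, ?_, ?_, ?_, ?_, hsq, ?_, hflat⟩
  all_goals
    intro z hz X
    simp only [LaurentForm.ofForms, typeL_apply, typeR_apply, sub_apply, neg_apply, map_sub,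
      map_smul, map_add, map_neg, hNτ z hz, hQτ z hz, mul_smul_comm, smul_mul_assoc, mul_sub,
      sub_mul, mul_add, add_mul, mul_neg, neg_mul, hQρ z hz]
  · module
  · module
  · module
  · module
  · module
  · rw [hNa z hz, hNa z hz]; module
  · rw [hNa z hz, hNa z hz]; module
  · rw [hNd z hz]; module

/-- Gauging a Laurent family to the one of a constrained harmonic bundle. -/
theorem IsLax.curv_ofForms (hΩ : IsOpen Ω) {B : LaurentForm 𝔸} (hB : IsLax Ω τ Complex.I ρ B)
    {g h : ℂ → 𝔸} (hg : ContDiffOn ℝ ∞ g Ω)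
    (hh : ContDiffOn ℝ ∞ h Ω) (hgh : ∀ z ∈ Ω, g z * h z = 1) (hhg : ∀ z ∈ Ω, h z * g z = 1)
    (hB1 : ∀ z ∈ Ω, ∀ X, B.form 1 z X = -(fderiv ℝ g z X * h z))
    {N Q : ℂ → ℂ →L[ℝ] 𝔸}
    (hN : ∀ z ∈ Ω, ∀ X, N z X = -((1 / 2 : ℂ) • (h z * ρ z * g z *
      fderiv ℝ (fun y => h y * ρ y * g y) z X)))
    (hQ : ∀ z ∈ Ω, ∀ X, Q z X = h z * (B.m2 z X + B.p2 z X) * g z)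
    {t : ℂ} (ht : t ≠ 0) {z : ℂ} (hz : z ∈ Ω) (X Y : ℂ) :
    curv ((LaurentForm.ofForms N Q).form t) z X Y = 0 := by
  have hdgh := fun z hz X => fderiv_inv_mul hΩ hh hg hhg (z := z) hz X
  have hgh' : ∀ z ∈ Ω, ∀ x, g z * (h z * x) = x := fun z hz x => by
    rw [← mul_assoc, hgh z hz, one_mul]
  have hρ' : ∀ z ∈ Ω, ∀ x, ρ z * (ρ z * x) = x := fun z hz x => by
    rw [← mul_assoc, hB.refl_sq z hz, one_mul]
  -- In the derivative of `h ρ g`, the coefficients of `B` that commute with `ρ` drop out and the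
  -- anticommuting ones, `m1` and `p1`, survive.
  have hNB : ∀ z ∈ Ω, ∀ X, N z X = h z * B.m1 z X * g z + h z * B.p1 z X * g z := by
    intro z hz X
    have dg := differentiableAt_of_contDiffOn hΩ hg hz
    have dh := differentiableAt_of_contDiffOn hΩ hh hz
    have dρ := differentiableAt_of_contDiffOn hΩ hB.smooth_refl hz
    have hz0 : B.z0 z X = -(fderiv ℝ g z X * h z) - B.m2 z X - B.m1 z X - B.p1 z X - B.p2 z X := by
      rw [← hB1 z hz]
      simp only [LaurentForm.form, inv_one, one_pow, one_smul, add_apply]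
      abel
    have hdh : fderiv ℝ h z X = -(h z * (fderiv ℝ g z X * h z)) := by
      have := congrArg (· * h z) (hdgh z hz X)
      simp only [mul_assoc, hgh z hz, mul_one, neg_mul] at this
      rw [this, neg_neg]
    rw [hN z hz, fderiv_mul_apply (by exact dh.mul dρ) dg, fderiv_mul_apply dh dρ,
      hB.fderiv_refl z hz, hz0, hdh]
    have m1 := hB.parity_m1 z hz X
    have m2 := hB.parity_m2 z hz X
    have p1 := hB.parity_p1 z hz X
    have p2 := hB.parity_p2 z hz X
    have m1' : ∀ x, ρ z * (B.m1 z X * x) = -(B.m1 z X * (ρ z * x)) := fun x => by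
      rw [← mul_assoc, m1, neg_mul, mul_assoc]
    have m2' : ∀ x, ρ z * (B.m2 z X * x) = (B.m2 z X * (ρ z * x)) := fun x => by
      rw [← mul_assoc, m2, mul_assoc]
    have p1' : ∀ x, ρ z * (B.p1 z X * x) = -(B.p1 z X * (ρ z * x)) := fun x => by
      rw [← mul_assoc, p1, neg_mul, mul_assoc]
    have p2' : ∀ x, ρ z * (B.p2 z X * x) = (B.p2 z X * (ρ z * x)) := fun x => by
      rw [← mul_assoc, p2, mul_assoc]
    simp only [mul_assoc, mul_add, add_mul, mul_sub, sub_mul, mul_neg, neg_mul, hgh' z hz,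
      hhg z hz, hρ' z hz, m1', m2', p1', p2', mul_one]
    module
  -- The types of the coefficients of `B` identify the parts of `N` and `Q`, and `B.form 1` supplies
  -- the derivative of the gauge. Thus the family of `N`, `Q` is `B` gauged by `h = g⁻¹`.
  have hC : ∀ z ∈ Ω, ∀ X, (LaurentForm.ofForms N Q).form t z X
      = h z * B.form t z X * g z - fderiv ℝ h z X * g z := by
    intro z hz X
    have hl : typeL (N z) = sandwich (h z) (g z) (B.m1 z) :=
      typeL_eq_of_types (b := sandwich (h z) (g z) (B.p1 z)) (hNB z hz)
        (fun X => by simp [hB.type_m1 z hz]) (fun X => by simp [hB.type_p1 z hz])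
    have hr : typeR (N z) = sandwich (h z) (g z) (B.p1 z) :=
      typeR_eq_of_types (a := sandwich (h z) (g z) (B.m1 z)) (hNB z hz)
        (fun X => by simp [hB.type_m1 z hz]) (fun X => by simp [hB.type_p1 z hz])
    have hQ' : ∀ X, Q z X = sandwich (h z) (g z) (B.m2 z) X + sandwich (h z) (g z) (B.p2 z) X :=
      fun X => by rw [hQ z hz]; simp only [sandwich_apply]; noncomm_ring
    have hl' : typeL (Q z) = sandwich (h z) (g z) (B.m2 z) :=
      typeL_eq_of_types (b := sandwich (h z) (g z) (B.p2 z)) hQ'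
        (fun X => by simp [hB.type_m2 z hz]) (fun X => by simp [hB.type_p2 z hz])
    have hr' : typeR (Q z) = sandwich (h z) (g z) (B.p2 z) :=
      typeR_eq_of_types (a := sandwich (h z) (g z) (B.m2 z)) hQ'
        (fun X => by simp [hB.type_m2 z hz]) (fun X => by simp [hB.type_p2 z hz])
    have hdh : fderiv ℝ h z X * g z = h z * B.form 1 z X * g z := by
      rw [hB1 z hz, ← neg_eq_iff_eq_neg.2 (hdgh z hz X)]
      simp only [mul_neg, neg_mul, mul_assoc, hhg z hz, mul_one]
    rw [LaurentForm.form_ofForms, hl, hr, hl', hr', hdh]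
    simp only [LaurentForm.form, add_apply, neg_apply, smul_apply, sandwich_apply, hNB z hz,
      mul_add, add_mul, mul_smul_comm, smul_mul_assoc]
    module
  have hCs : ContDiffOn ℝ ∞ ((LaurentForm.ofForms N Q).form t) Ω := by
    refine ContDiffOn.congr (f := fun z => sandwich (h z) (g z) (B.form t z)
      - sandwich 1 (g z) (fderiv ℝ h z)) ?_ (fun y hy => ?_)
    · exact (ContDiffOn.sandwich hh hg (hB.smooth.form t)).sub
        (ContDiffOn.sandwich contDiffOn_const hg (contDiffOn_fderiv hΩ hh))
    · ext1 X
      rw [hC y hy]; simp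
  rw [curv_gauge hΩ hh hg hhg hgh (hB.smooth.form t) hCs hC hz, hB.flat t ht z hz]
  simp

end Harmonic

/-! ### The metric, transposes and conjugates -/

section Metric

variable {n : ℕ}

lemma CEnd.mul_smul (c : ℂ) (a b : CEnd n) : a * (c • b) = c • (a * b) := by ext1 v; simp

lemma CEnd.smul_mul (c : ℂ) (a b : CEnd n) : c • a * b = c • (a * b) := by ext1 v; simp

lemma metric_apply (u v : CVec n) : metric n u v =
    (∑ i : Fin (n + 1), u i.castSucc * v i.castSucc)
      - u (Fin.last (n + 1)) * v (Fin.last (n + 1)) := rfl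

lemma metric_comm (u v : CVec n) : metric n u v = metric n v u := by
  simp only [metric_apply, mul_comm]

lemma metric_star (u v : CVec n) : metric n (star u) (star v) = star (metric n u v) := by
  simp [metric_apply, star_sum]

lemma eq_zero_of_metric {u : CVec n} (h : ∀ v, metric n u v = 0) : u = 0 := by
  funext i
  refine Fin.lastCases ?_ (fun i => ?_) i
  · have := h (Pi.single (Fin.last _) 1)
    simpa [metric_apply, Pi.single_apply, Fin.castSucc_ne_last] using this
  · have := h (Pi.single i.castSucc 1)
    simpa [metric_apply, Pi.single_apply, (Fin.castSucc_ne_last i).symm] using this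

lemma eq_of_metric {u u' : CVec n} (h : ∀ v, metric n u v = metric n u' v) : u = u' := by
  refine sub_eq_zero.1 (eq_zero_of_metric fun v => ?_)
  rw [map_sub, LinearMap.sub_apply, h, sub_self]

lemma metric_nondegenerate : (metric n).Nondegenerate :=
  ⟨fun _ h => eq_zero_of_metric h,
    fun u h => eq_zero_of_metric fun v => by rw [metric_comm]; exact h v⟩

lemma metric_isRefl : (metric n).IsRefl := fun u v h => by rwa [metric_comm]

lemma mem_perp {P : Submodule ℂ (CVec n)} {v : CVec n} : v ∈ perp P ↔ ∀ u ∈ P, metric n u v = 0 :=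
  LinearMap.BilinForm.mem_orthogonal_iff

/-- The transpose of an endomorphism, as an untyped function. -/
def transposeFun (ξ : CEnd n) : CEnd n :=
  LinearMap.toContinuousLinearMap
    ((metric n).leftAdjointOfNondegenerate metric_nondegenerate (ξ : CVec n →ₗ[ℂ] CVec n))

lemma metric_transposeFun (ξ : CEnd n) (u v : CVec n) :
    metric n (transposeFun ξ u) v = metric n u (ξ v) :=
  (metric n).isAdjointPairLeftAdjointOfNondegenerate metric_nondegenerate
    (ξ : CVec n →ₗ[ℂ] CVec n) u v

/-- The transpose of an endomorphism with respect to the metric. -/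
def transpose (n : ℕ) : CEnd n →L[ℂ] CEnd n :=
  LinearMap.toContinuousLinearMap
    { toFun := transposeFun
      map_add' := fun ξ η => by
        ext1 u
        refine eq_of_metric fun v => ?_
        simp [metric_transposeFun]
      map_smul' := fun c ξ => by
        ext1 u
        refine eq_of_metric fun v => ?_
        simp [metric_transposeFun] }

@[simp] lemma metric_transpose (ξ : CEnd n) (u v : CVec n) :
    metric n (transpose n ξ u) v = metric n u (ξ v) := metric_transposeFun ξ u v

lemma metric_transpose' (ξ : CEnd n) (u v : CVec n) :
    metric n u (transpose n ξ v) = metric n (ξ u) v := by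
  rw [metric_comm, metric_transpose, metric_comm]

lemma transpose_mul (a b : CEnd n) :
    transpose n (a * b) = transpose n b * transpose n a := by
  ext1 u
  refine eq_of_metric fun v => ?_
  simp

lemma transpose_one : transpose n 1 = 1 := by
  ext1 u
  refine eq_of_metric fun v => ?_
  simp

lemma transpose_transpose (a : CEnd n) : transpose n (transpose n a) = a := by
  ext1 u
  refine eq_of_metric fun v => ?_
  rw [metric_transpose, metric_transpose']

/-- The conjugate `v ↦ star (ξ (star v))` of an endomorphism, as an untyped function. -/
def conjFun (ξ : CEnd n) : CEnd n :=
  LinearMap.toContinuousLinearMap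
    { toFun := fun v => star (ξ (star v))
      map_add' := fun u v => by simp
      map_smul' := fun c v => by simp [star_smul] }

lemma conjFun_apply (ξ : CEnd n) (v : CVec n) : conjFun ξ v = star (ξ (star v)) := rfl

/-- The conjugate `v ↦ star (ξ (star v))` of an endomorphism. -/
def conjEnd (n : ℕ) : CEnd n →L[ℝ] CEnd n :=
  LinearMap.toContinuousLinearMap
    { toFun := conjFun
      map_add' := fun ξ η => by ext1 v; simp [conjFun_apply]
      map_smul' := fun c ξ => by
        ext1 v
        simp only [conjFun_apply, smul_apply, RingHom.id_apply]
        rw [star_smul, star_trivial] }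

@[simp] lemma conjEnd_apply (ξ : CEnd n) (v : CVec n) : conjEnd n ξ v = star (ξ (star v)) := rfl

lemma conjEnd_mul (a b : CEnd n) : conjEnd n (a * b) = conjEnd n a * conjEnd n b := by
  ext1 v; simp

lemma conjEnd_one : conjEnd n 1 = 1 := by ext1 v; simp

lemma conjEnd_smul (c : ℂ) (a : CEnd n) : conjEnd n (c • a) = star c • conjEnd n a := by
  ext1 v; simp [star_smul]

lemma conjEnd_conjEnd (a : CEnd n) : conjEnd n (conjEnd n a) = a := by
  ext1 v; simp

/-- The endomorphism `w ↦ (u, w) v`. -/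
def rankOne (u v : CVec n) : CEnd n := LinearMap.toContinuousLinearMap ((metric n u).smulRight v)

@[simp] lemma rankOne_apply (u v w : CVec n) : rankOne u v w = metric n u w • v := rfl

lemma wedge_eq (u v : CVec n) : wedge u v = rankOne u v - rankOne v u := rfl

lemma transpose_rankOne (u v : CVec n) : transpose n (rankOne u v) = rankOne v u := by
  ext1 w
  refine eq_of_metric fun w' => ?_
  simp only [metric_transpose, rankOne_apply, map_smul, smul_eq_mul, LinearMap.smul_apply]
  rw [metric_comm w v, mul_comm]

lemma mul_rankOne (T : CEnd n) (u v : CVec n) : T * rankOne u v = rankOne u (T v) := by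
  ext1 w; simp

lemma rankOne_mul (T : CEnd n) (u v : CVec n) :
    rankOne u v * T = rankOne (transpose n T u) v := by
  ext1 w; simp

lemma rankOne_smul_left (c : ℂ) (u v : CVec n) : rankOne (c • u) v = c • rankOne u v := by
  ext1 w; simp [mul_smul]

lemma rankOne_smul_right (c : ℂ) (u v : CVec n) : rankOne u (c • v) = c • rankOne u v := by
  ext1 w; simp [smul_comm c]

lemma conjEnd_rankOne (u v : CVec n) :
    conjEnd n (rankOne u v) = rankOne (star u) (star v) := by
  ext1 w
  simp only [conjEnd_apply, rankOne_apply, star_smul]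
  rw [← metric_star, star_star]

/-- `rankOne` as a continuous bilinear map. -/
def rankOneL (n : ℕ) : CVec n →L[ℂ] CVec n →L[ℂ] CEnd n :=
  LinearMap.toContinuousLinearMap
    { toFun := fun u => LinearMap.toContinuousLinearMap
        { toFun := fun v => rankOne u v
          map_add' := fun v v' => by ext1 w; simp
          map_smul' := fun c v => by simp [rankOne_smul_right] }
      map_add' := fun u u' => by ext v w; simp [add_mul]
      map_smul' := fun c u => by ext1 v; simp [rankOne_smul_left] }

end Metric

/-! ### Orthogonal projections and reflections -/

section Reflection

variable {n : ℕ}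

/-- The four conditions force `P` and `Q` to be complementary, so the junk value of `projAlong` is
excluded without a separate check. -/
lemma projAlong_eq {P Q : Submodule ℂ (CVec n)} {T : CEnd n} (h1 : ∀ v, T v ∈ P)
    (h2 : ∀ v, v - T v ∈ Q) (h3 : ∀ v ∈ P, T v = v) (h4 : ∀ v ∈ Q, T v = 0) :
    projAlong P Q = T := by
  have hc : IsCompl P Q := by
    refine IsCompl.of_eq ((Submodule.eq_bot_iff _).2 fun v hv => ?_) (eq_top_iff.2 fun v _ => ?_)
    · rw [← h3 v hv.1, h4 v hv.2]
    · rw [← add_sub_cancel (T v) v]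
      exact Submodule.add_mem_sup (h1 v) (h2 v)
  rw [projAlong, dif_pos hc]
  ext1 v
  show P.projection Q hc v = T v
  conv_lhs => rw [← add_sub_cancel (T v) v]
  rw [map_add, Submodule.projection_apply_of_mem_left hc (h1 v),
    (Submodule.projection_apply_eq_zero_iff hc).2 (h2 v), add_zero]

/-- `ρ` is the reflection across `V`, characterised by its eigenspaces. -/
structure IsReflectionOf (ρ : CEnd n) (V : Submodule ℂ (CVec n)) : Prop where
  sq : ρ * ρ = 1
  tr : transpose n ρ = ρ
  mem_iff : ∀ v, v ∈ V ↔ ρ v = v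

lemma IsReflectionOf.apply_apply {ρ : CEnd n} {V : Submodule ℂ (CVec n)} (h : IsReflectionOf ρ V)
    (v : CVec n) : ρ (ρ v) = v := by
  have := congrArg (· v) h.sq
  simpa using this

lemma IsReflectionOf.metric_apply {ρ : CEnd n} {V : Submodule ℂ (CVec n)}
    (h : IsReflectionOf ρ V) (u v : CVec n) : metric n (ρ u) v = metric n u (ρ v) := by
  conv_lhs => rw [← h.tr]
  rw [metric_transpose]

/-- `V` consists of the vectors `w + ρ w`, up to factors. As `ρ` is symmetric, `(w + ρ w, v) = (w, v
+ ρ v)`, and the metric is non-degenerate. -/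
lemma IsReflectionOf.mem_perp_iff {ρ : CEnd n} {V : Submodule ℂ (CVec n)}
    (h : IsReflectionOf ρ V) (v : CVec n) : v ∈ perp V ↔ ρ v = -v := by
  rw [mem_perp]
  constructor
  · intro hv
    refine eq_of_metric fun w => ?_
    have h1 : w + ρ w ∈ V := by rw [h.mem_iff, map_add, h.apply_apply, add_comm]
    have h2 := hv _ h1
    rw [map_add, LinearMap.add_apply, h.metric_apply, metric_comm w, metric_comm w] at h2
    rw [map_neg, LinearMap.neg_apply]
    exact eq_neg_of_add_eq_zero_right h2
  · intro hv u hu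
    have h1 : metric n (ρ u) v = - metric n u v := by rw [h.metric_apply, hv, map_neg]
    rw [(h.mem_iff u).1 hu] at h1
    linear_combination (1 / 2 : ℂ) * h1

lemma IsReflectionOf.perp_perp {ρ : CEnd n} {V : Submodule ℂ (CVec n)}
    (h : IsReflectionOf ρ V) : IsReflectionOf (-ρ) (perp V) where
  sq := (neg_mul_neg ρ ρ).trans h.sq
  tr := by rw [map_neg, h.tr]
  mem_iff := fun v => by rw [h.mem_perp_iff, neg_apply, neg_eq_iff_eq_neg]

lemma IsReflectionOf.orthProj_eq {ρ : CEnd n} {V : Submodule ℂ (CVec n)}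
    (h : IsReflectionOf ρ V) : orthProj V = (1 / 2 : ℂ) • (1 + ρ) := by
  refine projAlong_eq (fun v => ?_) (fun v => ?_) (fun v hv => ?_) (fun v hv => ?_)
  · rw [h.mem_iff]
    simp [h.apply_apply, add_comm]
  · rw [h.mem_perp_iff]
    simp only [smul_apply, add_apply, map_sub, map_smul, map_add,
      one_apply_eq_self, h.apply_apply]
    module
  · rw [h.mem_iff] at hv
    simp only [smul_apply, add_apply, one_apply_eq_self, hv]
    module
  · rw [h.mem_perp_iff] at hv
    simp [hv]

lemma IsReflectionOf.orthProj_perp_eq {ρ : CEnd n} {V : Submodule ℂ (CVec n)}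
    (h : IsReflectionOf ρ V) : orthProj (perp V) = (1 / 2 : ℂ) • (1 - ρ) := by
  rw [h.perp_perp.orthProj_eq, sub_eq_add_neg]

lemma IsReflectionOf.reflection_eq {ρ : CEnd n} {V : Submodule ℂ (CVec n)}
    (h : IsReflectionOf ρ V) : reflection V = ρ := by
  rw [reflection, h.orthProj_eq, h.orthProj_perp_eq]; module

lemma IsReflectionOf.nondegenerate {ρ : CEnd n} {V : Submodule ℂ (CVec n)}
    (h : IsReflectionOf ρ V) : ((metric n).restrict V).Nondegenerate := by
  rw [LinearMap.BilinForm.restrict_nondegenerate_iff_isCompl_orthogonal metric_isRefl]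
  refine IsCompl.of_eq ((Submodule.eq_bot_iff _).2 fun v hv => ?_) (eq_top_iff.2 fun v _ => ?_)
  · have h1 := (h.mem_iff v).1 hv.1
    have h2 := (h.mem_perp_iff v).1 hv.2
    rw [h1] at h2
    exact self_eq_neg.1 h2
  · have : v = (1 / 2 : ℂ) • (v + ρ v) + (1 / 2 : ℂ) • (v - ρ v) := by module
    rw [this]
    refine Submodule.add_mem_sup (Submodule.smul_mem _ _ ?_) (Submodule.smul_mem _ _ ?_)
    · rw [h.mem_iff, map_add, h.apply_apply, add_comm]
    · refine (h.mem_perp_iff _).2 ?_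
      rw [map_sub, h.apply_apply, neg_sub]

lemma isReflectionOf_reflection {V : Submodule ℂ (CVec n)}
    (h : ((metric n).restrict V).Nondegenerate) : IsReflectionOf (reflection V) V := by
  have hc : IsCompl V (perp V) :=
    LinearMap.BilinForm.isCompl_orthogonal_of_restrict_nondegenerate metric_isRefl h
  have hpp : perp (perp V) = V :=
    LinearMap.BilinForm.orthogonal_orthogonal metric_nondegenerate metric_isRefl V
  have e1 : ∀ v, orthProj V v = V.projection (perp V) hc v := fun v => by
    rw [orthProj, projAlong, dif_pos hc]; rfl
  have e2 : ∀ v, orthProj (perp V) v = v - V.projection (perp V) hc v := fun v => by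
    rw [orthProj, hpp, projAlong, dif_pos hc.symm, ← Submodule.projection_eq_self_sub_projection]
    rfl
  have e3 : ∀ v, reflection V v = (2 : ℂ) • V.projection (perp V) hc v - v := fun v => by
    rw [reflection, sub_apply, e1, e2]; module
  have e4 : ∀ v, V.projection (perp V) hc v ∈ V := Submodule.projection_apply_mem hc
  have e5 : ∀ v, v - V.projection (perp V) hc v ∈ perp V := Submodule.sub_projection_mem hc
  have e6 : ∀ v, V.projection (perp V) hc (V.projection (perp V) hc v)
      = V.projection (perp V) hc v := fun v => Submodule.projection_apply_of_mem_left hc (e4 v)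
  refine ⟨?_, ?_, fun v => ?_⟩
  · ext1 v
    rw [mul_apply_eq_comp, e3, e3, map_sub, map_smul, e6,
      one_apply_eq_self]
    module
  · ext1 u
    refine eq_of_metric fun v => ?_
    rw [metric_transpose, e3, e3]
    have h1 := mem_perp.1 (e5 v) _ (e4 u)
    have h2 := mem_perp.1 (e5 u) _ (e4 v)
    rw [metric_comm] at h2
    simp only [map_sub, map_smul, LinearMap.sub_apply, LinearMap.smul_apply, smul_eq_mul] at h1 h2 ⊢
    linear_combination 2 * h2 - 2 * h1
  · rw [e3]
    constructor
    · intro hv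
      rw [Submodule.projection_apply_of_mem_left hc hv]; module
    · intro hv
      have : v = V.projection (perp V) hc v := by
        have h2 : (2 : ℂ) • V.projection (perp V) hc v = (2 : ℂ) • v := by
          rw [sub_eq_iff_eq_add.1 hv]; module
        exact (smul_right_injective _ (two_ne_zero (α := ℂ)) h2).symm
      rw [this]; exact e4 v

/-- Transport of a reflection by an orthogonal transformation. -/
lemma IsReflectionOf.image {ρ T : CEnd n} {V : Submodule ℂ (CVec n)} (h : IsReflectionOf ρ V)
    (h1 : transpose n T * T = 1) (h2 : T * transpose n T = 1) :
    IsReflectionOf (T * ρ * transpose n T) (image T V) where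
  sq := by
    calc T * ρ * transpose n T * (T * ρ * transpose n T)
        = T * ρ * (transpose n T * T) * ρ * transpose n T := by noncomm_ring
      _ = T * (ρ * ρ) * transpose n T := by rw [h1]; noncomm_ring
      _ = 1 := by rw [h.sq, mul_one, h2]
  tr := by rw [transpose_mul, transpose_mul, transpose_transpose, h.tr, mul_assoc]
  mem_iff := fun v => by
    have h1' : ∀ v, transpose n T (T v) = v := fun v => by
      simpa using congrArg (· v) h1
    have h2' : ∀ v, T (transpose n T v) = v := fun v => by
      simpa using congrArg (· v) h2
    constructor
    · rintro ⟨w, hw, rfl⟩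
      have := (h.mem_iff w).1 hw
      simp [h1', this]
    · intro hv
      refine ⟨transpose n T v, ?_, h2' v⟩
      show transpose n T v ∈ V
      rw [h.mem_iff]
      have := congrArg (transpose n T) hv
      simpa [h1'] using this

lemma wedge_conj (T : CEnd n) (u v : CVec n) :
    T * wedge u v * transpose n T = wedge (T u) (T v) := by
  rw [wedge_eq, wedge_eq, mul_sub, sub_mul, mul_rankOne, mul_rankOne, rankOne_mul, rankOne_mul,
    transpose_transpose]

lemma wedgeSq_conj {T : CEnd n} {P P' : Submodule ℂ (CVec n)} (hT : ∀ v ∈ P, T v ∈ P')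
    {ξ : CEnd n} (hξ : ξ ∈ wedgeSq P) : T * ξ * transpose n T ∈ wedgeSq P' := by
  refine Submodule.span_induction ?_ ?_ ?_ ?_ hξ
  · rintro _ ⟨u, hu, v, hv, rfl⟩
    rw [wedge_conj]
    exact Submodule.subset_span ⟨_, hT u hu, _, hT v hv, rfl⟩
  · simp
  · intro x y _ _ hx hy
    rw [mul_add, add_mul]; exact Submodule.add_mem _ hx hy
  · intro c x _ hx
    rw [CEnd.mul_smul, CEnd.smul_mul]; exact Submodule.smul_mem _ _ hx

lemma wedgeSq_sup_conj {T : CEnd n} {P P' R R' : Submodule ℂ (CVec n)} (hT : ∀ v ∈ P, T v ∈ P')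
    (hT' : ∀ v ∈ R, T v ∈ R') {ξ : CEnd n} (hξ : ξ ∈ wedgeSq P ⊔ wedgeSq R) :
    T * ξ * transpose n T ∈ wedgeSq P' ⊔ wedgeSq R' := by
  obtain ⟨a, ha, b, hb, rfl⟩ := Submodule.mem_sup.1 hξ
  rw [mul_add, add_mul]
  exact Submodule.add_mem_sup (wedgeSq_conj hT ha) (wedgeSq_conj hT' hb)

lemma transpose_of_mem_wedgeSq {P : Submodule ℂ (CVec n)} {ξ : CEnd n} (hξ : ξ ∈ wedgeSq P) :
    transpose n ξ = -ξ := by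
  refine Submodule.span_induction ?_ ?_ ?_ ?_ hξ
  · rintro _ ⟨u, hu, v, hv, rfl⟩
    rw [wedge_eq, map_sub, transpose_rankOne, transpose_rankOne, neg_sub]
  · simp
  · intro x y _ _ hx hy
    rw [map_add, hx, hy, neg_add]
  · intro c x _ hx
    rw [map_smul, hx, smul_neg]

/-- Both vectors of `u ∧ v` are multiplied by `ε`. With `ε = 1` on `V` and `ε = -1` on its
orthogonal, this makes `q` commute with `ρ`. -/
lemma conj_of_mem_wedgeSq {P : Submodule ℂ (CVec n)} {T ξ : CEnd n} {ε : ℂ} (hε : ε * ε = 1)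
    (hT : ∀ v ∈ P, T v = ε • v) (hξ : ξ ∈ wedgeSq P) : T * ξ * transpose n T = ξ := by
  refine Submodule.span_induction ?_ ?_ ?_ ?_ hξ
  · rintro _ ⟨u, hu, v, hv, rfl⟩
    rw [wedge_conj, hT u hu, hT v hv, wedge_eq, wedge_eq]
    simp only [rankOne_smul_left, rankOne_smul_right, smul_smul, hε, one_smul]
  · simp
  · intro x y _ _ hx hy
    rw [mul_add, add_mul, hx, hy]
  · intro c x _ hx
    rw [CEnd.mul_smul, CEnd.smul_mul, hx]

lemma transpose_of_mem_sup {V : Submodule ℂ (CVec n)} {ξ : CEnd n}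
    (hξ : ξ ∈ wedgeSq V ⊔ wedgeSq (perp V)) : transpose n ξ = -ξ := by
  obtain ⟨a, ha, b, hb, rfl⟩ := Submodule.mem_sup.1 hξ
  rw [map_add, transpose_of_mem_wedgeSq ha, transpose_of_mem_wedgeSq hb, neg_add]

lemma IsReflectionOf.comm_of_mem_sup {ρ : CEnd n} {V : Submodule ℂ (CVec n)}
    (h : IsReflectionOf ρ V) {ξ : CEnd n}
    (hξ : ξ ∈ wedgeSq V ⊔ wedgeSq (perp V)) : ρ * ξ = ξ * ρ := by
  obtain ⟨a, ha, b, hb, rfl⟩ := Submodule.mem_sup.1 hξ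
  have h1 := conj_of_mem_wedgeSq (T := ρ) (ε := 1) (by simp)
    (fun v hv => by rw [one_smul]; exact (h.mem_iff v).1 hv) ha
  have h2 := conj_of_mem_wedgeSq (T := ρ) (ε := -1) (by simp)
    (fun v hv => by rw [neg_one_smul]; exact (h.mem_perp_iff v).1 hv) hb
  rw [h.tr] at h1 h2
  have h3 : ρ * (a + b) * ρ = a + b := by rw [mul_add, add_mul, h1, h2]
  calc ρ * (a + b) = ρ * (a + b) * (ρ * ρ) := by rw [h.sq, mul_one]
    _ = ρ * (a + b) * ρ * ρ := by noncomm_ring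
    _ = _ := by rw [h3]

/-- The reflection across a real subspace is real. -/
lemma IsReflectionOf.conjEnd_eq {ρ : CEnd n} {V : Submodule ℂ (CVec n)}
    (h : IsReflectionOf ρ V) (hV : conjSpace V = V) : conjEnd n ρ = ρ := by
  have h1 : ∀ v, v ∈ V ↔ star v ∈ V := fun v => by
    conv_lhs => rw [← hV]
    rfl
  have h2 : ∀ v, v ∈ perp V → star v ∈ perp V := fun v hv => by
    rw [mem_perp] at hv ⊢
    intro u hu
    have := hv (star u) ((h1 u).1 hu)
    rw [← star_star u, metric_star, this, star_zero]
  -- Conjugation preserves `V` and its orthogonal; it is applied to the components `v + ρ v` and `v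
  -- - ρ v` of `2v`.
  ext1 v
  have e1 : v + ρ v ∈ V := by rw [h.mem_iff, map_add, h.apply_apply, add_comm]
  have e2 : v - ρ v ∈ perp V := by rw [h.mem_perp_iff, map_sub, h.apply_apply, neg_sub]
  have e3 := (h.mem_iff _).1 ((h1 _).1 e1)
  have e4 := (h.mem_perp_iff _).1 (h2 _ e2)
  rw [star_add, map_add] at e3
  rw [star_sub, map_sub] at e4
  have e5 : ρ (star v) = star (ρ v) := by
    have : (2 : ℂ) • ρ (star v) = (2 : ℂ) • star (ρ v) := by
      rw [two_smul, two_smul]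
      calc ρ (star v) + ρ (star v) = (ρ (star v) + ρ (star (ρ v)))
            + (ρ (star v) - ρ (star (ρ v))) := by abel
        _ = _ := by rw [e3, e4]; abel
    exact smul_right_injective _ (two_ne_zero (α := ℂ)) this
  rw [conjEnd_apply, e5, star_star]

end Reflection

/-! ### Null lines and their dressing transformations -/

section NullLine

variable {n : ℕ}

/-- The projection onto the line of `l` with kernel the orthogonal of `ρ l`. -/
def nullProj (ρ : CEnd n) (l : CVec n) : CEnd n := (metric n l (ρ l))⁻¹ • rankOne (ρ l) l

/-- The projection onto the line of `ρ l` with kernel the orthogonal of `l`. -/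
def nullProj' (ρ : CEnd n) (l : CVec n) : CEnd n := (metric n l (ρ l))⁻¹ • rankOne l (ρ l)

/-- `dress` for the null line spanned by `l`. -/
def nullDress (ρ : CEnd n) (l : CVec n) (c : ℂ) : CEnd n :=
  dress c (nullProj ρ l) (nullProj' ρ l)

/-- `l` is null and not orthogonal to its reflection. -/
structure IsNullVector (ρ : CEnd n) (l : CVec n) : Prop where
  null : metric n l l = 0
  ne : metric n l (ρ l) ≠ 0

lemma nullProj_apply (ρ : CEnd n) (l w : CVec n) :
    nullProj ρ l w = ((metric n l (ρ l))⁻¹ * metric n (ρ l) w) • l := by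
  simp [nullProj, mul_smul]

lemma nullProj'_apply (ρ : CEnd n) (l w : CVec n) :
    nullProj' ρ l w = ((metric n l (ρ l))⁻¹ * metric n l w) • ρ l := by
  simp [nullProj', mul_smul]

lemma nullDress_apply (ρ : CEnd n) (l : CVec n) (c : ℂ) (w : CVec n) :
    nullDress ρ l c w = w + ((c - 1) / metric n l (ρ l) * metric n (ρ l) w) • l
      + ((c⁻¹ - 1) / metric n l (ρ l) * metric n l w) • ρ l := by
  have : nullDress ρ l c w = w + (c - 1) • nullProj ρ l w + (c⁻¹ - 1) • nullProj' ρ l w := rfl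
  rw [this, nullProj_apply, nullProj'_apply, smul_smul, smul_smul]
  simp only [div_eq_mul_inv, mul_assoc]

variable {ρ : CEnd n} {V : Submodule ℂ (CVec n)}

lemma IsReflectionOf.metric_refl (h : IsReflectionOf ρ V) (u v : CVec n) :
    metric n (ρ u) (ρ v) = metric n u v := by
  rw [h.metric_apply, h.apply_apply]

lemma isNullPair_nullProj (h : IsReflectionOf ρ V) {l : CVec n} (hl : IsNullVector ρ l) :
    IsNullPair (transpose n) ρ (nullProj ρ l) (nullProj' ρ l) := by
  have h0 := hl.null
  have h1 : metric n (ρ l) (ρ l) = 0 := by rw [h.metric_refl, h0]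
  have ha := hl.ne
  have h2 : metric n (ρ l) l = metric n l (ρ l) := metric_comm _ _
  -- The reason that weights ±2 vanish: `e ξ f` and `f ξ e` involve only `(ρ l, ξ ρ l)` and `(l, ξ
  -- l)`.
  have sk : ∀ (ξ : CEnd n) (u : CVec n), transpose n ξ = -ξ → metric n u (ξ u) = 0 := by
    intro ξ u hξ
    have := metric_transpose ξ u u
    rw [hξ, neg_apply, map_neg, LinearMap.neg_apply, metric_comm] at this
    linear_combination (-1 / 2 : ℂ) * this
  refine ⟨?_, ?_, ?_, ?_, ?_, ?_, ?_, ?_, fun ξ hξ => ?_, fun ξ hξ => ?_⟩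
  · ext1 w; simp [nullProj_apply, h2, ha]
  · ext1 w; simp [nullProj'_apply, ha]
  · ext1 w; simp [nullProj_apply, nullProj'_apply, h1]
  · ext1 w; simp [nullProj_apply, nullProj'_apply, h0]
  · ext1 w; simp [nullProj_apply, nullProj'_apply, h.metric_apply]
  · ext1 w; simp [nullProj_apply, nullProj'_apply, h.metric_refl, h.apply_apply]
  · rw [nullProj, map_smul, transpose_rankOne, nullProj']
  · rw [nullProj', map_smul, transpose_rankOne, nullProj]
  · ext1 w; simp [nullProj_apply, nullProj'_apply, sk ξ _ hξ]
  · ext1 w; simp [nullProj_apply, nullProj'_apply, sk ξ _ hξ]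

lemma transpose_nullDress (h : IsReflectionOf ρ V) {l : CVec n} (hl : IsNullVector ρ l) (c : ℂ) :
    transpose n (nullDress ρ l c) = nullDress ρ l c⁻¹ := by
  have hp := isNullPair_nullProj h hl
  rw [nullDress, nullDress, dress, dress, map_add, map_add, map_smul, map_smul, hp.tr_left,
    hp.tr_right, transpose_one, inv_inv]
  abel

lemma nullDress_mul (h : IsReflectionOf ρ V) {l : CVec n} (hl : IsNullVector ρ l) {c d : ℂ}
    (hc : c ≠ 0) (hd : d ≠ 0) : nullDress ρ l c * nullDress ρ l d = nullDress ρ l (c * d) :=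
  dress_mul_dress (isNullPair_nullProj h hl) hc hd

lemma nullDress_one (ρ : CEnd n) (l : CVec n) : nullDress ρ l 1 = 1 := dress_one _ _

lemma nullDress_mul_inv (h : IsReflectionOf ρ V) {l : CVec n} (hl : IsNullVector ρ l) {c : ℂ}
    (hc : c ≠ 0) : nullDress ρ l c * nullDress ρ l c⁻¹ = 1 :=
  dress_mul_dress_inv (isNullPair_nullProj h hl) hc

lemma nullDress_inv_mul (h : IsReflectionOf ρ V) {l : CVec n} (hl : IsNullVector ρ l) {c : ℂ}
    (hc : c ≠ 0) : nullDress ρ l c⁻¹ * nullDress ρ l c = 1 :=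
  dress_inv_mul_dress (isNullPair_nullProj h hl) hc

lemma refl_mul_nullDress (h : IsReflectionOf ρ V) (l : CVec n) (c : ℂ) :
    ρ * nullDress ρ l c = nullDress ρ l c⁻¹ * ρ := by
  ext1 w
  simp only [mul_apply_eq_comp, nullDress_apply, map_add, map_smul, h.apply_apply, h.metric_refl,
    h.metric_apply, inv_inv]
  abel

lemma metric_nullDress (h : IsReflectionOf ρ V) {l : CVec n} (hl : IsNullVector ρ l) {c : ℂ}
    (hc : c ≠ 0) (u v : CVec n) :
    metric n (nullDress ρ l c u) (nullDress ρ l c v) = metric n u v := by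
  rw [← metric_transpose, transpose_nullDress h hl]
  have := congrArg (· u) (nullDress_inv_mul h hl hc)
  simp only [mul_apply_eq_comp, one_apply_eq_self] at this
  rw [this]

lemma conjEnd_nullProj (hρ : conjEnd n ρ = ρ) (l : CVec n) :
    conjEnd n (nullProj ρ l) = nullProj ρ (star l) := by
  have h1 : ∀ v, star (ρ v) = ρ (star v) := fun v => by
    conv_rhs => rw [← hρ]
    simp
  rw [nullProj, nullProj, conjEnd_smul, conjEnd_rankOne, h1, ← h1 l, metric_star, star_inv₀]

lemma conjEnd_nullProj' (hρ : conjEnd n ρ = ρ) (l : CVec n) :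
    conjEnd n (nullProj' ρ l) = nullProj' ρ (star l) := by
  have h1 : ∀ v, star (ρ v) = ρ (star v) := fun v => by
    conv_rhs => rw [← hρ]
    simp
  rw [nullProj', nullProj', conjEnd_smul, conjEnd_rankOne, h1, ← h1 l, metric_star, star_inv₀]

lemma conjEnd_nullDress (hρ : conjEnd n ρ = ρ) (l : CVec n) (c : ℂ) :
    conjEnd n (nullDress ρ l c) = nullDress ρ (star l) (star c) := by
  rw [nullDress, nullDress, dress, dress, map_add, map_add, conjEnd_smul, conjEnd_smul,
    conjEnd_nullProj hρ, conjEnd_nullProj' hρ, conjEnd_one]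
  simp

lemma IsNullVector.star (hρ : conjEnd n ρ = ρ) {l : CVec n} (hl : IsNullVector ρ l) :
    IsNullVector ρ (star l) := by
  have h1 : ∀ v, Star.star (ρ v) = ρ (Star.star v) := fun v => by
    conv_rhs => rw [← hρ]
    simp
  refine ⟨by rw [metric_star, hl.null, star_zero], ?_⟩
  rw [← h1, metric_star]
  exact star_ne_zero.2 hl.ne

lemma image_span_singleton (T : CEnd n) (l : CVec n) :
    image T (Submodule.span ℂ {l}) = Submodule.span ℂ {T l} := by
  rw [image, Submodule.map_span, Set.image_singleton]; rfl

lemma conjSpace_span_singleton (l : CVec n) :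
    conjSpace (Submodule.span ℂ {l}) = Submodule.span ℂ {star l} := by
  ext v
  show star v ∈ Submodule.span ℂ {l} ↔ _
  simp only [Submodule.mem_span_singleton]
  constructor
  · rintro ⟨c, hc⟩
    exact ⟨star c, by rw [← star_smul, hc, star_star]⟩
  · rintro ⟨c, hc⟩
    exact ⟨star c, by rw [← hc, star_smul, star_star]⟩

/-! ### Formulas for the projections attached to a null line and for `threeEigen` -/

/-- The projection onto `L` along `ρL ⊔ (L ⊔ ρL)^⊥`. -/
def lineProj (V L : Submodule ℂ (CVec n)) : CEnd n :=
  projAlong L (image (reflection V) L ⊔ perp (L ⊔ image (reflection V) L))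

/-- The projection onto `ρL` along `L ⊔ (L ⊔ ρL)^⊥`. -/
def lineProj' (V L : Submodule ℂ (CVec n)) : CEnd n :=
  projAlong (image (reflection V) L) (L ⊔ perp (L ⊔ image (reflection V) L))

lemma mem_perp_span_sup {u v w : CVec n} :
    w ∈ perp (Submodule.span ℂ {u} ⊔ Submodule.span ℂ {v}) ↔ metric n u w = 0 ∧ metric n v w = 0 := by
  rw [mem_perp]
  constructor
  · intro h
    exact ⟨h u (Submodule.mem_sup_left (Submodule.mem_span_singleton_self u)),
      h v (Submodule.mem_sup_right (Submodule.mem_span_singleton_self v))⟩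
  · rintro ⟨h1, h2⟩ x hx
    obtain ⟨y, hy, z, hz, rfl⟩ := Submodule.mem_sup.1 hx
    obtain ⟨c, rfl⟩ := Submodule.mem_span_singleton.1 hy
    obtain ⟨d, rfl⟩ := Submodule.mem_span_singleton.1 hz
    simp [h1, h2]

lemma sub_nullProj_mem_perp (h : IsReflectionOf ρ V) {l : CVec n} (hl : IsNullVector ρ l)
    (v : CVec n) : v - nullProj ρ l v - nullProj' ρ l v ∈
      perp (Submodule.span ℂ {l} ⊔ Submodule.span ℂ {ρ l}) := by
  have h1 : metric n (ρ l) (ρ l) = 0 := by rw [h.metric_refl, hl.null]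
  have ha := hl.ne
  have h2 : metric n (ρ l) l = metric n l (ρ l) := metric_comm _ _
  rw [mem_perp_span_sup, nullProj_apply, nullProj'_apply]
  simp only [map_sub, map_smul, smul_eq_mul, hl.null, h1, h2]
  constructor <;> field_simp <;> ring

lemma lineProj_span (h : IsReflectionOf ρ V) {l : CVec n} (hl : IsNullVector ρ l) :
    lineProj V (Submodule.span ℂ {l}) = nullProj ρ l := by
  have h1 : metric n (ρ l) (ρ l) = 0 := by rw [h.metric_refl, hl.null]
  have ha := hl.ne
  have h2 : metric n (ρ l) l = metric n l (ρ l) := metric_comm _ _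
  rw [lineProj, h.reflection_eq, image_span_singleton]
  refine projAlong_eq (fun v => ?_) (fun v => ?_) (fun v hv => ?_) (fun v hv => ?_)
  · rw [nullProj_apply]; exact Submodule.smul_mem _ _ (Submodule.mem_span_singleton_self _)
  · have : v - nullProj ρ l v
        = nullProj' ρ l v + (v - nullProj ρ l v - nullProj' ρ l v) := by abel
    rw [this]
    refine Submodule.add_mem_sup ?_ (sub_nullProj_mem_perp h hl v)
    rw [nullProj'_apply]; exact Submodule.smul_mem _ _ (Submodule.mem_span_singleton_self _)
  · obtain ⟨c, rfl⟩ := Submodule.mem_span_singleton.1 hv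
    rw [map_smul, nullProj_apply, h2, inv_mul_cancel₀ ha, one_smul]
  · obtain ⟨y, hy, z, hz, rfl⟩ := Submodule.mem_sup.1 hv
    obtain ⟨c, rfl⟩ := Submodule.mem_span_singleton.1 hy
    rw [nullProj_apply, map_add, map_smul, h1, (mem_perp_span_sup.1 hz).2]
    simp

lemma lineProj'_span (h : IsReflectionOf ρ V) {l : CVec n} (hl : IsNullVector ρ l) :
    lineProj' V (Submodule.span ℂ {l}) = nullProj' ρ l := by
  have ha := hl.ne
  rw [lineProj', h.reflection_eq, image_span_singleton]
  refine projAlong_eq (fun v => ?_) (fun v => ?_) (fun v hv => ?_) (fun v hv => ?_)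
  · rw [nullProj'_apply]; exact Submodule.smul_mem _ _ (Submodule.mem_span_singleton_self _)
  · have : v - nullProj' ρ l v
        = nullProj ρ l v + (v - nullProj ρ l v - nullProj' ρ l v) := by abel
    rw [this]
    refine Submodule.add_mem_sup ?_ (sub_nullProj_mem_perp h hl v)
    rw [nullProj_apply]; exact Submodule.smul_mem _ _ (Submodule.mem_span_singleton_self _)
  · obtain ⟨c, rfl⟩ := Submodule.mem_span_singleton.1 hv
    rw [map_smul, nullProj'_apply, inv_mul_cancel₀ ha, one_smul]
  · obtain ⟨y, hy, z, hz, rfl⟩ := Submodule.mem_sup.1 hv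
    obtain ⟨c, rfl⟩ := Submodule.mem_span_singleton.1 hy
    rw [nullProj'_apply, map_add, map_smul, hl.null, (mem_perp_span_sup.1 hz).1]
    simp

lemma threeEigen_span (h : IsReflectionOf ρ V) {l : CVec n} (hl : IsNullVector ρ l) (c : ℂ) :
    threeEigen V (Submodule.span ℂ {l}) c = nullDress ρ l c := by
  have h1 : metric n (ρ l) (ρ l) = 0 := by rw [h.metric_refl, hl.null]
  have ha := hl.ne
  have h2 : metric n (ρ l) l = metric n l (ρ l) := metric_comm _ _
  have e1 := lineProj_span h hl
  have e2 := lineProj'_span h hl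
  have e3 : projAlong (perp (Submodule.span ℂ {l} ⊔ image (reflection V) (Submodule.span ℂ {l})))
      (Submodule.span ℂ {l} ⊔ image (reflection V) (Submodule.span ℂ {l}))
      = 1 - nullProj ρ l - nullProj' ρ l := by
    rw [h.reflection_eq, image_span_singleton]
    refine projAlong_eq (fun v => ?_) (fun v => ?_) (fun v hv => ?_) (fun v hv => ?_)
    · exact sub_nullProj_mem_perp h hl v
    · have : v - (1 - nullProj ρ l - nullProj' ρ l) v = nullProj ρ l v + nullProj' ρ l v := by
        simp only [sub_apply, one_apply_eq_self]; abel
      rw [this, nullProj_apply, nullProj'_apply]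
      exact Submodule.add_mem_sup
        (Submodule.smul_mem _ _ (Submodule.mem_span_singleton_self _))
        (Submodule.smul_mem _ _ (Submodule.mem_span_singleton_self _))
    · obtain ⟨h3, h4⟩ := mem_perp_span_sup.1 hv
      simp [nullProj_apply, nullProj'_apply, h3, h4]
    · obtain ⟨y, hy, z, hz, rfl⟩ := Submodule.mem_sup.1 hv
      obtain ⟨c, rfl⟩ := Submodule.mem_span_singleton.1 hy
      obtain ⟨d, rfl⟩ := Submodule.mem_span_singleton.1 hz
      simp only [sub_apply, one_apply_eq_self, nullProj_apply, nullProj'_apply, map_add, map_smul,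
        hl.null, h1, h2]
      match_scalars <;> field_simp <;> ring
  unfold threeEigen
  rw [lineProj] at e1
  rw [lineProj'] at e2
  simp only [e1, e2, e3, nullDress, dress]
  module

/-- A null line meeting the genericity condition is spanned by a vector as in `IsNullVector`. -/
lemma isNullVector_of_inf (h : IsReflectionOf ρ V) {l : CVec n} (hl0 : l ≠ 0)
    (hl : metric n l l = 0)
    (hi : image (reflection V) (Submodule.span ℂ {l}) ⊓ perp (Submodule.span ℂ {l}) = ⊥) :
    IsNullVector ρ l := by
  refine ⟨hl, fun h0 => hl0 ?_⟩
  rw [h.reflection_eq, image_span_singleton] at hi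
  have : ρ l ∈ Submodule.span ℂ {ρ l} ⊓ perp (Submodule.span ℂ {l}) := by
    refine ⟨Submodule.mem_span_singleton_self _, mem_perp.2 fun u hu => ?_⟩
    obtain ⟨c, rfl⟩ := Submodule.mem_span_singleton.1 hu
    simp [h0]
  rw [hi, Submodule.mem_bot] at this
  rw [← h.apply_apply l, this, map_zero]

end NullLine

/-! ### Permutability of dressing transformations -/

section Permutability

variable {n : ℕ} {ρ : CEnd n} {V : Submodule ℂ (CVec n)}

/-- The numerator is symmetric in `l` and `m`. Hence genericity of the line obtained from `m` by
dressing with `l` is the same condition as with the roles exchanged. -/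
lemma metric_nullDress_refl (h : IsReflectionOf ρ V) {l m : CVec n} (hl : IsNullVector ρ l)
    (c : ℂ) :
    metric n (nullDress ρ l c m) (ρ (nullDress ρ l c m)) =
      (metric n l (ρ l) * metric n m (ρ m) + metric n l (ρ m) ^ 2 * (c ^ 2 - 1)
        + metric n l m ^ 2 * (c⁻¹ ^ 2 - 1)) / metric n l (ρ l) := by
  have ha := hl.ne
  have h1 : metric n (ρ l) (ρ l) = 0 := by rw [h.metric_refl, hl.null]
  have h3 : metric n (ρ l) (ρ m) = metric n l m := h.metric_refl _ _
  have h4 : metric n (ρ l) m = metric n l (ρ m) := h.metric_apply _ _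
  have h5 : metric n m l = metric n l m := metric_comm _ _
  have h6 : metric n m (ρ l) = metric n l (ρ m) := by rw [metric_comm, h4]
  have h7 : metric n (ρ l) l = metric n l (ρ l) := metric_comm _ _
  simp only [nullDress_apply, map_add, map_smul, LinearMap.add_apply, LinearMap.smul_apply,
    smul_eq_mul, h.apply_apply, h1, h3, h4, h5, h6, h7, hl.null]
  field_simp
  ring

/-- Bianchi permutability at one parameter. With `x = (α - 1)/(α + 1)` and `y = (1 - β)/(1 + β)`,
the constant `c` equals `(α - β)/(α + β)`, the eigenvalue of `p(β)`. The factor `nullDress ρ m (-1)`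
is the cost of using `c` and `y` on the left, instead of the eigenvalues `-c` and `-y` of the second
transformation of type `p`. The proof expands both sides on `l`, `m`, `ρ l`, `ρ m`. -/
lemma nullDress_permute (h : IsReflectionOf ρ V) {l m : CVec n} (hl : IsNullVector ρ l)
    (hm : IsNullVector ρ m) {c x y : ℂ} (hx : x ≠ 0) (hy : y ≠ 0) (hxy : x + y ≠ 0)
    (hxy' : 1 + x * y ≠ 0) (hc : c = (x + y) / (1 + x * y))
    (hlm : IsNullVector ρ (nullDress ρ l c m)) :
    nullDress ρ (nullDress ρ m c l) x * nullDress ρ m y =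
      nullDress ρ m (-1) * (nullDress ρ (nullDress ρ l c m) (-y) * nullDress ρ l x) := by
  ext1 w
  have h1 := metric_nullDress_refl (m := m) h hl c
  have h2 := metric_nullDress_refl (m := l) h hm c
  have h3 := hlm.ne
  rw [h1] at h3
  have ha := hl.ne
  have hb := hm.ne
  have e1 : metric n (ρ l) (ρ l) = 0 := by rw [h.metric_refl, hl.null]
  have e2 : metric n (ρ m) (ρ m) = 0 := by rw [h.metric_refl, hm.null]
  have e3 : metric n (ρ l) (ρ m) = metric n l m := h.metric_refl _ _
  have e4 : metric n (ρ l) m = metric n l (ρ m) := h.metric_apply _ _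
  have e5 : metric n m l = metric n l m := metric_comm _ _
  have e6 : metric n m (ρ l) = metric n l (ρ m) := by rw [metric_comm, e4]
  have e7 : metric n (ρ l) l = metric n l (ρ l) := metric_comm _ _
  have e8 : metric n (ρ m) m = metric n m (ρ m) := metric_comm _ _
  have e9 : metric n (ρ m) (ρ l) = metric n l m := by rw [h.metric_refl, e5]
  have e10 : metric n (ρ m) l = metric n l (ρ m) := metric_comm _ _
  rw [e5, e6, mul_comm (metric n m (ρ m))] at h2
  simp only [mul_apply_eq_comp]
  rw [nullDress_apply ρ (nullDress ρ m c l), nullDress_apply ρ (nullDress ρ l c m), h1, h2]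
  have hs : ((x + y) / (1 + x * y))⁻¹ = (1 + x * y) / (x + y) := inv_div _ _
  rw [hc, hs] at h3 ⊢
  simp only [nullDress_apply, hs, map_add, map_smul, LinearMap.add_apply, LinearMap.smul_apply,
    smul_eq_mul, h.apply_apply, e1, e2, e3, e4, e5, e6, e7, e8, e9, e10, hl.null, hm.null]
  have h3' := (div_ne_zero_iff.1 h3).1
  generalize metric n l (ρ l) = a at *
  generalize metric n m (ρ m) = b at *
  generalize metric n l m = p at *
  generalize metric n l (ρ m) = k at *
  generalize metric n l w = X
  generalize metric n m w = Y
  generalize metric n (ρ l) w = Z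
  generalize metric n (ρ m) w = T
  clear h1 h2 h3 e1 e2 e3 e4 e5 e6 e7 e8 e9 e10 hs hc
  -- `S` is the common numerator of both denominators. It stays atomic while they are cleared and is
  -- expanded only for the resulting polynomial identity.
  obtain ⟨S, hS⟩ : ∃ S, S = a * b + k ^ 2 * (((x + y) / (1 + x * y)) ^ 2 - 1)
    + p ^ 2 * (((1 + x * y) / (x + y)) ^ 2 - 1) := ⟨_, rfl⟩
  rw [← hS] at h3' ⊢
  match_scalars <;> field_simp <;> rw [hS] <;> field_simp <;> ring

/-- Permutability at `λ = ∞`. Here `x = -1` and `y = 1`, for which `(x + y) / (1 + x y)` is `0/0`;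
so this is not an instance of `nullDress_permute`, and `c` is arbitrary non-zero. -/
lemma nullDress_permute_neg_one (h : IsReflectionOf ρ V) {l m : CVec n} (hl : IsNullVector ρ l)
    (hm : IsNullVector ρ m) {c : ℂ} (hc : c ≠ 0)
    (hlm : IsNullVector ρ (nullDress ρ l c m)) :
    nullDress ρ (nullDress ρ m c l) (-1) =
      nullDress ρ m (-1) * (nullDress ρ (nullDress ρ l c m) (-1) * nullDress ρ l (-1)) := by
  ext1 w
  have h1 := metric_nullDress_refl (m := m) h hl c
  have h2 := metric_nullDress_refl (m := l) h hm c
  have h3 := hlm.ne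
  rw [h1] at h3
  have ha := hl.ne
  have hb := hm.ne
  have e1 : metric n (ρ l) (ρ l) = 0 := by rw [h.metric_refl, hl.null]
  have e2 : metric n (ρ m) (ρ m) = 0 := by rw [h.metric_refl, hm.null]
  have e4 : metric n (ρ l) m = metric n l (ρ m) := h.metric_apply _ _
  have e5 : metric n m l = metric n l m := metric_comm _ _
  have e6 : metric n m (ρ l) = metric n l (ρ m) := by rw [metric_comm, e4]
  have e7 : metric n (ρ l) l = metric n l (ρ l) := metric_comm _ _
  have e8 : metric n (ρ m) m = metric n m (ρ m) := metric_comm _ _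
  have e9 : metric n (ρ m) (ρ l) = metric n l m := by rw [h.metric_refl, e5]
  have e10 : metric n (ρ m) l = metric n l (ρ m) := metric_comm _ _
  rw [e5, e6, mul_comm (metric n m (ρ m))] at h2
  simp only [mul_apply_eq_comp]
  rw [nullDress_apply ρ (nullDress ρ m c l), nullDress_apply ρ (nullDress ρ l c m), h1, h2]
  simp only [nullDress_apply, map_add, map_smul, LinearMap.add_apply, LinearMap.smul_apply,
    smul_eq_mul, h.apply_apply, e1, e2, e4, e5, e6, e7, e8, e9, e10, hl.null, hm.null]
  have h3' := (div_ne_zero_iff.1 h3).1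
  generalize metric n l (ρ l) = a at *
  generalize metric n m (ρ m) = b at *
  generalize metric n l m = p at *
  generalize metric n l (ρ m) = k at *
  generalize metric n l w = X
  generalize metric n m w = Y
  generalize metric n (ρ l) w = Z
  generalize metric n (ρ m) w = T
  clear h1 h2 h3 e1 e2 e4 e5 e6 e7 e8 e9 e10
  obtain ⟨S, hS⟩ : ∃ S, S = a * b + k ^ 2 * (c ^ 2 - 1) + p ^ 2 * (c⁻¹ ^ 2 - 1) := ⟨_, rfl⟩
  rw [← hS] at h3' ⊢
  match_scalars <;> field_simp <;> rw [hS] <;> field_simp <;> ring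

end Permutability

/-! ### Smoothness -/

section Smoothness

variable {M : Type*} [TopologicalSpace M] [ChartedSpace ℂ M] {n : ℕ}
variable {E F G : Type*} [NormedAddCommGroup E] [NormedSpace ℂ E] [NormedAddCommGroup F]
  [NormedSpace ℂ F] [NormedAddCommGroup G] [NormedSpace ℂ G]

lemma contMDiffAt_bilin (B : E →L[ℂ] F →L[ℂ] G) {f : M → E} {g : M → F} {x : M}
    (hf : ContMDiffAt 𝓘(ℝ, ℂ) 𝓘(ℝ, E) ∞ f x) (hg : ContMDiffAt 𝓘(ℝ, ℂ) 𝓘(ℝ, F) ∞ g x) :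
    ContMDiffAt 𝓘(ℝ, ℂ) 𝓘(ℝ, G) ∞ (fun y => B (f y) (g y)) x := by
  have hB : ContDiff ℝ ∞ (fun p : E × F => B p.1 p.2) :=
    (B.isBoundedBilinearMap.contDiff).restrict_scalars ℝ
  exact hB.comp_contMDiffAt (hf.prodMk_space hg)

lemma contMDiffAt_clm (B : E →L[ℂ] F) {f : M → E} {x : M}
    (hf : ContMDiffAt 𝓘(ℝ, ℂ) 𝓘(ℝ, E) ∞ f x) :
    ContMDiffAt 𝓘(ℝ, ℂ) 𝓘(ℝ, F) ∞ (fun y => B (f y)) x :=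
  (B.restrictScalars ℝ).contDiff.comp_contMDiffAt hf

lemma contMDiffAt_const_smul (c : ℂ) {f : M → E} {x : M}
    (hf : ContMDiffAt 𝓘(ℝ, ℂ) 𝓘(ℝ, E) ∞ f x) :
    ContMDiffAt 𝓘(ℝ, ℂ) 𝓘(ℝ, E) ∞ (fun y => c • f y) x :=
  contMDiffAt_clm (c • ContinuousLinearMap.id ℂ E) hf

/-! ### Frames, Gram operators and smoothness of reflections -/

/-- The metric as a continuous bilinear form. -/
def metricL (n : ℕ) : CVec n →L[ℂ] CVec n →L[ℂ] ℂ :=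
  LinearMap.toContinuousLinearMap
    { toFun := fun u => LinearMap.toContinuousLinearMap (metric n u)
      map_add' := fun u v => by ext1 w; simp
      map_smul' := fun c u => by ext1 w; simp }

/-- Linear combinations of a family of vectors. -/
def frameMap (n k : ℕ) : (Fin k → CVec n) →L[ℂ] ((Fin k → ℂ) →L[ℂ] CVec n) :=
  LinearMap.toContinuousLinearMap
    { toFun := fun s => LinearMap.toContinuousLinearMap (Fintype.linearCombination ℂ s)
      map_add' := fun s t => by
        ext1 c; simp [Fintype.linearCombination_apply, Finset.sum_add_distrib]
      map_smul' := fun a s => by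
        ext1 c
        simp [Fintype.linearCombination_apply, Finset.smul_sum, smul_comm a] }

lemma frameMap_apply {k : ℕ} (s : Fin k → CVec n) (c : Fin k → ℂ) :
    frameMap n k s c = ∑ i, c i • s i := by
  show Fintype.linearCombination ℂ s c = _
  rw [Fintype.linearCombination_apply]

/-- Scalar products with a family of vectors. -/
def coframeMap (n k : ℕ) : (Fin k → CVec n) →L[ℂ] (CVec n →L[ℂ] (Fin k → ℂ)) :=
  LinearMap.toContinuousLinearMap
    { toFun := fun s => LinearMap.toContinuousLinearMap (LinearMap.pi fun i => metric n (s i))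
      map_add' := fun s t => by ext; simp
      map_smul' := fun a s => by ext; simp }

lemma coframeMap_apply {k : ℕ} (s : Fin k → CVec n) (v : CVec n) (i : Fin k) :
    coframeMap n k s v i = metric n (s i) v := rfl

lemma mem_span_range_iff {k : ℕ} {s : Fin k → CVec n} {v : CVec n} :
    v ∈ Submodule.span ℂ (Set.range s) ↔ ∃ c, frameMap n k s c = v := by
  rw [Submodule.mem_span_range_iff_exists_fun]
  simp only [frameMap_apply]

lemma mem_perp_span_range_iff {k : ℕ} {s : Fin k → CVec n} {v : CVec n} :
    v ∈ perp (Submodule.span ℂ (Set.range s)) ↔ coframeMap n k s v = 0 := by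
  rw [mem_perp]
  constructor
  · intro h
    funext i
    exact h _ (Submodule.subset_span ⟨i, rfl⟩)
  · intro h u hu
    obtain ⟨c, rfl⟩ := mem_span_range_iff.1 hu
    rw [frameMap_apply, map_sum, LinearMap.sum_apply]
    refine Finset.sum_eq_zero fun i _ => ?_
    have := congrFun h i
    rw [coframeMap_apply] at this
    simp [this]

/-- The Gram operator of a family of vectors. -/
def gram {k : ℕ} (s : Fin k → CVec n) : (Fin k → ℂ) →L[ℂ] (Fin k → ℂ) :=
  (coframeMap n k s).comp (frameMap n k s)

/-- A combination killed by the Gram operator lies in the span and in its orthogonal, hence is fixed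
and negated by `ρ`. -/
lemma isUnit_gram {k : ℕ} {s : Fin k → CVec n} (hs : LinearIndependent ℂ s) {ρ : CEnd n}
    (h : IsReflectionOf ρ (Submodule.span ℂ (Set.range s))) : IsUnit (gram s) := by
  have hinj : Function.Injective (gram s : (Fin k → ℂ) →ₗ[ℂ] (Fin k → ℂ)) := by
    rw [← LinearMap.ker_eq_bot, LinearMap.ker_eq_bot']
    intro c hc
    have h1 : frameMap n k s c ∈ Submodule.span ℂ (Set.range s) := mem_span_range_iff.2 ⟨c, rfl⟩
    have h2 : frameMap n k s c ∈ perp (Submodule.span ℂ (Set.range s)) :=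
      mem_perp_span_range_iff.2 hc
    have h3 := (h.mem_iff _).1 h1
    rw [(h.mem_perp_iff _).1 h2] at h3
    have h4 : frameMap n k s c = 0 := neg_eq_self.1 h3
    rw [frameMap_apply] at h4
    funext i
    exact Fintype.linearIndependent_iff.1 hs c h4 i
  let e := (LinearEquiv.ofInjectiveEndo _ hinj).toContinuousLinearEquiv
  have he : (e : (Fin k → ℂ) →L[ℂ] (Fin k → ℂ)) = gram s := by ext1 c; rfl
  exact ⟨ContinuousLinearEquiv.toUnit e, he⟩

/-- This expression in the frame shows that the projection depends smoothly on it, since inversion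
is smooth on units. -/
lemma orthProj_span {k : ℕ} {s : Fin k → CVec n} (hs : LinearIndependent ℂ s) {ρ : CEnd n}
    (h : IsReflectionOf ρ (Submodule.span ℂ (Set.range s))) :
    orthProj (Submodule.span ℂ (Set.range s)) =
      (frameMap n k s).comp ((Ring.inverse (gram s)).comp (coframeMap n k s)) := by
  have hu := isUnit_gram hs h
  have h1 : ∀ c, gram s (Ring.inverse (gram s) c) = c := fun c => by
    simpa using congrArg (· c) (Ring.mul_inverse_cancel _ hu)
  have h2 : ∀ c, Ring.inverse (gram s) (gram s c) = c := fun c => by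
    simpa using congrArg (· c) (Ring.inverse_mul_cancel _ hu)
  refine projAlong_eq (fun v => ?_) (fun v => ?_) (fun v hv => ?_) (fun v hv => ?_)
  · exact mem_span_range_iff.2 ⟨_, rfl⟩
  · have := h1 (coframeMap n k s v)
    rw [gram, ContinuousLinearMap.comp_apply] at this
    refine mem_perp_span_range_iff.2 ?_
    rw [map_sub, ContinuousLinearMap.comp_apply, ContinuousLinearMap.comp_apply]
    exact sub_eq_zero.2 this.symm
  · obtain ⟨c, rfl⟩ := mem_span_range_iff.1 hv
    exact congrArg (frameMap n k s) (h2 c)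
  · rw [ContinuousLinearMap.comp_apply, ContinuousLinearMap.comp_apply,
      mem_perp_span_range_iff.1 hv, map_zero, map_zero]

lemma contMDiffAt_compL {f : M → F →L[ℂ] G} {g : M → E →L[ℂ] F} {x : M}
    (hf : ContMDiffAt 𝓘(ℝ, ℂ) 𝓘(ℝ, F →L[ℂ] G) ∞ f x)
    (hg : ContMDiffAt 𝓘(ℝ, ℂ) 𝓘(ℝ, E →L[ℂ] F) ∞ g x) :
    ContMDiffAt 𝓘(ℝ, ℂ) 𝓘(ℝ, E →L[ℂ] G) ∞ (fun y => (f y).comp (g y)) x :=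
  contMDiffAt_bilin (ContinuousLinearMap.compL ℂ E F G) hf hg

/-- The reflection across a non-degenerate subbundle is smooth. -/
lemma contMDiff_reflection {V : M → Submodule ℂ (CVec n)} (hV : IsSubbundle V)
    (hnd : IsNondegenerate V) :
    ContMDiff 𝓘(ℝ, ℂ) 𝓘(ℝ, CEnd n) ∞ (fun x => reflection (V x)) := by
  intro x₀
  obtain ⟨U, hU, hx₀, k, s, hs, hsV⟩ := hV x₀
  have hs' : ContMDiffAt 𝓘(ℝ, ℂ) 𝓘(ℝ, Fin k → CVec n) ∞ (fun y i => s i y) x₀ :=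
    contMDiffAt_pi_space.2 fun i => (hs i).contMDiffAt (hU.mem_nhds hx₀)
  have hf := contMDiffAt_clm (frameMap n k) hs'
  have hc := contMDiffAt_clm (coframeMap n k) hs'
  have hg : ContMDiffAt 𝓘(ℝ, ℂ) 𝓘(ℝ, (Fin k → ℂ) →L[ℂ] (Fin k → ℂ)) ∞
      (fun y => gram fun i => s i y) x₀ := contMDiffAt_compL hc hf
  have hρ : ∀ x ∈ U, IsReflectionOf (reflection (V x))
      (Submodule.span ℂ (Set.range fun i => s i x)) := fun x hx => by
    rw [(hsV x hx).2]; exact isReflectionOf_reflection (hnd x)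
  have hi : ContMDiffAt 𝓘(ℝ, ℂ) 𝓘(ℝ, (Fin k → ℂ) →L[ℂ] (Fin k → ℂ)) ∞
      (fun y => Ring.inverse (gram fun i => s i y)) x₀ := by
    obtain ⟨u, hu⟩ := isUnit_gram (hsV x₀ hx₀).1 (hρ x₀ hx₀)
    have := contDiffAt_ringInverse ℝ (n := ∞) u
    rw [hu] at this
    exact ContDiffAt.comp_contMDiffAt (f := fun y => gram fun i => s i y) this hg
  have hπ := contMDiffAt_compL hf (contMDiffAt_compL hi hc)
  have hr : ContMDiffAt 𝓘(ℝ, ℂ) 𝓘(ℝ, CEnd n) ∞ (fun x => (2 : ℂ) •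
      (frameMap n k fun i => s i x).comp ((Ring.inverse (gram fun i => s i x)).comp
        (coframeMap n k fun i => s i x)) - (1 : CEnd n)) x₀ :=
    (contMDiffAt_const_smul 2 hπ).sub contMDiffAt_const
  refine hr.congr_of_eventuallyEq (Filter.eventually_of_mem (hU.mem_nhds hx₀) fun x hx => ?_)
  beta_reduce
  rw [← orthProj_span (hsV x hx).1 (hρ x hx), (hρ x hx).orthProj_eq]
  module

/-! ### Smooth null line bundles and their projections -/

/-- `L` is a smooth null line bundle spanned by vectors not orthogonal to their reflection. -/
def IsGenericNullLine (V L : M → Submodule ℂ (CVec n)) : Prop :=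
  ∀ x₀, ∃ U : Set M, IsOpen U ∧ x₀ ∈ U ∧ ∃ l : M → CVec n,
    ContMDiffOn 𝓘(ℝ, ℂ) 𝓘(ℝ, CVec n) ∞ l U ∧
    ∀ x ∈ U, IsNullVector (reflection (V x)) (l x) ∧ L x = Submodule.span ℂ {l x}

lemma IsNullLineSubbundle.isGenericNullLine {V L : M → Submodule ℂ (CVec n)}
    (hL : IsNullLineSubbundle L) (hnd : IsNondegenerate V)
    (hρ : ∀ x, image (reflection (V x)) (L x) ⊓ perp (L x) = ⊥) : IsGenericNullLine V L := by
  intro x₀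
  obtain ⟨U, hU, hx₀, k, s, hs, hsL⟩ := hL.isSubbundle x₀
  have hk : k = 1 := by
    have := finrank_span_eq_card (hsL x₀ hx₀).1
    rw [(hsL x₀ hx₀).2, hL.finrank_eq_one] at this
    simpa using this.symm
  subst hk
  have hspan : ∀ x ∈ U, L x = Submodule.span ℂ {s 0 x} := fun x hx => by
    rw [← (hsL x hx).2, Set.range_unique]; rfl
  refine ⟨U, hU, hx₀, s 0, hs 0, fun x hx => ⟨?_, hspan x hx⟩⟩
  have hmem : s 0 x ∈ L x := by
    rw [hspan x hx]; exact Submodule.mem_span_singleton_self _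
  refine isNullVector_of_inf (isReflectionOf_reflection (hnd x)) ((hsL x hx).1.ne_zero 0)
    (hL.isNull x _ hmem _ hmem) ?_
  rw [← hspan x hx]; exact hρ x

section LineProj

variable {V L : M → Submodule ℂ (CVec n)}

lemma contMDiffAt_nullProj {ρ : M → CEnd n} {l : M → CVec n} {x : M}
    (hρ : ContMDiffAt 𝓘(ℝ, ℂ) 𝓘(ℝ, CEnd n) ∞ ρ x)
    (hl : ContMDiffAt 𝓘(ℝ, ℂ) 𝓘(ℝ, CVec n) ∞ l x) (h : IsNullVector (ρ x) (l x)) :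
    ContMDiffAt 𝓘(ℝ, ℂ) 𝓘(ℝ, CEnd n) ∞ (fun y => nullProj (ρ y) (l y)) x ∧
    ContMDiffAt 𝓘(ℝ, ℂ) 𝓘(ℝ, CEnd n) ∞ (fun y => nullProj' (ρ y) (l y)) x := by
  have h1 : ContMDiffAt 𝓘(ℝ, ℂ) 𝓘(ℝ, CVec n) ∞ (fun y => ρ y (l y)) x :=
    contMDiffAt_bilin (ContinuousLinearMap.id ℂ (CEnd n)) hρ hl
  have h2 : ContMDiffAt 𝓘(ℝ, ℂ) 𝓘(ℝ, ℂ) ∞ (fun y => (metricL n (l y) (ρ y (l y)))⁻¹) x :=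
    ContDiffAt.comp_contMDiffAt (f := fun y => metricL n (l y) (ρ y (l y)))
      (contDiffAt_inv ℝ h.ne) (contMDiffAt_bilin (metricL n) hl h1)
  exact ⟨contMDiffAt_bilin (ContinuousLinearMap.lsmul ℂ ℂ) h2
      (contMDiffAt_bilin (rankOneL n) h1 hl),
    contMDiffAt_bilin (ContinuousLinearMap.lsmul ℂ ℂ) h2
      (contMDiffAt_bilin (rankOneL n) hl h1)⟩

lemma IsGenericNullLine.contMDiff_lineProj (hV : IsSubbundle V)
    (hnd : IsNondegenerate V) (hL : IsGenericNullLine V L) :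
    ContMDiff 𝓘(ℝ, ℂ) 𝓘(ℝ, CEnd n) ∞ (fun x => lineProj (V x) (L x)) := by
  intro x₀
  obtain ⟨U, hU, hx₀, l, hl, hlL⟩ := hL x₀
  refine ((contMDiffAt_nullProj (contMDiff_reflection hV hnd x₀)
    (hl.contMDiffAt (hU.mem_nhds hx₀)) (hlL x₀ hx₀).1).1).congr_of_eventuallyEq
    (Filter.eventually_of_mem (hU.mem_nhds hx₀) fun x hx => ?_)
  show lineProj (V x) (L x) = _
  rw [(hlL x hx).2, lineProj_span (isReflectionOf_reflection (hnd x)) (hlL x hx).1]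

lemma IsGenericNullLine.contMDiff_lineProj' (hV : IsSubbundle V)
    (hnd : IsNondegenerate V) (hL : IsGenericNullLine V L) :
    ContMDiff 𝓘(ℝ, ℂ) 𝓘(ℝ, CEnd n) ∞ (fun x => lineProj' (V x) (L x)) := by
  intro x₀
  obtain ⟨U, hU, hx₀, l, hl, hlL⟩ := hL x₀
  refine ((contMDiffAt_nullProj (contMDiff_reflection hV hnd x₀)
    (hl.contMDiffAt (hU.mem_nhds hx₀)) (hlL x₀ hx₀).1).2).congr_of_eventuallyEq
    (Filter.eventually_of_mem (hU.mem_nhds hx₀) fun x hx => ?_)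
  show lineProj' (V x) (L x) = _
  rw [(hlL x hx).2, lineProj'_span (isReflectionOf_reflection (hnd x)) (hlL x hx).1]

end LineProj

end Smoothness

/-! ### Forms in charts -/

section Charts

lemma isManifold_real (M : Type*) [TopologicalSpace M] [ChartedSpace ℂ M] [IsManifold 𝓘(ℂ) ω M] :
    IsManifold 𝓘(ℝ, ℂ) ∞ M := by
  refine isManifold_of_contDiffOn _ _ _ fun e e' he he' => ?_
  have h := (contDiffGroupoid ω 𝓘(ℂ)).compatible he he'
  rw [contDiffGroupoid, mem_groupoid_of_pregroupoid] at h
  have h1 : ContDiffOn ℂ ω (𝓘(ℂ) ∘ e.symm ≫ₕ e' ∘ 𝓘(ℂ).symm)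
    (𝓘(ℂ).symm ⁻¹' (e.symm ≫ₕ e').source ∩ Set.range 𝓘(ℂ)) := h.1
  exact (h1.restrict_scalars ℝ).of_le le_top

variable {M : Type*} [TopologicalSpace M] [ChartedSpace ℂ M]
variable {E : Type*} [NormedAddCommGroup E] [NormedSpace ℂ E]

lemma inChart_apply (η : OneForm M E) (x₀ : M) (z X : ℂ) :
    inChart η x₀ z X = η ((chartAt ℂ x₀).symm z)
      (mfderiv 𝓘(ℝ, ℂ) 𝓘(ℝ, ℂ) (chartAt ℂ x₀).symm z X) := rfl

variable {n : ℕ}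

lemma formN_apply (V : M → Submodule ℂ (CVec n)) (x : M) (X : TangentSpace 𝓘(ℝ, ℂ) x) :
    formN V x X = -(orthProj (V x) * diff (fun y => orthProj (V y)) x X
      + orthProj (perp (V x)) * diff (fun y => orthProj (perp (V y))) x X) := rfl

lemma isFlat_iff (A : OneForm M (CEnd n)) : IsFlat A ↔ ∀ x₀ : M, ∀ z ∈ (chartAt ℂ x₀).target,
    ∀ X Y, curv (inChart A x₀) z X Y = 0 := Iff.rfl

lemma curv_congr_on {𝔸 : Type*} [NormedRing 𝔸] [NormedAlgebra ℂ 𝔸] {Ω : Set ℂ} (hΩ : IsOpen Ω)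
    {A B : ℂ → ℂ →L[ℝ] 𝔸} (h : ∀ z ∈ Ω, A z = B z) {z : ℂ} (hz : z ∈ Ω) (X Y : ℂ) :
    curv A z X Y = curv B z X Y := by
  simp only [curv, fderiv_congr_on hΩ h hz, h z hz]

variable [IsManifold 𝓘(ℂ) ω M]

lemma contDiffOn_comp_chart {f : M → E} (hf : ContMDiff 𝓘(ℝ, ℂ) 𝓘(ℝ, E) ∞ f) (x₀ : M) :
    ContDiffOn ℝ ∞ (fun z => f ((chartAt ℂ x₀).symm z)) (chartAt ℂ x₀).target := by
  have := isManifold_real M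
  exact (hf.comp_contMDiffOn (contMDiffOn_chart_symm (n := ∞) (x := x₀))).contDiffOn

lemma mdifferentiableAt_chart_symm (x₀ : M) {z : ℂ} (hz : z ∈ (chartAt ℂ x₀).target) :
    MDifferentiableAt 𝓘(ℝ, ℂ) 𝓘(ℝ, ℂ) (chartAt ℂ x₀).symm z := by
  have := isManifold_real M
  exact ((contMDiffOn_chart_symm (n := ∞) (x := x₀)).contMDiffAt
    ((chartAt ℂ x₀).open_target.mem_nhds hz)).mdifferentiableAt (by simp)

lemma inChart_diff {f : M → E} (hf : ContMDiff 𝓘(ℝ, ℂ) 𝓘(ℝ, E) ∞ f) (x₀ : M) {z : ℂ}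
    (hz : z ∈ (chartAt ℂ x₀).target) :
    inChart (diff f) x₀ z = fderiv ℝ (fun z => f ((chartAt ℂ x₀).symm z)) z := by
  have h1 := mfderiv_comp z (((hf _).mdifferentiableAt (by simp)) :
    MDifferentiableAt 𝓘(ℝ, ℂ) 𝓘(ℝ, E) f ((chartAt ℂ x₀).symm z))
    (mdifferentiableAt_chart_symm x₀ hz)
  rw [mfderiv_eq_fderiv] at h1
  exact h1.symm

/-- The tangent space at the image point is read in the chart preferred there, so the differential
is that of a change of charts. This is holomorphic, hence its real differential commutes with `i`,
and types can be computed in any preferred chart. -/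
lemma mfderiv_chart_symm_I (x₀ : M) {z : ℂ} (hz : z ∈ (chartAt ℂ x₀).target) (X : ℂ) :
    mfderiv 𝓘(ℝ, ℂ) 𝓘(ℝ, ℂ) (chartAt ℂ x₀).symm z (Complex.I * X : ℂ) =
      complexStructure _ (mfderiv 𝓘(ℝ, ℂ) 𝓘(ℝ, ℂ) (chartAt ℂ x₀).symm z X) := by
  have h1 := mdifferentiableAt_chart_symm x₀ hz
  have h2 : MDifferentiableAt 𝓘(ℂ) 𝓘(ℂ) (chartAt ℂ x₀).symm z :=
    ((contMDiffOn_chart_symm (I := 𝓘(ℂ)) (n := ω) (x := x₀)).contMDiffAt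
    ((chartAt ℂ x₀).open_target.mem_nhds hz)).mdifferentiableAt (by simp)
  have h3 := h2.differentiableWithinAt_writtenInExtChartAt
  have h4 : DifferentiableAt ℂ (chartAt ℂ ((chartAt ℂ x₀).symm z) ∘ (chartAt ℂ x₀).symm) z := by
    have : Set.range 𝓘(ℂ) = Set.univ := by simp
    rw [this, differentiableWithinAt_univ] at h3
    exact h3
  have h5 : mfderiv 𝓘(ℝ, ℂ) 𝓘(ℝ, ℂ) (chartAt ℂ x₀).symm z =
      fderiv ℝ (chartAt ℂ ((chartAt ℂ x₀).symm z) ∘ (chartAt ℂ x₀).symm) z := by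
    rw [h1.mfderiv]
    have : Set.range 𝓘(ℝ, ℂ) = Set.univ := by simp
    rw [this, fderivWithin_univ]
    rfl
  have h6 := h4.fderiv_restrictScalars ℝ
  rw [h5, h6]
  show fderiv ℂ _ z (Complex.I * X) = Complex.I * fderiv ℂ _ z X
  rw [← smul_eq_mul, map_smul, smul_eq_mul]

lemma inChart_part10 (η : OneForm M E) (x₀ : M) {z : ℂ} (hz : z ∈ (chartAt ℂ x₀).target) :
    inChart (part10 η) x₀ z = typeL (inChart η x₀ z) := by
  ext1 X
  rw [typeL_apply, inChart_apply, inChart_apply, inChart_apply, mfderiv_chart_symm_I x₀ hz]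
  rfl

lemma inChart_part01 (η : OneForm M E) (x₀ : M) {z : ℂ} (hz : z ∈ (chartAt ℂ x₀).target) :
    inChart (part01 η) x₀ z = typeR (inChart η x₀ z) := by
  ext1 X
  rw [typeR_apply, inChart_apply, inChart_apply, inChart_apply, mfderiv_chart_symm_I x₀ hz]
  rfl

lemma inChart_connForm (V : M → Submodule ℂ (CVec n)) (q : OneForm M (CEnd n)) (t : ℂ) (x₀ : M)
    {z : ℂ} (hz : z ∈ (chartAt ℂ x₀).target) :
    inChart (connForm V q t) x₀ z =
      (LaurentForm.ofForms (inChart (formN V) x₀) (inChart q x₀)).form t z := by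
  rw [LaurentForm.form_ofForms, ← inChart_part10 _ _ hz, ← inChart_part10 _ _ hz,
    ← inChart_part01 _ _ hz, ← inChart_part01 _ _ hz]
  rfl

lemma inChart_formN {V : M → Submodule ℂ (CVec n)} {ρ : M → CEnd n}
    (hρ : ContMDiff 𝓘(ℝ, ℂ) 𝓘(ℝ, CEnd n) ∞ ρ) (h : ∀ x, IsReflectionOf (ρ x) (V x)) (x₀ : M)
    {z : ℂ} (hz : z ∈ (chartAt ℂ x₀).target) (X : ℂ) :
    inChart (formN V) x₀ z X = -((1 / 2 : ℂ) • (ρ ((chartAt ℂ x₀).symm z)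
      * fderiv ℝ (fun z => ρ ((chartAt ℂ x₀).symm z)) z X)) := by
  have e1 : (fun y => orthProj (V y)) = fun y => (1 / 2 : ℂ) • (1 + ρ y) :=
    funext fun y => (h y).orthProj_eq
  have e2 : (fun y => orthProj (perp (V y))) = fun y => (1 / 2 : ℂ) • (1 - ρ y) :=
    funext fun y => (h y).orthProj_perp_eq
  have s1 : ContMDiff 𝓘(ℝ, ℂ) 𝓘(ℝ, CEnd n) ∞ (fun y => (1 / 2 : ℂ) • (1 + ρ y)) := fun x =>
    contMDiffAt_const_smul _ (contMDiffAt_const.add (hρ x))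
  have s2 : ContMDiff 𝓘(ℝ, ℂ) 𝓘(ℝ, CEnd n) ∞ (fun y => (1 / 2 : ℂ) • (1 - ρ y)) := fun x =>
    contMDiffAt_const_smul _ (contMDiffAt_const.sub (hρ x))
  have d := (differentiableAt_of_contDiffOn (chartAt ℂ x₀).open_target
    (contDiffOn_comp_chart hρ x₀) hz).hasFDerivAt
  have f1 : inChart (diff fun y => (1 / 2 : ℂ) • (1 + ρ y)) x₀ z X =
      (1 / 2 : ℂ) • fderiv ℝ (fun z => ρ ((chartAt ℂ x₀).symm z)) z X := by
    have h' : fderiv ℝ (fun z => (1 / 2 : ℂ) • (1 + ρ ((chartAt ℂ x₀).symm z))) z = _ :=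
      ((d.const_add 1).const_smul (1 / 2 : ℂ)).fderiv
    rw [inChart_diff s1 x₀ hz, h']; rfl
  have f2 : inChart (diff fun y => (1 / 2 : ℂ) • (1 - ρ y)) x₀ z X =
      -((1 / 2 : ℂ) • fderiv ℝ (fun z => ρ ((chartAt ℂ x₀).symm z)) z X) := by
    have h' : fderiv ℝ (fun z => (1 / 2 : ℂ) • (1 - ρ ((chartAt ℂ x₀).symm z))) z = _ :=
      ((d.const_sub 1).const_smul (1 / 2 : ℂ)).fderiv
    rw [inChart_diff s2 x₀ hz, h', smul_neg]; rfl
  rw [inChart_apply, formN_apply, (h _).orthProj_eq, (h _).orthProj_perp_eq, e1, e2,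
    ← inChart_apply, ← inChart_apply, f1, f2]
  ext1 v
  simp only [neg_apply, add_apply, mul_apply_eq_comp, smul_apply, sub_apply, one_apply_eq_self,
    map_smul, map_neg]
  module

end Charts

/-! ### The double dressing -/

section DoubleDressing

variable {𝔸 : Type*} [NormedRing 𝔸] [NormedAlgebra ℂ 𝔸] {Ω : Set ℂ} {τ : 𝔸 →L[ℂ] 𝔸}
  {ρ e f e' f' : ℂ → 𝔸} {A : LaurentForm 𝔸} {α β : ℂ}

/-- Flatness of the connections obtained from a Laurent family, trivial at `1`, by dressing twice
and gauging the result to be trivial at `1`. -/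
theorem curv_dress_dress (hΩ : IsOpen Ω) (hA : IsLax Ω τ Complex.I ρ A)
    (hτ : ∀ a b, τ (a * b) = τ b * τ a) (hτ1 : τ 1 = 1)
    (hA1 : ∀ z ∈ Ω, A.form 1 z = 0) (hα : α ≠ 0) (hβ : β ≠ 0)
    (hα1 : α ≠ 1) (hα1' : α ≠ -1) (hβ1 : β ≠ 1) (hβ1' : β ≠ -1)
    (h : IsParallelPair Ω τ ρ e f (A.form α))
    (h' : IsParallelPair Ω τ ρ e' f' ((A.dress α e f).form β)) {g k : ℂ → 𝔸}
    (hg : g = fun z =>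
      dress ((1 - β) / (1 + β)) (e' z) (f' z) * dress ((α - 1) / (α + 1)) (e z) (f z))
    (hk : k = fun z =>
      dress ((α - 1) / (α + 1))⁻¹ (e z) (f z) * dress ((1 - β) / (1 + β))⁻¹ (e' z) (f' z))
    {N Q : ℂ → ℂ →L[ℝ] 𝔸}
    (hN : ∀ z ∈ Ω, ∀ X, N z X = -((1 / 2 : ℂ) • (k z * ρ z * g z *
      fderiv ℝ (fun y => k y * ρ y * g y) z X)))
    (hQ : ∀ z ∈ Ω, ∀ X, Q z X = k z * (dress (-1) (e' z) (f' z) * A.m2 z X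
      * dress (-1) (e' z) (f' z) + dress (-1) (e z) (f z) * A.p2 z X * dress (-1) (e z) (f z)) * g z)
    {t : ℂ} (ht : t ≠ 0) {z : ℂ} (hz : z ∈ Ω) (X Y : ℂ) :
    curv ((LaurentForm.ofForms N Q).form t) z X Y = 0 := by
  have hB := hA.dress hΩ hτ hτ1 hα h
  have hBi := hB.inv
  -- Dressing by `q` with parameter `β` is dressing by `p` with parameter `β⁻¹` in the inverted
  -- family.
  have h'' : IsParallelPair Ω τ ρ e' f' ((A.dress α e f).inv.form β⁻¹) := by
    rwa [LaurentForm.form_inv, inv_inv]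
  have hC := (hBi.dress hΩ hτ hτ1 (inv_ne_zero hβ) h'').inv
  rw [neg_neg] at hC
  have hc : (α - 1) / (α + 1) ≠ 0 := dressFactor_ne_zero hα1.symm
    (fun h => hα1' (by rw [h, neg_neg]))
  have hc' : (1 - β) / (1 + β) ≠ 0 := dressFactor_ne_zero hβ1 hβ1'
  have hcc : (β⁻¹ - 1) / (β⁻¹ + 1) = (1 - β) / (1 + β) := by
    have : 1 + β ≠ 0 := fun h => hβ1' (eq_neg_of_add_eq_zero_right h)
    have : β⁻¹ + 1 ≠ 0 := by
      rw [show β⁻¹ + 1 = (1 + β) / β by field_simp]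
      exact div_ne_zero this hβ
    field_simp
  have s1 := contDiffOn_dress ((α - 1) / (α + 1)) h.smooth_left h.smooth_right
  have s2 := contDiffOn_dress ((1 - β) / (1 + β)) h'.smooth_left h'.smooth_right
  have s1' := contDiffOn_dress ((α - 1) / (α + 1))⁻¹ h.smooth_left h.smooth_right
  have s2' := contDiffOn_dress ((1 - β) / (1 + β))⁻¹ h'.smooth_left h'.smooth_right
  have m1 := fun z hz => dress_mul_dress_inv (h.pair z hz) hc
  have m1' := fun z hz => dress_inv_mul_dress (h.pair z hz) hc
  have m2 := fun z hz => dress_mul_dress_inv (h'.pair z hz) hc'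
  have m2' := fun z hz => dress_inv_mul_dress (h'.pair z hz) hc'
  refine hC.curv_ofForms hΩ (g := g) (h := k) (by rw [hg]; exact s2.mul s1)
    (by rw [hk]; exact s1'.mul s2') (fun z hz => ?_) (fun z hz => ?_) (fun z hz X => ?_) hN
    (fun z hz X => ?_) ht hz X Y
  · rw [hg, hk]
    calc _ = dress ((1 - β) / (1 + β)) (e' z) (f' z) * (dress ((α - 1) / (α + 1)) (e z) (f z)
          * dress ((α - 1) / (α + 1))⁻¹ (e z) (f z)) * dress ((1 - β) / (1 + β))⁻¹ (e' z) (f' z) := by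
          noncomm_ring
      _ = 1 := by rw [m1 z hz, mul_one, m2 z hz]
  · rw [hg, hk]
    calc _ = dress ((α - 1) / (α + 1))⁻¹ (e z) (f z) * (dress ((1 - β) / (1 + β))⁻¹ (e' z) (f' z)
          * dress ((1 - β) / (1 + β)) (e' z) (f' z)) * dress ((α - 1) / (α + 1)) (e z) (f z) := by
          noncomm_ring
      _ = 1 := by rw [m2' z hz, mul_one, m1' z hz]
  -- As `A(1) = 0`, two successive gauges leave the pure gauge form of the product `g` at the
  -- parameter 1.
  · have b1 := h.dress_form hΩ hA hτ hτ1 hα one_ne_zero hα1.symm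
      (fun h => hα1' (by rw [h, neg_neg])) hz X
    have hβi : (1 : ℂ) ≠ β⁻¹ := fun h => hβ1 (by rw [← inv_inv β, ← h, inv_one])
    have hβi' : (1 : ℂ) ≠ -β⁻¹ := fun h => hβ1' (by
      rw [← inv_inv β, eq_neg_iff_add_eq_zero.1 h |> eq_neg_of_add_eq_zero_right, inv_neg, inv_one])
    have b2 := h''.dress_form hΩ hBi hτ hτ1 (inv_ne_zero hβ) one_ne_zero hβi hβi' hz X
    rw [hcc, LaurentForm.form_inv, inv_one, b1, hA1 z hz] at b2
    rw [LaurentForm.form_inv, inv_one, b2, hg, hk,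
      fderiv_mul_apply (differentiableAt_of_contDiffOn hΩ s2 hz)
        (differentiableAt_of_contDiffOn hΩ s1 hz)]
    have m1z : ∀ x, dress ((α - 1) / (α + 1)) (e z) (f z)
        * (dress ((α - 1) / (α + 1))⁻¹ (e z) (f z) * x) = x := fun x => by
      rw [← mul_assoc, m1 z hz, one_mul]
    simp only [zero_apply, mul_zero, zero_mul, zero_sub, mul_assoc, add_mul, neg_mul, mul_neg, m1z]
    abel
  · rw [hQ z hz]
    -- The first dressing leaves the coefficient of degree -2 alone and the second, made after
    -- inversion, leaves that of degree 2 alone. So each extreme coefficient is conjugated once.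
    have p1 := h''.dress_p2 (α := β⁻¹) hBi hz X
    have p2 := h.dress_p2 (α := α) hA hz X
    show _ = k z * (((A.dress α e f).inv.dress β⁻¹ e' f').p2 z X + (A.dress α e f).p2 z X) * g z
    rw [p1, p2]
    rfl

end DoubleDressing

/-! ### Reality -/

section Reality

variable {n : ℕ}

lemma conjEnd_typeL {η : ℂ →L[ℝ] CEnd n} (h : ∀ X, conjEnd n (η X) = η X) (X : ℂ) :
    conjEnd n (typeL η X) = typeR η X := by
  rw [typeL_apply, typeR_apply, conjEnd_smul, map_sub, conjEnd_smul, h, h]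
  simp
  module

lemma conjEnd_typeR {η : ℂ →L[ℝ] CEnd n} (h : ∀ X, conjEnd n (η X) = η X) (X : ℂ) :
    conjEnd n (typeR η X) = typeL η X := by
  rw [← conjEnd_typeL h, conjEnd_conjEnd]

/-- Conjugation exchanges the parts of types (1,0) and (0,1) of a real form, and therefore positive
and negative powers of `t`. -/
lemma conjEnd_form {N Q : ℂ → ℂ →L[ℝ] CEnd n} {z : ℂ}
    (hN : ∀ X, conjEnd n (N z X) = N z X) (hQ : ∀ X, conjEnd n (Q z X) = Q z X) (t X : ℂ) :
    conjEnd n ((LaurentForm.ofForms N Q).form t z X) =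
      (LaurentForm.ofForms N Q).form (star t)⁻¹ z X := by
  rw [LaurentForm.form_ofForms, LaurentForm.form_ofForms]
  simp only [add_apply, neg_apply, smul_apply, map_add, map_neg, conjEnd_smul, conjEnd_typeL hN,
    conjEnd_typeR hN, conjEnd_typeL hQ, conjEnd_typeR hQ, hN, inv_inv, star_sub, star_pow, star_inv₀,
    star_one]
  abel

lemma fderiv_conjEnd {Ω : Set ℂ} (hΩ : IsOpen Ω) {F G : ℂ → CEnd n} (hF : ContDiffOn ℝ ∞ F Ω)
    (h : ∀ z ∈ Ω, conjEnd n (F z) = G z) {z : ℂ} (hz : z ∈ Ω) (X : ℂ) :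
    conjEnd n (fderiv ℝ F z X) = fderiv ℝ G z X := by
  have h1 : fderiv ℝ (fun y => conjEnd n (F y)) z = _ := ((conjEnd n).hasFDerivAt.comp z
    (differentiableAt_of_contDiffOn hΩ hF hz).hasFDerivAt).fderiv
  rw [← fderiv_congr_on hΩ h hz, h1]; rfl

/-- The conjugate of a line parallel for the parameter `α` is parallel for `(star α)⁻¹`. -/
lemma parallel_conj {Ω : Set ℂ} (hΩ : IsOpen Ω) {N Q : ℂ → ℂ →L[ℝ] CEnd n}
    (hN : ∀ z ∈ Ω, ∀ X, conjEnd n (N z X) = N z X) (hQ : ∀ z ∈ Ω, ∀ X, conjEnd n (Q z X) = Q z X)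
    {α : ℂ} {e e' : ℂ → CEnd n} (he : ContDiffOn ℝ ∞ e Ω) (hee' : ∀ z ∈ Ω, conjEnd n (e z) = e' z)
    (hpar : ∀ z ∈ Ω, ∀ X,
      (1 - e z) * (fderiv ℝ e z X + (LaurentForm.ofForms N Q).form α z X * e z) = 0)
    {z : ℂ} (hz : z ∈ Ω) (X : ℂ) :
    (1 - e' z) * (fderiv ℝ e' z X + (LaurentForm.ofForms N Q).form (star α)⁻¹ z X * e' z) = 0 := by
  have := congrArg (conjEnd n) (hpar z hz X)
  rw [conjEnd_mul, map_sub, map_add, conjEnd_mul, conjEnd_one, hee' z hz,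
    fderiv_conjEnd hΩ he hee' hz, conjEnd_form (hN z hz) (hQ z hz), map_zero] at this
  exact this

variable {ρ : CEnd n} {V : Submodule ℂ (CVec n)}

lemma commute_nullDress_neg_one (h : IsReflectionOf ρ V) (l : CVec n) :
    ρ * nullDress ρ l (-1) = nullDress ρ l (-1) * ρ := by
  rw [refl_mul_nullDress h, inv_neg, inv_one]

lemma nullDress_neg_one_sq (h : IsReflectionOf ρ V) {l : CVec n} (hl : IsNullVector ρ l) :
    nullDress ρ l (-1) * nullDress ρ l (-1) = 1 := by
  rw [nullDress_mul h hl (by simp) (by simp)]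
  norm_num [nullDress_one]

lemma star_nullDress (hρ : conjEnd n ρ = ρ) (l : CVec n) (c : ℂ) (v : CVec n) :
    star (nullDress ρ l c v) = nullDress ρ (star l) (star c) (star v) := by
  rw [← conjEnd_nullDress hρ]; simp

/-- Conjugation changes the double dressing `r` by a constant factor: `conj r(λ) = K r(1 / conj λ)`,
here for `λ = 1, 0, ∞`. -/
lemma exists_conj_factor (h : IsReflectionOf ρ V) (hρ : conjEnd n ρ = ρ) {l : CVec n}
    (hl : IsNullVector ρ l) {α β : ℂ} (hα₀ : α ≠ 0) (hβ : β = (star α)⁻¹)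
    (hα1 : α ≠ 1) (hα1' : α ≠ -1) (hβ1 : β ≠ 1) (hβ1' : β ≠ -1) (hαβ : α ≠ β) (hαβ' : α ≠ -β)
    (hl' : IsNullVector ρ (nullDress ρ l ((α - β) / (α + β)) (star l))) :
    ∃ K K' : CEnd n, K * K' = 1 ∧ K' * K = 1 ∧ ρ * K = K * ρ ∧
      conjEnd n (nullDress ρ (nullDress ρ l ((α - β) / (α + β)) (star l)) ((1 - β) / (1 + β))
        * nullDress ρ l ((α - 1) / (α + 1))) =
        K * (nullDress ρ (nullDress ρ l ((α - β) / (α + β)) (star l)) ((1 - β) / (1 + β))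
        * nullDress ρ l ((α - 1) / (α + 1))) ∧
      conjEnd n (nullDress ρ l (-1)) =
        K * nullDress ρ (nullDress ρ l ((α - β) / (α + β)) (star l)) (-1) ∧
      conjEnd n (nullDress ρ (nullDress ρ l ((α - β) / (α + β)) (star l)) (-1)) =
        K * nullDress ρ l (-1) := by
  have hsα : star α ≠ 0 := star_ne_zero.2 hα₀
  have hβ₀ : β ≠ 0 := by rw [hβ]; exact inv_ne_zero hsα
  have hsα' : star α = β⁻¹ := by rw [hβ, inv_inv]
  have hsβ : star β = α⁻¹ := by rw [hβ, star_inv₀, star_star]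
  have n1 : α - β ≠ 0 := sub_ne_zero.2 hαβ
  have n2 : α + β ≠ 0 := fun h => hαβ' (eq_neg_of_add_eq_zero_left h)
  have n3 : α - 1 ≠ 0 := sub_ne_zero.2 hα1
  have n4 : α + 1 ≠ 0 := fun h => hα1' (eq_neg_of_add_eq_zero_left h)
  have n5 : 1 - β ≠ 0 := sub_ne_zero.2 hβ1.symm
  have n6 : 1 + β ≠ 0 := fun h => hβ1' (eq_neg_of_add_eq_zero_right h)
  set c := (α - β) / (α + β) with hc
  set x := (α - 1) / (α + 1) with hx
  set y := (1 - β) / (1 + β) with hy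
  have hc0 : c ≠ 0 := div_ne_zero n1 n2
  have hx0 : x ≠ 0 := div_ne_zero n3 n4
  have hy0 : y ≠ 0 := div_ne_zero n5 n6
  -- Since `star α = β⁻¹` and `star β = α⁻¹`, conjugation fixes `c` and exchanges `x` and `y`. So
  -- the conjugate of `r(1)` is the left-hand side of the permutability identity with `m = star l`.
  have hsc : star c = c := by
    have : β⁻¹ + α⁻¹ ≠ 0 := by
      rw [show β⁻¹ + α⁻¹ = (α + β) / (α * β) by field_simp]
      exact div_ne_zero n2 (mul_ne_zero hα₀ hβ₀)
    rw [hc, star_div₀, star_sub, star_add, hsα', hsβ]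
    field_simp
  have hsx : star x = y := by
    have : β⁻¹ + 1 ≠ 0 := by
      rw [show β⁻¹ + 1 = (1 + β) / β by field_simp]
      exact div_ne_zero n6 hβ₀
    rw [hx, hy, star_div₀, star_sub, star_add, hsα', star_one]
    field_simp
  have hsy : star y = x := by rw [← hsx, star_star]
  have hxy : x + y = 2 * (α - β) / ((α + 1) * (1 + β)) := by
    rw [hx, hy]; field_simp; ring
  have hxy' : 1 + x * y = 2 * (α + β) / ((α + 1) * (1 + β)) := by
    rw [hx, hy]; field_simp; ring
  have hxy0 : x + y ≠ 0 := by
    rw [hxy]; exact div_ne_zero (mul_ne_zero two_ne_zero n1) (mul_ne_zero n4 n6)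
  have hxy0' : 1 + x * y ≠ 0 := by
    rw [hxy']; exact div_ne_zero (mul_ne_zero two_ne_zero n2) (mul_ne_zero n4 n6)
  have hcxy : c = (x + y) / (1 + x * y) := by
    rw [hxy, hxy', hc]; field_simp
  have hm := hl.star hρ
  have p1 := nullDress_permute h hl hm hx0 hy0 hxy0 hxy0' hcxy hl'
  have p2 := nullDress_permute_neg_one h hl hm hc0 hl'
  have sl : star (nullDress ρ l c (star l)) = nullDress ρ (star l) c l := by
    rw [star_nullDress hρ, hsc, star_star]
  have q1 := nullDress_neg_one_sq h hl'
  have q2 := nullDress_neg_one_sq h hm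
  have r1 := commute_nullDress_neg_one h (nullDress ρ l c (star l))
  have r2 := commute_nullDress_neg_one h (star l)
  have q1' : ∀ a, nullDress ρ (nullDress ρ l c (star l)) (-1) *
      (nullDress ρ (nullDress ρ l c (star l)) (-1) * a) = a := fun a => by
    rw [← mul_assoc, q1, one_mul]
  have q2' : ∀ a, nullDress ρ (star l) (-1) * (nullDress ρ (star l) (-1) * a) = a := fun a => by
    rw [← mul_assoc, q2, one_mul]
  -- The second factor of `K` absorbs the sign in `nullDress ρ (nullDress ρ l c (star l)) (-y)`.
  -- Both factors are involutions commuting with `ρ`, so the reversed product is the inverse of `K`.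
  refine ⟨nullDress ρ (star l) (-1) * nullDress ρ (nullDress ρ l c (star l)) (-1),
    nullDress ρ (nullDress ρ l c (star l)) (-1) * nullDress ρ (star l) (-1), ?_, ?_, ?_, ?_, ?_, ?_⟩
  · rw [mul_assoc, q1', q2]
  · rw [mul_assoc, q2', q1]
  · rw [← mul_assoc, r2, mul_assoc, r1, mul_assoc]
  · rw [conjEnd_mul, conjEnd_nullDress hρ, conjEnd_nullDress hρ, hsx, hsy, sl, p1,
      show -y = -1 * y by ring, ← nullDress_mul h hl' (by simp) hy0]
    simp only [mul_assoc]
  · rw [conjEnd_nullDress hρ, star_neg, star_one, mul_assoc, q1, mul_one]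
  · rw [conjEnd_nullDress hρ, star_neg, star_one, sl, p2, mul_assoc]

end Reality

/-! ### Pointwise description of the Bäcklund transform -/

section Pointwise

variable {n : ℕ} {ρ : CEnd n} {V : Submodule ℂ (CVec n)}

lemma nullProj_self {l : CVec n} (hl : IsNullVector ρ l) : nullProj ρ l l = l := by
  rw [nullProj_apply, metric_comm (ρ l), inv_mul_cancel₀ hl.ne, one_smul]

/-- An explicit two-sided inverse rules out the junk value of `Ring.inverse`. -/
lemma ringInverse_eq {R : Type*} [Ring R] {a b : R} (h1 : a * b = 1) (h2 : b * a = 1) :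
    Ring.inverse a = b :=
  Ring.inverse_unit ⟨a, b, h1, h2⟩

lemma hatLine_span (h : IsReflectionOf ρ V) {l : CVec n} (hl : IsNullVector ρ l) (α β : ℂ) :
    hatLine V α β (Submodule.span ℂ {l}) (conjSpace (Submodule.span ℂ {l})) =
      Submodule.span ℂ {nullDress ρ l ((α - β) / (α + β)) (star l)} := by
  rw [hatLine, pTransf, threeEigen_span h hl, conjSpace_span_singleton, image_span_singleton]
  rfl

lemma rStar_span (h : IsReflectionOf ρ V) {l : CVec n} (hl : IsNullVector ρ l) {α β : ℂ}
    (hl' : IsNullVector ρ (nullDress ρ l ((α - β) / (α + β)) (star l))) (t : OnePoint ℂ) :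
    rStar V α β (Submodule.span ℂ {l}) (conjSpace (Submodule.span ℂ {l})) t =
      nullDress ρ (nullDress ρ l ((α - β) / (α + β)) (star l))
        (OnePoint.elim t 1 fun t => (t - β) / (t + β))
      * nullDress ρ l (OnePoint.elim t (-1) fun t => (α - t) / (α + t)) := by
  rw [rStar, hatLine_span h hl, qTransf, pTransf, threeEigen_span h hl, threeEigen_span h hl']

/-- The double dressing transformation `r(1)`. -/
def gaugeAt (ρ : CEnd n) (α β : ℂ) (l l' : CVec n) : CEnd n :=
  nullDress ρ l' ((1 - β) / (1 + β)) * nullDress ρ l ((α - 1) / (α + 1))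

/-- The inverse of `gaugeAt`. -/
def gaugeInvAt (ρ : CEnd n) (α β : ℂ) (l l' : CVec n) : CEnd n :=
  nullDress ρ l ((α - 1) / (α + 1))⁻¹ * nullDress ρ l' ((1 - β) / (1 + β))⁻¹

section Gauge

variable {α β : ℂ} {l l' : CVec n}

lemma gaugeAt_mul_inv (h : IsReflectionOf ρ V) (hl : IsNullVector ρ l) (hl' : IsNullVector ρ l')
    (hc : (α - 1) / (α + 1) ≠ 0) (hc' : (1 - β) / (1 + β) ≠ 0) :
    gaugeAt ρ α β l l' * gaugeInvAt ρ α β l l' = 1 := by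
  rw [gaugeAt, gaugeInvAt, mul_assoc, ← mul_assoc (nullDress ρ l _), nullDress_mul_inv h hl hc,
    one_mul, nullDress_mul_inv h hl' hc']

lemma gaugeInvAt_mul (h : IsReflectionOf ρ V) (hl : IsNullVector ρ l) (hl' : IsNullVector ρ l')
    (hc : (α - 1) / (α + 1) ≠ 0) (hc' : (1 - β) / (1 + β) ≠ 0) :
    gaugeInvAt ρ α β l l' * gaugeAt ρ α β l l' = 1 := by
  rw [gaugeAt, gaugeInvAt, mul_assoc, ← mul_assoc (nullDress ρ l' _), nullDress_inv_mul h hl' hc',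
    one_mul, nullDress_inv_mul h hl hc]

lemma transpose_gaugeInvAt (h : IsReflectionOf ρ V) (hl : IsNullVector ρ l)
    (hl' : IsNullVector ρ l') :
    transpose n (gaugeInvAt ρ α β l l') = gaugeAt ρ α β l l' := by
  rw [gaugeInvAt, transpose_mul, transpose_nullDress h hl, transpose_nullDress h hl', inv_inv,
    inv_inv, gaugeAt]

end Gauge

lemma IsReflectionOf.conjSpace_eq (h : IsReflectionOf ρ V) (hρ : conjEnd n ρ = ρ) :
    conjSpace V = V := by
  ext v
  show star v ∈ V ↔ v ∈ V
  rw [h.mem_iff, h.mem_iff]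
  conv_rhs => rw [← hρ, conjEnd_apply]
  exact (star_eq_iff_star_eq.trans eq_comm).symm

lemma nullDress_neg_one_mem (h : IsReflectionOf ρ V) (l : CVec n) {v : CVec n} (hv : v ∈ V) :
    nullDress ρ l (-1) v ∈ V := by
  have := congrArg (· v) (commute_nullDress_neg_one h l)
  simp only [mul_apply_eq_comp] at this
  rw [h.mem_iff, this, (h.mem_iff v).1 hv]

lemma nullDress_neg_one_mem_perp (h : IsReflectionOf ρ V) (l : CVec n) {v : CVec n}
    (hv : v ∈ perp V) : nullDress ρ l (-1) v ∈ perp V := by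
  have := congrArg (· v) (commute_nullDress_neg_one h l)
  simp only [mul_apply_eq_comp] at this
  rw [h.mem_perp_iff, this, (h.mem_perp_iff v).1 hv, map_neg]

lemma wedgeSq_nullDress_neg_one (h : IsReflectionOf ρ V) {l : CVec n} (hl : IsNullVector ρ l)
    {ξ : CEnd n} (hξ : ξ ∈ wedgeSq V ⊔ wedgeSq (perp V)) :
    nullDress ρ l (-1) * ξ * nullDress ρ l (-1) ∈ wedgeSq V ⊔ wedgeSq (perp V) := by
  have := wedgeSq_sup_conj (fun v => nullDress_neg_one_mem h l)
    (fun v => nullDress_neg_one_mem_perp h l) hξ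
  rwa [transpose_nullDress h hl, show (-1 : ℂ)⁻¹ = -1 by norm_num] at this

lemma wedgeSq_image {T : CEnd n} (hT : transpose n T * T = 1) {ξ : CEnd n}
    (hξ : ξ ∈ wedgeSq V ⊔ wedgeSq (perp V)) :
    T * ξ * transpose n T ∈ wedgeSq (image T V) ⊔ wedgeSq (perp (image T V)) := by
  refine wedgeSq_sup_conj (P' := image T V)
    (fun v hv => Submodule.mem_map_of_mem (f := (T : CVec n →ₗ[ℂ] CVec n)) hv) (fun v hv => ?_) hξ
  rw [mem_perp] at hv ⊢
  rintro _ ⟨w, hw, rfl⟩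
  have := congrArg (· v) hT
  simp only [mul_apply_eq_comp, one_apply_eq_self] at this
  show metric n (T w) (T v) = 0
  rw [← metric_transpose', this, hv w hw]

/-- For reality of the transform: primes denote conjugates, and the factor `K` cancels from the
conjugate of its reflection because it commutes with `r = ρ`. -/
lemma mul_reflection_mul_of_conj_factor {R : Type*} [Ring R] {k g k' g' K K' r : R}
    (hgk : g * k = 1) (hkg' : k' * g' = 1) (hKK : K * K' = 1) (hKK' : K' * K = 1)
    (hr : r * K = K * r) (hg : g' = K * g) :
    k' = k * K' ∧ k' * r * g' = k * r * g := by
  have h1 : k' = k * K' := by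
    calc k' = k' * (K * (g * k) * K') := by rw [hgk, mul_one, hKK, mul_one]
      _ = k' * (K * g) * k * K' := by noncomm_ring
      _ = k * K' := by rw [← hg, hkg', one_mul]
  refine ⟨h1, ?_⟩
  calc k' * r * g' = k * K' * (r * K) * g := by rw [h1, hg]; noncomm_ring
    _ = k * (K' * K) * r * g := by rw [hr]; noncomm_ring
    _ = k * r * g := by rw [hKK', mul_one]

/-- For reality of the multiplier, with `s` one of `r(0)`, `r(∞)` and `s'` the conjugate of the
other. Since `s` and `s' = K s` are involutions, `K s K = s`. -/
lemma sandwich_of_conj_factor {R : Type*} [Ring R] {K K' s s' a : R}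
    (hKK' : K' * K = 1) (hs : s * s = 1) (hs' : s' * s' = 1) (h : s' = K * s) :
    K' * (s' * a * s') * K = s * a * s := by
  have h1 : K * s * K = s := by
    calc K * s * K = (K * s) * K * (s * s) := by rw [hs, mul_one]
      _ = (K * s) * (K * s) * s := by noncomm_ring
      _ = s := by rw [← h, hs', one_mul]
  calc K' * (s' * a * s') * K = (K' * K) * s * a * (K * s * K) := by rw [h]; noncomm_ring
    _ = s * a * s := by rw [hKK', one_mul, h1]

end Pointwise

/-! ### Parallel line bundles in charts -/

section Parallel

variable {M : Type*} [TopologicalSpace M] [ChartedSpace ℂ M] {n : ℕ}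

lemma diff_apply {e : M → CEnd n} (he : ContMDiff 𝓘(ℝ, ℂ) 𝓘(ℝ, CEnd n) ∞ e) (w : CVec n) (x : M)
    (X : TangentSpace 𝓘(ℝ, ℂ) x) : diff (fun y => e y w) x X = diff e x X w := by
  have h1 := (he x).mdifferentiableAt (by simp)
  let B : CEnd n →L[ℝ] CVec n := (ContinuousLinearMap.apply ℂ (CVec n) w).restrictScalars ℝ
  have h2 : MDifferentiableAt 𝓘(ℝ, CEnd n) 𝓘(ℝ, CVec n) B (e x) :=
    B.differentiableAt.mdifferentiableAt
  have h3 := mfderiv_comp x h2 h1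
  rw [mfderiv_eq_fderiv, ContinuousLinearMap.fderiv] at h3
  exact congrArg (fun T => T X) h3

/-- For every constant vector `w`, the map `y ↦ e y w` is a global section of `L`. These sections
turn parallelism into an algebraic identity for the projection. -/
lemma IsParallel.proj {A : OneForm M (CEnd n)} {L : M → Submodule ℂ (CVec n)}
    (hpar : IsParallel A L) {e : M → CEnd n} (he : ContMDiff 𝓘(ℝ, ℂ) 𝓘(ℝ, CEnd n) ∞ e)
    (h1 : ∀ x w, e x w ∈ L x) (h2 : ∀ x, ∀ w ∈ L x, e x w = w) (x : M)
    (X : TangentSpace 𝓘(ℝ, ℂ) x) :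
    (1 - e x) * (diff e x X + A x X * e x) = 0 := by
  ext1 w
  have := hpar Set.univ (fun y => e y w) isOpen_univ
    (fun y _ => (contMDiffAt_clm (ContinuousLinearMap.apply ℂ (CVec n) w)
      (he y)).contMDiffWithinAt) (fun y _ => h1 y w) x trivial X
  rw [diff_apply he] at this
  have h3 := h2 x _ this
  simp only [mul_apply_eq_comp, sub_apply, add_apply, one_apply_eq_self, zero_apply]
  rw [h3, sub_self]

lemma conjEnd_of_isRealForm {q : OneForm M (CEnd n)} (hq : IsRealForm q) (x : M)
    (X : TangentSpace 𝓘(ℝ, ℂ) x) : conjEnd n (q x X) = q x X := by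
  ext1 v
  rw [conjEnd_apply, hq, star_star]

lemma part10_apply (q : OneForm M (CEnd n)) (x : M) (X : TangentSpace 𝓘(ℝ, ℂ) x) :
    part10 q x X = (1 / 2 : ℂ) • (q x X - Complex.I • q x (complexStructure x X)) := rfl

lemma part01_apply (q : OneForm M (CEnd n)) (x : M) (X : TangentSpace 𝓘(ℝ, ℂ) x) :
    part01 q x X = (1 / 2 : ℂ) • (q x X + Complex.I • q x (complexStructure x X)) := rfl

variable [IsManifold 𝓘(ℂ) ω M]

lemma IsParallel.proj_inChart {V L : M → Submodule ℂ (CVec n)} {q : OneForm M (CEnd n)} {α : ℂ}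
    (hpar : IsParallel (connForm V q α) L) {e : M → CEnd n}
    (he : ContMDiff 𝓘(ℝ, ℂ) 𝓘(ℝ, CEnd n) ∞ e)
    (h1 : ∀ x w, e x w ∈ L x) (h2 : ∀ x, ∀ w ∈ L x, e x w = w) (x₀ : M) {z : ℂ}
    (hz : z ∈ (chartAt ℂ x₀).target) (X : ℂ) :
    (1 - e ((chartAt ℂ x₀).symm z)) * (fderiv ℝ (fun z => e ((chartAt ℂ x₀).symm z)) z X
      + (LaurentForm.ofForms (inChart (formN V) x₀) (inChart q x₀)).form α z X
        * e ((chartAt ℂ x₀).symm z)) = 0 := by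
  rw [← inChart_diff he x₀ hz, ← inChart_connForm V q α x₀ hz]
  exact hpar.proj he h1 h2 _ _

/-- A constrained harmonic bundle in a chart. -/
lemma IsConstrainedHarmonic.isLax {V : M → Submodule ℂ (CVec n)} {q : OneForm M (CEnd n)}
    (hV : IsConstrainedHarmonic V q) (x₀ : M) :
    IsLax (chartAt ℂ x₀).target (transpose n) Complex.I
      (fun z => reflection (V ((chartAt ℂ x₀).symm z)))
      (LaurentForm.ofForms (inChart (formN V) x₀) (inChart q x₀)) := by
  have hΩ := (chartAt ℂ x₀).open_target
  have h := fun x => isReflectionOf_reflection (hV.isNondegenerate x)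
  have hρ := contMDiff_reflection hV.isSubbundle hV.isNondegenerate
  have hρ' := contDiffOn_comp_chart hρ x₀
  have hN : ∀ z ∈ (chartAt ℂ x₀).target, ∀ X, inChart (formN V) x₀ z X = _ :=
    fun z hz X => inChart_formN hρ h x₀ hz X
  have hQ : ∀ z ∈ (chartAt ℂ x₀).target, ∀ X, inChart q x₀ z X ∈
      wedgeSq (V ((chartAt ℂ x₀).symm z)) ⊔ wedgeSq (perp (V ((chartAt ℂ x₀).symm z))) :=
    fun z hz X => hV.values _ _
  refine isLax_ofForms hΩ transpose_mul ?_ (hV.isSmoothForm x₀) hρ' (fun z _ => (h _).sq)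
    (fun z _ => (h _).tr) hN (fun z hz X => transpose_of_mem_sup (hQ z hz X))
    (fun z hz X => (h _).comm_of_mem_sup (hQ z hz X)) (fun t ht z hz X Y => ?_)
  · refine ContDiffOn.congr (f := fun z => -((1 / 2 : ℂ) •
      sandwich (reflection (V ((chartAt ℂ x₀).symm z))) 1
        (fderiv ℝ (fun z => reflection (V ((chartAt ℂ x₀).symm z))) z))) ?_ (fun z hz => ?_)
    · exact ((ContDiffOn.sandwich hρ' contDiffOn_const (contDiffOn_fderiv hΩ hρ')).const_smul _).neg
    · ext1 X
      rw [hN z hz, neg_apply, smul_apply, sandwich_apply, mul_one]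
  · rw [curv_congr_on hΩ (fun z hz => (inChart_connForm V q t x₀ hz).symm) hz]
    exact hV.flat t ht x₀ z hz X Y

lemma conjEnd_inChart_formN {V : M → Submodule ℂ (CVec n)} (hV : IsSubbundle V)
    (hnd : IsNondegenerate V) (hr : IsRealBundle V) (x₀ : M) {z : ℂ}
    (hz : z ∈ (chartAt ℂ x₀).target) (X : ℂ) :
    conjEnd n (inChart (formN V) x₀ z X) = inChart (formN V) x₀ z X := by
  have h := fun x => isReflectionOf_reflection (hnd x)
  have hρ := contMDiff_reflection hV hnd
  rw [inChart_formN hρ h x₀ hz, map_neg, conjEnd_smul, conjEnd_mul, (h _).conjEnd_eq (hr _),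
    fderiv_conjEnd (chartAt ℂ x₀).open_target (contDiffOn_comp_chart hρ x₀)
      (fun z _ => (h _).conjEnd_eq (hr _)) hz]
  simp

end Parallel

/-! ### The second line of the double dressing -/

/-- The second line of the double dressing is parallel for the connection dressed once. -/
lemma isParallelPair_hat {n : ℕ} {Ω : Set ℂ} (hΩ : IsOpen Ω) {N Q : ℂ → ℂ →L[ℝ] CEnd n}
    {ρ : ℂ → CEnd n} {W : ℂ → Submodule ℂ (CVec n)} (h : ∀ z, IsReflectionOf (ρ z) (W z))
    (hρ : ∀ z, conjEnd n (ρ z) = ρ z)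
    (hA : IsLax Ω (transpose n) Complex.I ρ (LaurentForm.ofForms N Q))
    (hN : ∀ z ∈ Ω, ∀ X, conjEnd n (N z X) = N z X) (hQ : ∀ z ∈ Ω, ∀ X, conjEnd n (Q z X) = Q z X)
    {α β : ℂ} (hα₀ : α ≠ 0) (hβ : β = (star α)⁻¹) (hαβ : β ≠ α) (hαβ' : β ≠ -α)
    {l l' : ℂ → CVec n} (hl : ∀ z, IsNullVector (ρ z) (l z))
    (hl' : ∀ z, IsNullVector (ρ z) (l' z))
    (hll' : ∀ z, l' z = nullDress (ρ z) (l z) ((α - β) / (α + β)) (star (l z)))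
    (hp : IsParallelPair Ω (transpose n) ρ (fun z => nullProj (ρ z) (l z))
      (fun z => nullProj' (ρ z) (l z)) ((LaurentForm.ofForms N Q).form α))
    (hs : ContDiffOn ℝ ∞ (fun z => nullProj (ρ z) (star (l z))) Ω)
    (he : ContDiffOn ℝ ∞ (fun z => nullProj (ρ z) (l' z)) Ω)
    (hf : ContDiffOn ℝ ∞ (fun z => nullProj' (ρ z) (l' z)) Ω) :
    IsParallelPair Ω (transpose n) ρ (fun z => nullProj (ρ z) (l' z))
      (fun z => nullProj' (ρ z) (l' z)) (((LaurentForm.ofForms N Q).dress α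
        (fun z => nullProj (ρ z) (l z)) (fun z => nullProj' (ρ z) (l z))).form β) where
  pair := fun z _ => isNullPair_nullProj (h z) (hl' z)
  smooth_left := he
  smooth_right := hf
  parallel := by
    have hc : (α - β) / (α + β) ≠ 0 := dressFactor_ne_zero hαβ hαβ'
    have hβ₀ : β ≠ 0 := by rw [hβ]; exact inv_ne_zero (star_ne_zero.2 hα₀)
    have hls := fun z => (hl z).star (hρ z)
    have g1 : ∀ z, nullDress (ρ z) (l z) ((α - β) / (α + β))⁻¹ (l' z) = star (l z) := fun z => by
      rw [hll']
      simpa using congrArg (· (star (l z))) (nullDress_inv_mul (h z) (hl z) hc)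
    have g2 : ∀ z w, nullDress (ρ z) (l z) ((α - β) / (α + β))
        (nullProj (ρ z) (star (l z)) w) = ((metric n (star (l z)) (ρ z (star (l z))))⁻¹
          * metric n (ρ z (star (l z))) w) • l' z := fun z w => by
      rw [nullProj_apply, map_smul, ← hll']
    have hcs : ∀ c, ContDiffOn ℝ ∞ (fun z => nullDress (ρ z) (l z) c) Ω := fun c =>
      contDiffOn_dress c hp.smooth_left hp.smooth_right
    -- By reality the conjugate line is parallel at `β` before dressing; the gauge transformation
    -- `p(β)`, regular because `β ≠ ±α`, then carries it to `L̂`.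
    have hB : ∀ z ∈ Ω, ∀ X, (1 - nullProj (ρ z) (star (l z))) *
        (fderiv ℝ (fun z => nullProj (ρ z) (star (l z))) z X
          + (LaurentForm.ofForms N Q).form β z X * nullProj (ρ z) (star (l z))) = 0 := by
      intro z hz X
      rw [hβ]
      exact parallel_conj hΩ hN hQ hp.smooth_left
        (fun z _ => conjEnd_nullProj (hρ z) _) hp.parallel hz X
    have h1 : ∀ z ∈ Ω, nullDress (ρ z) (l z) ((α - β) / (α + β)) * nullProj (ρ z) (star (l z))
        * nullDress (ρ z) (l z) ((α - β) / (α + β))⁻¹ * nullProj (ρ z) (l' z)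
        = nullProj (ρ z) (l' z) := by
      intro z _
      ext1 w
      simp only [mul_apply_eq_comp]
      rw [nullProj_apply _ (l' _), map_smul, g1, map_smul, nullProj_self (hls z), map_smul,
        ← hll']
    have h2 : ∀ z ∈ Ω, nullProj (ρ z) (l' z) * (nullDress (ρ z) (l z) ((α - β) / (α + β))
        * nullProj (ρ z) (star (l z)) * nullDress (ρ z) (l z) ((α - β) / (α + β))⁻¹)
        = nullDress (ρ z) (l z) ((α - β) / (α + β))
        * nullProj (ρ z) (star (l z)) * nullDress (ρ z) (l z) ((α - β) / (α + β))⁻¹ := by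
      intro z _
      ext1 w
      simp only [mul_apply_eq_comp]
      rw [g2, map_smul, nullProj_self (hl' z)]
    have hd := fun z hz X =>
      hp.dress_form hΩ hA transpose_mul transpose_one hα₀ hβ₀ hαβ hαβ' (z := z) hz X
    intro z hz X
    exact parallel_of_gauge hΩ (hcs ((α - β) / (α + β))) (hcs ((α - β) / (α + β))⁻¹)
      (fun z _ => nullDress_mul_inv (h z) (hl z) hc)
      (fun z _ => nullDress_inv_mul (h z) (hl z) hc) hs he hd hB h1 h2 hz X

/-! ### The Bäcklund transform -/

section Backlund

variable {M : Type*} [TopologicalSpace M] [ChartedSpace ℂ M] {n : ℕ}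

/-- The line bundle spanned by the vectors `l x` is smooth, in terms of the projections onto it and
onto its reflection. -/
structure IsSmoothNullLine (ρ : M → CEnd n) (l : M → CVec n) : Prop where
  null : ∀ x, IsNullVector (ρ x) (l x)
  smooth_left : ContMDiff 𝓘(ℝ, ℂ) 𝓘(ℝ, CEnd n) ∞ (fun x => nullProj (ρ x) (l x))
  smooth_right : ContMDiff 𝓘(ℝ, ℂ) 𝓘(ℝ, CEnd n) ∞ (fun x => nullProj' (ρ x) (l x))

lemma IsSmoothNullLine.contMDiff_nullDress {ρ : M → CEnd n} {l : M → CVec n}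
    (h : IsSmoothNullLine ρ l) (c : ℂ) :
    ContMDiff 𝓘(ℝ, ℂ) 𝓘(ℝ, CEnd n) ∞ (fun x => nullDress (ρ x) (l x) c) := fun x =>
  (contMDiffAt_const.add (contMDiffAt_const_smul _ (h.smooth_left x))).add
    (contMDiffAt_const_smul _ (h.smooth_right x))

lemma contMDiff_mul {a b : M → CEnd n} (ha : ContMDiff 𝓘(ℝ, ℂ) 𝓘(ℝ, CEnd n) ∞ a)
    (hb : ContMDiff 𝓘(ℝ, ℂ) 𝓘(ℝ, CEnd n) ∞ b) :
    ContMDiff 𝓘(ℝ, ℂ) 𝓘(ℝ, CEnd n) ∞ (fun x => a x * b x) := fun x =>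
  contMDiffAt_compL (ha x) (hb x)

lemma IsGenericNullLine.isSmoothNullLine {V L : M → Submodule ℂ (CVec n)} (hV : IsSubbundle V)
    (hnd : IsNondegenerate V) (hL : IsGenericNullLine V L) {l : M → CVec n}
    (hl : ∀ x, IsNullVector (reflection (V x)) (l x)) (hlL : ∀ x, L x = Submodule.span ℂ {l x}) :
    IsSmoothNullLine (fun x => reflection (V x)) l where
  null := hl
  smooth_left := by
    have := hL.contMDiff_lineProj hV hnd
    simpa only [hlL, lineProj_span (isReflectionOf_reflection (hnd _)) (hl _)] using this
  smooth_right := by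
    have := hL.contMDiff_lineProj' hV hnd
    simpa only [hlL, lineProj'_span (isReflectionOf_reflection (hnd _)) (hl _)] using this

lemma IsSubbundle.image {V : M → Submodule ℂ (CVec n)} (hV : IsSubbundle V) {k g : M → CEnd n}
    (hk : ContMDiff 𝓘(ℝ, ℂ) 𝓘(ℝ, CEnd n) ∞ k) (hgk : ∀ x, g x * k x = 1) :
    IsSubbundle (fun x => image (k x) (V x)) := by
  intro x₀
  obtain ⟨U, hU, hx₀, m, s, hs, hsV⟩ := hV x₀
  refine ⟨U, hU, hx₀, m, fun i x => k x (s i x), fun i x hx => ?_, fun x hx => ⟨?_, ?_⟩⟩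
  · exact (contMDiffAt_bilin (ContinuousLinearMap.id ℂ (CEnd n)) (hk x)
      ((hs i).contMDiffAt (hU.mem_nhds hx))).contMDiffWithinAt
  · refine (hsV x hx).1.map' (k x : CVec n →ₗ[ℂ] CVec n) (LinearMap.ker_eq_bot'.2 fun v hv => ?_)
    have h1 : g x (k x v) = v := by simpa using congrArg (· v) (hgk x)
    have h2 : k x v = 0 := hv
    rw [← h1, h2, map_zero]
  · beta_reduce
    rw [← (hsV x hx).2, HarmonicBundles.image, Submodule.map_span, ← Set.range_comp]
    rfl

/-- The hypothesis on `L̂` is only the transversality condition. That `L̂` is a null line follows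
because `p(β)` is orthogonal and invertible, and its smoothness from a local spanning vector. -/
lemma IsGenericNullLine.conj_dress {V L : M → Submodule ℂ (CVec n)} (hV : IsSubbundle V)
    (hnd : IsNondegenerate V) (hr : IsRealBundle V) (hL : IsGenericNullLine V L) (α β : ℂ)
    (hi : ∀ x, image (reflection (V x)) (hatLine (V x) α β (L x) (conjSpace (L x)))
      ⊓ perp (hatLine (V x) α β (L x) (conjSpace (L x))) = ⊥)
    (hc : (α - β) / (α + β) ≠ 0) :
    IsGenericNullLine V (fun x => conjSpace (L x)) ∧
    IsGenericNullLine V (fun x => hatLine (V x) α β (L x) (conjSpace (L x))) ∧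
    ∀ x (l : CVec n), IsNullVector (reflection (V x)) l → L x = Submodule.span ℂ {l} →
      IsNullVector (reflection (V x))
        (nullDress (reflection (V x)) l ((α - β) / (α + β)) (star l)) := by
  have h := fun x => isReflectionOf_reflection (hnd x)
  have hρ := contMDiff_reflection hV hnd
  have key : ∀ x (l : CVec n), IsNullVector (reflection (V x)) l → L x = Submodule.span ℂ {l} →
      IsNullVector (reflection (V x))
        (nullDress (reflection (V x)) l ((α - β) / (α + β)) (star l)) := by
    intro x l hl hlL
    have hi' := hi x
    rw [hlL, hatLine_span (h x) hl] at hi'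
    have hs := hl.star ((h x).conjEnd_eq (hr x))
    have hn : metric n (nullDress (reflection (V x)) l ((α - β) / (α + β)) (star l))
        (nullDress (reflection (V x)) l ((α - β) / (α + β)) (star l)) = 0 := by
      rw [metric_nullDress (h x) hl hc, hs.null]
    refine isNullVector_of_inf (h x) (fun h0 => hs.ne ?_) hn hi'
    have h1 := congrArg (· (star l)) (nullDress_inv_mul (h x) hl hc)
    simp only [mul_apply_eq_comp, one_apply_eq_self, h0, map_zero] at h1
    rw [← h1]; simp
  -- Conjugation is only real-linear, so its smoothness is taken over `ℝ`.
  have hsm : ∀ {U : Set M} {l : M → CVec n} {x : M}, IsOpen U → x ∈ U →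
      ContMDiffOn 𝓘(ℝ, ℂ) 𝓘(ℝ, CVec n) ∞ l U →
      ContMDiffAt 𝓘(ℝ, ℂ) 𝓘(ℝ, CVec n) ∞ (fun y => star (l y)) x := fun hU hx hl =>
    (starL' ℝ : CVec n ≃L[ℝ] CVec n).contDiff.comp_contMDiffAt (hl.contMDiffAt (hU.mem_nhds hx))
  refine ⟨fun x₀ => ?_, fun x₀ => ?_, key⟩
  · obtain ⟨U, hU, hx₀, l, hl, hlL⟩ := hL x₀
    refine ⟨U, hU, hx₀, fun y => star (l y), fun x hx => (hsm hU hx hl).contMDiffWithinAt,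
      fun x hx => ⟨(hlL x hx).1.star ((h x).conjEnd_eq (hr x)), ?_⟩⟩
    beta_reduce
    rw [(hlL x hx).2, conjSpace_span_singleton]
  · obtain ⟨U, hU, hx₀, l, hl, hlL⟩ := hL x₀
    refine ⟨U, hU, hx₀,
      fun y => nullDress (reflection (V y)) (l y) ((α - β) / (α + β)) (star (l y)),
      fun x hx => ?_, fun x hx => ⟨key x _ (hlL x hx).1 (hlL x hx).2, ?_⟩⟩
    · have hp := contMDiffAt_nullProj (hρ x) (hl.contMDiffAt (hU.mem_nhds hx)) (hlL x hx).1
      have hd : ContMDiffAt 𝓘(ℝ, ℂ) 𝓘(ℝ, CEnd n) ∞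
          (fun y => nullDress (reflection (V y)) (l y) ((α - β) / (α + β))) x :=
        (contMDiffAt_const.add (contMDiffAt_const_smul _ hp.1)).add
          (contMDiffAt_const_smul _ hp.2)
      exact (contMDiffAt_bilin (ContinuousLinearMap.id ℂ (CEnd n)) hd
        (hsm hU hx hl)).contMDiffWithinAt
    · beta_reduce
      rw [(hlL x hx).2, hatLine_span (h x) (hlL x hx).1]

variable [IsManifold 𝓘(ℂ) ω M]

section Chart

variable {V : M → Submodule ℂ (CVec n)} {q : OneForm M (CEnd n)} {l : M → CVec n} {α β : ℂ}

lemma isParallelPair_inChart (hV : IsConstrainedHarmonic V q)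
    (hl : IsSmoothNullLine (fun x => reflection (V x)) l)
    (hpar : IsParallel (connForm V q α) (fun x => Submodule.span ℂ {l x})) (x₀ : M) :
    IsParallelPair (chartAt ℂ x₀).target (transpose n)
      (fun z => reflection (V ((chartAt ℂ x₀).symm z)))
      (fun z => nullProj (reflection (V ((chartAt ℂ x₀).symm z))) (l ((chartAt ℂ x₀).symm z)))
      (fun z => nullProj' (reflection (V ((chartAt ℂ x₀).symm z))) (l ((chartAt ℂ x₀).symm z)))
      ((LaurentForm.ofForms (inChart (formN V) x₀) (inChart q x₀)).form α) where
  pair := fun _ _ =>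
    isNullPair_nullProj (isReflectionOf_reflection (hV.isNondegenerate _)) (hl.null _)
  smooth_left := contDiffOn_comp_chart hl.smooth_left x₀
  smooth_right := contDiffOn_comp_chart hl.smooth_right x₀
  parallel := fun z hz X => by
    refine hpar.proj_inChart hl.smooth_left (fun x w => ?_) (fun x w hw => ?_) x₀ hz X
    · rw [nullProj_apply]
      exact Submodule.smul_mem _ _ (Submodule.mem_span_singleton_self _)
    · obtain ⟨c, rfl⟩ := Submodule.mem_span_singleton.1 hw
      rw [map_smul, nullProj_self (hl.null x)]

lemma isParallelPair_hat_inChart (hV : IsRealConstrainedHarmonic V q) (hα₀ : α ≠ 0)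
    (hβ : β = (star α)⁻¹) (hαβ : β ≠ α) (hαβ' : β ≠ -α) {l' : M → CVec n}
    (hl : IsSmoothNullLine (fun x => reflection (V x)) l)
    (hls : IsSmoothNullLine (fun x => reflection (V x)) (fun x => star (l x)))
    (hl' : IsSmoothNullLine (fun x => reflection (V x)) l')
    (hll' : ∀ x, l' x = nullDress (reflection (V x)) (l x) ((α - β) / (α + β)) (star (l x)))
    (hpar : IsParallel (connForm V q α) (fun x => Submodule.span ℂ {l x})) (x₀ : M) :
    IsParallelPair (chartAt ℂ x₀).target (transpose n)
      (fun z => reflection (V ((chartAt ℂ x₀).symm z)))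
      (fun z => nullProj (reflection (V ((chartAt ℂ x₀).symm z))) (l' ((chartAt ℂ x₀).symm z)))
      (fun z => nullProj' (reflection (V ((chartAt ℂ x₀).symm z))) (l' ((chartAt ℂ x₀).symm z)))
      (((LaurentForm.ofForms (inChart (formN V) x₀) (inChart q x₀)).dress α
        (fun z => nullProj (reflection (V ((chartAt ℂ x₀).symm z))) (l ((chartAt ℂ x₀).symm z)))
        (fun z => nullProj' (reflection (V ((chartAt ℂ x₀).symm z)))
          (l ((chartAt ℂ x₀).symm z)))).form β) :=
  isParallelPair_hat (chartAt ℂ x₀).open_target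
    (fun _ => isReflectionOf_reflection (hV.isNondegenerate _))
    (fun _ => (isReflectionOf_reflection (hV.isNondegenerate _)).conjEnd_eq (hV.isRealBundle _))
    (hV.isLax x₀)
    (fun _ hz X => conjEnd_inChart_formN hV.isSubbundle hV.isNondegenerate hV.isRealBundle
      x₀ hz X) (fun _ _ _ => conjEnd_of_isRealForm hV.isRealForm _ _) hα₀ hβ hαβ hαβ'
    (fun _ => hl.null _) (fun _ => hl'.null _) (fun _ => hll' _)
    (isParallelPair_inChart hV.toIsConstrainedHarmonic hl hpar x₀)
    (contDiffOn_comp_chart hls.smooth_left x₀) (contDiffOn_comp_chart hl'.smooth_left x₀)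
    (contDiffOn_comp_chart hl'.smooth_right x₀)

end Chart

end Backlund

/-! ### Harmonicity and reality of the transform -/

section Backlund

variable {M : Type*} [TopologicalSpace M] [ChartedSpace ℂ M] [IsManifold 𝓘(ℂ) ω M] {n : ℕ}

lemma curv_dress_dress_nullDress {Ω : Set ℂ} (hΩ : IsOpen Ω) {N Q : ℂ → ℂ →L[ℝ] CEnd n}
    {ρ : ℂ → CEnd n} (hA : IsLax Ω (transpose n) Complex.I ρ (LaurentForm.ofForms N Q))
    {α β : ℂ} (hα : α ≠ 0) (hβ : β ≠ 0)
    (hα1 : α ≠ 1) (hα1' : α ≠ -1) (hβ1 : β ≠ 1) (hβ1' : β ≠ -1) {l l' : ℂ → CVec n}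
    (hp : IsParallelPair Ω (transpose n) ρ (fun z => nullProj (ρ z) (l z))
      (fun z => nullProj' (ρ z) (l z)) ((LaurentForm.ofForms N Q).form α))
    (hp' : IsParallelPair Ω (transpose n) ρ (fun z => nullProj (ρ z) (l' z))
      (fun z => nullProj' (ρ z) (l' z)) (((LaurentForm.ofForms N Q).dress α
        (fun z => nullProj (ρ z) (l z)) (fun z => nullProj' (ρ z) (l z))).form β))
    {N' Q' : ℂ → ℂ →L[ℝ] CEnd n}
    (hN : ∀ z ∈ Ω, ∀ X, N' z X = -((1 / 2 : ℂ) •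
      (gaugeInvAt (ρ z) α β (l z) (l' z) * ρ z * gaugeAt (ρ z) α β (l z) (l' z) *
      fderiv ℝ (fun y => gaugeInvAt (ρ y) α β (l y) (l' y) * ρ y
        * gaugeAt (ρ y) α β (l y) (l' y)) z X)))
    (hQ : ∀ z ∈ Ω, ∀ X, Q' z X = gaugeInvAt (ρ z) α β (l z) (l' z) *
      (nullDress (ρ z) (l' z) (-1) * typeL (Q z) X * nullDress (ρ z) (l' z) (-1)
        + nullDress (ρ z) (l z) (-1) * typeR (Q z) X * nullDress (ρ z) (l z) (-1))
      * gaugeAt (ρ z) α β (l z) (l' z))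
    {t : ℂ} (ht : t ≠ 0) {z : ℂ} (hz : z ∈ Ω) (X Y : ℂ) :
    curv ((LaurentForm.ofForms N' Q').form t) z X Y = 0 := by
  have h1 : ∀ z ∈ Ω, (LaurentForm.ofForms N Q).form 1 z = 0 :=
    fun z _ => LaurentForm.form_ofForms_one N Q z
  have key := curv_dress_dress hΩ hA transpose_mul transpose_one h1 hα hβ hα1 hα1' hβ1 hβ1' hp hp'
    (g := fun z => gaugeAt (ρ z) α β (l z) (l' z)) (k := fun z => gaugeInvAt (ρ z) α β (l z) (l' z))
    rfl rfl (N := N') (Q := Q')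
  exact key (fun z hz X => by rw [hN z hz X]) hQ ht hz X Y

/-- The theorem in terms of pointwise spanning vectors. The vectors `l x` need not vary smoothly:
everything depends on them through projections that are invariant under rescaling, and only these
are assumed smooth. -/
theorem isRealConstrainedHarmonic_image {V : M → Submodule ℂ (CVec n)} {q q' : OneForm M (CEnd n)}
    (hV : IsRealConstrainedHarmonic V q) {α β : ℂ} (hα₀ : α ≠ 0) (hβ : β = (star α)⁻¹)
    (hα1 : α ≠ 1) (hα1' : α ≠ -1) (hβ1 : β ≠ 1) (hβ1' : β ≠ -1) (hαβ : α ≠ β) (hαβ' : α ≠ -β)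
    {l l' : M → CVec n} (hl : IsSmoothNullLine (fun x => reflection (V x)) l)
    (hls : IsSmoothNullLine (fun x => reflection (V x)) (fun x => star (l x)))
    (hl' : IsSmoothNullLine (fun x => reflection (V x)) l')
    (hll' : ∀ x, l' x = nullDress (reflection (V x)) (l x) ((α - β) / (α + β)) (star (l x)))
    (hpar : IsParallel (connForm V q α) (fun x => Submodule.span ℂ {l x}))
    (hq' : ∀ x X, q' x X = gaugeInvAt (reflection (V x)) α β (l x) (l' x) *
      (nullDress (reflection (V x)) (l' x) (-1) * part10 q x X
          * nullDress (reflection (V x)) (l' x) (-1)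
        + nullDress (reflection (V x)) (l x) (-1) * part01 q x X
          * nullDress (reflection (V x)) (l x) (-1))
      * gaugeAt (reflection (V x)) α β (l x) (l' x)) :
    IsRealConstrainedHarmonic
      (fun x => image (gaugeInvAt (reflection (V x)) α β (l x) (l' x)) (V x)) q' := by
  have h := fun x => isReflectionOf_reflection (hV.isNondegenerate x)
  have hρ := contMDiff_reflection hV.isSubbundle hV.isNondegenerate
  have hρr : ∀ x, conjEnd n (reflection (V x)) = reflection (V x) := fun x =>
    (h x).conjEnd_eq (hV.isRealBundle x)
  have hc : (α - 1) / (α + 1) ≠ 0 := dressFactor_ne_zero hα1.symm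
    (fun h => hα1' (by rw [h, neg_neg]))
  have hc' : (1 - β) / (1 + β) ≠ 0 := dressFactor_ne_zero hβ1 hβ1'
  have hβ₀ : β ≠ 0 := by rw [hβ]; exact inv_ne_zero (star_ne_zero.2 hα₀)
  have hgk := fun x => gaugeAt_mul_inv (h x) (hl.null x) (hl'.null x) hc hc'
  have hkg := fun x => gaugeInvAt_mul (h x) (hl.null x) (hl'.null x) hc hc'
  have htr : ∀ x, transpose n (gaugeInvAt (reflection (V x)) α β (l x) (l' x)) =
      gaugeAt (reflection (V x)) α β (l x) (l' x) :=
    fun x => transpose_gaugeInvAt (h x) (hl.null x) (hl'.null x)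
  have hg : ContMDiff 𝓘(ℝ, ℂ) 𝓘(ℝ, CEnd n) ∞
      (fun x => gaugeAt (reflection (V x)) α β (l x) (l' x)) :=
    contMDiff_mul (hl'.contMDiff_nullDress _) (hl.contMDiff_nullDress _)
  have hk : ContMDiff 𝓘(ℝ, ℂ) 𝓘(ℝ, CEnd n) ∞
      (fun x => gaugeInvAt (reflection (V x)) α β (l x) (l' x)) :=
    contMDiff_mul (hl.contMDiff_nullDress _) (hl'.contMDiff_nullDress _)
  have h' : ∀ x, IsReflectionOf (gaugeInvAt (reflection (V x)) α β (l x) (l' x) * reflection (V x)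
      * gaugeAt (reflection (V x)) α β (l x) (l' x))
      (image (gaugeInvAt (reflection (V x)) α β (l x) (l' x)) (V x)) := fun x => by
    have := (h x).image (T := gaugeInvAt (reflection (V x)) α β (l x) (l' x))
      (by rw [htr, hgk]) (by rw [htr, hkg])
    rwa [htr] at this
  have hqc : ∀ x₀ z, z ∈ (chartAt ℂ x₀).target → ∀ X, inChart q' x₀ z X = _ := fun x₀ z hz X =>
    hq' ((chartAt ℂ x₀).symm z) (mfderiv 𝓘(ℝ, ℂ) 𝓘(ℝ, ℂ) (chartAt ℂ x₀).symm z X)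
  simp only [← inChart_apply] at hqc
  have hconj := fun x => exists_conj_factor (h x) (hρr x) (hl.null x) hα₀ hβ hα1 hα1' hβ1 hβ1'
    hαβ hαβ' (by rw [← hll']; exact hl'.null x)
  simp only [← hll'] at hconj
  refine ⟨⟨hV.isSubbundle.image hk hgk, fun x => (h' x).nondegenerate, fun x₀ => ?_,
    fun x X => ?_, fun t ht => ?_⟩, fun x => (h' x).conjSpace_eq ?_, fun x X v => ?_⟩
  · have s1 := contDiffOn_comp_chart hk x₀
    have s2 := contDiffOn_comp_chart hg x₀
    have s3 := contDiffOn_comp_chart (hl.contMDiff_nullDress (-1)) x₀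
    have s4 := contDiffOn_comp_chart (hl'.contMDiff_nullDress (-1)) x₀
    have s5 := contDiffOn_typeL (hV.isSmoothForm x₀)
    have s6 := contDiffOn_typeR (hV.isSmoothForm x₀)
    refine (ContDiffOn.sandwich s1 s2 ((ContDiffOn.sandwich s4 s4 s5).add
      (ContDiffOn.sandwich s3 s3 s6))).congr fun z hz => ?_
    ext1 X
    rw [hqc x₀ z hz, inChart_part10 q x₀ hz, inChart_part01 q x₀ hz]
    rfl
  · have m1 : part10 q x X ∈ wedgeSq (V x) ⊔ wedgeSq (perp (V x)) := by
      rw [part10_apply]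
      exact Submodule.smul_mem _ _ (Submodule.sub_mem _ (hV.values _ _)
        (Submodule.smul_mem _ _ (hV.values _ _)))
    have m2 : part01 q x X ∈ wedgeSq (V x) ⊔ wedgeSq (perp (V x)) := by
      rw [part01_apply]
      exact Submodule.smul_mem _ _ (Submodule.add_mem _ (hV.values _ _)
        (Submodule.smul_mem _ _ (hV.values _ _)))
    have := wedgeSq_image (T := gaugeInvAt (reflection (V x)) α β (l x) (l' x))
      (by rw [htr, hgk]) (Submodule.add_mem _
        (wedgeSq_nullDress_neg_one (h x) (hl'.null x) m1)
        (wedgeSq_nullDress_neg_one (h x) (hl.null x) m2))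
    rw [htr] at this
    rw [hq']
    exact this
  · rw [isFlat_iff]
    intro x₀ z hz X Y
    have hΩ := (chartAt ℂ x₀).open_target
    rw [curv_congr_on hΩ (fun z hz => inChart_connForm _ q' t x₀ hz) hz]
    refine curv_dress_dress_nullDress hΩ (hV.isLax x₀) hα₀ hβ₀ hα1 hα1' hβ1 hβ1'
      (isParallelPair_inChart hV.toIsConstrainedHarmonic hl hpar x₀)
      (isParallelPair_hat_inChart hV hα₀ hβ hαβ.symm (fun h => hαβ' (by rw [h, neg_neg])) hl hls
        hl' hll' hpar x₀)
      (fun z hz X => inChart_formN (contMDiff_mul (contMDiff_mul hk hρ) hg) h' x₀ hz X)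
      (fun z hz X => ?_) ht hz X Y
    rw [hqc x₀ z hz, inChart_part10 q x₀ hz, inChart_part01 q x₀ hz]
  · obtain ⟨K, K', k1, k2, k3, k4, k5, k6⟩ := hconj x
    have kg := congrArg (conjEnd n) (hkg x)
    rw [conjEnd_mul, conjEnd_one] at kg
    rw [conjEnd_mul, conjEnd_mul, hρr]
    exact (mul_reflection_mul_of_conj_factor (hgk x) kg k1 k2 k3 k4).2
  · obtain ⟨K, K', k1, k2, k3, k4, k5, k6⟩ := hconj x
    have kg := congrArg (conjEnd n) (hkg x)
    rw [conjEnd_mul, conjEnd_one] at kg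
    have e1 := (mul_reflection_mul_of_conj_factor (hgk x) kg k1 k2 k3 k4).1
    have r1 := nullDress_neg_one_sq (h x) (hl.null x)
    have r2 := nullDress_neg_one_sq (h x) (hl'.null x)
    have r1' := congrArg (conjEnd n) r1
    have r2' := congrArg (conjEnd n) r2
    rw [conjEnd_mul, conjEnd_one] at r1' r2'
    have hq := fun X => conjEnd_of_isRealForm hV.isRealForm x X
    have p1 : conjEnd n (part10 q x X) = part01 q x X := conjEnd_typeL (η := q x) hq X
    have p2 : conjEnd n (part01 q x X) = part10 q x X := conjEnd_typeR (η := q x) hq X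
    have t1 := sandwich_of_conj_factor (a := part01 q x X) k2 r1 r2' k6
    -- Conjugation thus exchanges the two summands of the multiplier, up to `K`.
    have t2 := sandwich_of_conj_factor (a := part10 q x X) k2 r2 r1' k5
    have key : conjEnd n (q' x X) = q' x X := by
      have k4' : conjEnd n (gaugeAt (reflection (V x)) α β (l x) (l' x)) =
          K * gaugeAt (reflection (V x)) α β (l x) (l' x) := k4
      rw [hq', conjEnd_mul, conjEnd_mul, map_add, conjEnd_mul, conjEnd_mul, conjEnd_mul,
        conjEnd_mul, p1, p2, e1, k4', mul_assoc (gaugeInvAt _ _ _ _ _) K', ← mul_assoc _ K,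
        mul_assoc (gaugeInvAt _ _ _ _ _), mul_add K', add_mul _ _ K, t1, t2,
        add_comm (nullDress _ (l x) _ * _ * _)]
    conv_rhs => rw [← key, conjEnd_apply, star_star]

end Backlund

end HarmonicBundles

end

/-! ### Identification with `r*` and conclusion -/

theorem mainTheorem5 {M : Type*} [TopologicalSpace M] [ChartedSpace ℂ M]
    [IsManifold 𝓘(ℂ) ω M] {n : ℕ}
    (V : M → Submodule ℂ (CVec n)) (q : OneForm M (CEnd n))
    (hV : IsRealConstrainedHarmonic V q)
    (α β : ℂ) (hα₀ : α ≠ 0) (hα₁ : ‖α‖ ≠ 1) (hβ : β = (star α)⁻¹)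
    (Lα Lβ : M → Submodule ℂ (CVec n))
    (hLα : IsNullLineSubbundle Lα)
    (hpar : IsParallel (connForm V q α) Lα)
    (hρ : ∀ x, image (reflection (V x)) (Lα x) ⊓ perp (Lα x) = ⊥)
    (hLβ : ∀ x, Lβ x = conjSpace (Lα x))
    (hρ' : ∀ x, image (reflection (V x)) (hatLine (V x) α β (Lα x) (Lβ x))
      ⊓ perp (hatLine (V x) α β (Lα x) (Lβ x)) = ⊥) :
    IsRealConstrainedHarmonic (backlundBundle V α β Lα Lβ)
      (backlundForm V q α β Lα Lβ) := by
  have hn : ‖β‖ = ‖α‖⁻¹ := by rw [hβ, norm_inv, norm_star]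
  -- Off the unit circle, `α` and `β` lie on opposite sides of it, hence `α ≠ ±β`; and neither is
  -- `±1`, so that `r(1)` is regular.
  have hn1 : ‖β‖ ≠ 1 := by rw [hn]; exact inv_ne_one.2 hα₁
  have hn2 : ‖α‖ ≠ ‖β‖ := fun h => by
    rw [hn] at h
    have h2 : ‖α‖ * ‖α‖ = 1 := by
      nth_rewrite 1 [h]; exact inv_mul_cancel₀ (norm_ne_zero_iff.2 hα₀)
    rcases mul_self_eq_one_iff.1 h2 with h3 | h3
    · exact hα₁ h3
    · linarith [norm_nonneg α]
  have hβ₀ : β ≠ 0 := by rw [hβ]; exact inv_ne_zero (star_ne_zero.2 hα₀)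
  have hα1 : α ≠ 1 := fun h => hα₁ (by rw [h, norm_one])
  have hα1' : α ≠ -1 := fun h => hα₁ (by rw [h, norm_neg, norm_one])
  have hβ1 : β ≠ 1 := fun h => hn1 (by rw [h, norm_one])
  have hβ1' : β ≠ -1 := fun h => hn1 (by rw [h, norm_neg, norm_one])
  have hαβ : α ≠ β := fun h => hn2 (by rw [h])
  have hαβ' : α ≠ -β := fun h => hn2 (by rw [h, norm_neg])
  obtain rfl : Lβ = fun x => conjSpace (Lα x) := funext hLβ
  have h := fun x => isReflectionOf_reflection (hV.isNondegenerate x)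
  have hr : ∀ x, conjEnd n (reflection (V x)) = reflection (V x) := fun x =>
    (h x).conjEnd_eq (hV.isRealBundle x)
  have gα := hLα.isGenericNullLine hV.isNondegenerate hρ
  obtain ⟨gβ, gh, hnull⟩ := gα.conj_dress hV.isSubbundle hV.isNondegenerate hV.isRealBundle α β hρ'
    (dressFactor_ne_zero hαβ.symm fun h => hαβ' (by rw [h, neg_neg]))
  have hex : ∀ x, ∃ l, IsNullVector (reflection (V x)) l ∧ Lα x = Submodule.span ℂ {l} := fun x => by
    obtain ⟨U, _, hx, l, _, hl⟩ := gα x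
    exact ⟨l x, hl x hx⟩
  -- A line bundle need not have a global nowhere vanishing section, so the spanning vectors are
  -- chosen point by point, without continuity.
  choose l hl hlL using hex
  obtain rfl : Lα = fun x => Submodule.span ℂ {l x} := funext hlL
  have hl' := fun x => hnull x (l x) (hl x) rfl
  have sα := gα.isSmoothNullLine hV.isSubbundle hV.isNondegenerate hl fun _ => rfl
  have sβ := gβ.isSmoothNullLine hV.isSubbundle hV.isNondegenerate
    (fun x => (hl x).star (hr x)) fun x => conjSpace_span_singleton _
  have sh := gh.isSmoothNullLine hV.isSubbundle hV.isNondegenerate hl'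
    fun x => hatLine_span (h x) (hl x) α β
  have hc : (α - 1) / (α + 1) ≠ 0 := dressFactor_ne_zero hα1.symm
    (fun h => hα1' (by rw [h, neg_neg]))
  have hc' : (1 - β) / (1 + β) ≠ 0 := dressFactor_ne_zero hβ1 hβ1'
  have hgk := fun x => gaugeAt_mul_inv (h x) (hl x) (hl' x) hc hc'
  have hkg := fun x => gaugeInvAt_mul (h x) (hl x) (hl' x) hc hc'
  have r1 := fun x => rStar_span (h x) (hl x) (hl' x) ((1 : ℂ) : OnePoint ℂ)
  have r0 := fun x => rStar_span (h x) (hl x) (hl' x) ((0 : ℂ) : OnePoint ℂ)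
  have ri := fun x => rStar_span (h x) (hl x) (hl' x) OnePoint.infty
  -- At `0` the factor `p` is the identity, and at `∞` the factor `q` is. So `r(0)` and `r(∞)` are
  -- the involutions of eigenvalue -1 for `L̂` and `Lα` respectively.
  simp only [OnePoint.elim_some, OnePoint.elim_infty, zero_sub, zero_add, sub_zero, add_zero,
    neg_div, div_self hα₀, div_self hβ₀, nullDress_one, mul_one, one_mul] at r1 r0 ri
  have ek : ∀ x, Ring.inverse (rStar (V x) α β (Submodule.span ℂ {l x})
      (conjSpace (Submodule.span ℂ {l x})) ((1 : ℂ) : OnePoint ℂ)) =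
      gaugeInvAt (reflection (V x)) α β (l x)
        (nullDress (reflection (V x)) (l x) ((α - β) / (α + β)) (star (l x))) := fun x => by
    rw [r1]; exact ringInverse_eq (hgk x) (hkg x)
  have eV : backlundBundle V α β (fun x => Submodule.span ℂ {l x})
      (fun x => conjSpace (Submodule.span ℂ {l x})) = fun x => image (gaugeInvAt (reflection (V x))
        α β (l x) (nullDress (reflection (V x)) (l x) ((α - β) / (α + β)) (star (l x)))) (V x) :=
    funext fun x => by rw [backlundBundle, ek]
  rw [eV]
  refine isRealConstrainedHarmonic_image hV hα₀ hβ hα1 hα1' hβ1 hβ1' hαβ hαβ' sα sβ sh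
    (fun _ => rfl) hpar (fun x X => ?_)
  have hAd : ∀ (T ξ : CEnd n), Ad T ξ = T * ξ * Ring.inverse T := fun _ _ => rfl
  have e : backlundForm V q α β (fun x => Submodule.span ℂ {l x})
      (fun x => conjSpace (Submodule.span ℂ {l x})) x X = Ad _ (Ad _ (part10 q x X)
        + Ad _ (part01 q x X)) := rfl
  rw [e, hAd, hAd, hAd, ek, r0, ri,
    ringInverse_eq (nullDress_neg_one_sq (h x) (hl x)) (nullDress_neg_one_sq (h x) (hl x)),
    ringInverse_eq (nullDress_neg_one_sq (h x) (hl' x)) (nullDress_neg_one_sq (h x) (hl' x)),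
    ringInverse_eq (hkg x) (hgk x)]
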